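/- **Multiplication rules in the GTA basis of $\mathrm{SLF}(\bar U_q)$.** Let $p\ge 2$, $q=e^{i\pi/p}$ and $[n]=\frac{q^n-q^{-n}}{q-q^{-1}}$. Let $\bar U_q=\bar U_q(\mathfrak{sl}_2)$ be the restricted quantum group: the $\mathbb C$-algebra generated by $E,F,K$ with relations $$E^p=F^p=0,\quad K^{2p}=1,\quad KE=q^2EK,\quad KF=q^{-2}FK,\quad EF=FE+\frac{K-K^{-1}}{q-q^{-1}},$$ with coproduct $\Delta(E)=1\otimes E+E\otimes K$, $\Delta(F)=F\otimes 1+K^{-1}\otimes F$, $\Delta(K)=K\otimes K$ and counit $\varepsilon(E)=\varepsilon(F)=0$, $\varepsilon(K)=1$. Let $\mathrm{SLF}(\bar U_q)=\{\varphi\in\bar U_q^*:\varphi(xy)=\varphi(yx)\ \forall x,y\}$, a subalgebra of $\bar U_q^*$ for the product $(\varphi\psi)(x)=(\varphi\otimes\psi)(\Delta(x))$ with unit $\varepsilon$. For $\alpha\in\{+,-\}=\{\pm1\}$ and $1\le s\le p$, let $\chi^\alpha_s$ be the character of the simple module $\mathcal X^\alpha(s)$ with basis $v_0,\dots,v_{s-1}$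 and action $$Kv_i=\alpha q^{s-1-2i}v_i,\quad Ev_i=\alpha[i][s-i]v_{i-1}\ (Ev_0=0),\quad Fv_i=v_{i+1}\ (Fv_{s-1}=0).$$ For $1\le s\le p-1$ let $\mathcal P^\alpha(s)$ be the projective module with basis $b_i,a_i$ $(0\le i\le s-1)$, $x_j,y_j$ $(0\le j\le p-s-1)$ and action $$Kb_i=\alpha q^{s-1-2i}b_i,\quad Ka_i=\alpha q^{s-1-2i}a_i,\quad Kx_j=-\alpha q^{p-s-1-2j}x_j,\quad Ky_j=-\alpha q^{p-s-1-2j}y_j,$$ $$Eb_i=\alpha[i][s-i]b_{i-1}+a_{i-1}\ (i\ge1),\quad Eb_0=x_{p-s-1},\quad Ea_i=\alpha[i][s-i]a_{i-1},\quad Ea_0=0,$$ $$Ex_j=-\alpha[j][p-s-j]x_{j-1},\quad Ex_0=0,\quad Ey_j=-\alpha[j][p-s-j]y_{j-1}\ (j\ge1),\quad Ey_0=a_{s-1},$$ $$Fb_i=b_{i+1},\quad Fb_{s-1}=y_0,\quad Fx_j=x_{j+1},\quad Fx_{p-s-1}=a_0,\quad Fy_j=y_{j+1},\quad Fy_{p-s-1}=0,\quad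 Fa_i=a_{i+1},\quad Fa_{s-1}=0.$$ Let $H^\alpha_s(x)$ be the $s\times s$ block, with rows $(a_l)$ and columns $(b_i)$, of the matrix of $x\in\bar U_q$ on $\mathcal P^\alpha(s)$, and put $G_s=\mathrm{tr}(H^+_s)+\mathrm{tr}(H^-_{p-s})$ for $1\le s\le p-1$; put $G_0=G_p=0$. Then the forms $\chi^\pm_s$ $(1\le s\le p)$ and $G_s$ $(1\le s\le p-1)$ lie in $\mathrm{SLF}(\bar U_q)$ and are a basis of it (the GTA basis), the algebra $\mathrm{SLF}(\bar U_q)$ is commutative with unit $\chi^+_1=\varepsilon$, and the following rules hold: 1. $\chi^-_1\chi^\alpha_s=\chi^{-\alpha}_s$ for $1\le s\le p$; $\ \chi^+_2\chi^\alpha_s=\chi^\alpha_{s-1}+\chi^\alpha_{s+1}$ for $2\le s\le p-1$; $\ \chi^+_2\chi^\alpha_p=2\chi^\alpha_{p-1}+2\chi^{-\alpha}_1$; 2. $\chi^+_2G_1=[2]G_2$; 3. $\chi^+_2G_s=\frac{[s-1]}{[s]}G_{s-1}+\frac{[s+1]}{[s]}G_{s+1}$ for $2\le s\le p-2$; 4.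 $\chi^+_2G_{p-1}=[2]G_{p-2}$; 5. $\chi^-_1G_s=-G_{p-s}$ for $1\le s\le p-1$; 6. $G_sG_t=0$ for $1\le s,t\le p-1$. (For $p=2$, rules 2 and 4 both say $\chi^+_2G_1=0$.) Moreover these rules determine the multiplication entirely: the product of $\mathrm{SLF}(\bar U_q)$ is the only commutative and associative bilinear product on this vector space that has unit $\chi^+_1$ and satisfies rules 1–6. -/

import Mathlib

open scoped TensorProduct

noncomputable section

namespace RestrictedQuantumGroup

/-! ### Scalars -/

/-- `q = exp(iπ/p)`, a primitive root of unity of order `2p` (for `p ≥ 1`). -/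
def q (p : ℕ) : ℂ := Complex.exp (Real.pi * Complex.I / p)

/-- The `q`-integer `[n] = (q^n - q^{-n}) / (q - q^{-1})`. -/
def qInt (p : ℕ) (n : ℤ) : ℂ := (q p ^ n - q p ^ (-n)) / (q p - (q p)⁻¹)

/-- A sign `α ∈ {±1}` seen as a complex number. -/
def sgn (α : ℤˣ) : ℂ := ((α : ℤ) : ℂ)

lemma q_ne_zero (p : ℕ) : q p ≠ 0 := Complex.exp_ne_zero _

lemma q_sq (p : ℕ) : q p ^ 2 = Complex.exp (2 * Real.pi * Complex.I / p) := by
  rw [q, ← Complex.exp_nat_mul]; congr 1; push_cast; ring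

lemma q_sq_primitive (p : ℕ) (hp : p ≠ 0) : IsPrimitiveRoot (q p ^ 2) p := by
  rw [q_sq]; exact Complex.isPrimitiveRoot_exp p hp

lemma q_pow_p (p : ℕ) (hp : p ≠ 0) : q p ^ p = -1 := by
  rw [q, ← Complex.exp_nat_mul]
  have : (p : ℂ) ≠ 0 := by exact_mod_cast hp
  rw [mul_div_cancel₀ _ this, Complex.exp_pi_mul_I]

lemma q_pow_two_p (p : ℕ) (hp : p ≠ 0) : q p ^ (2 * p) = 1 := by
  rw [mul_comm, pow_mul, q_pow_p p hp]; norm_num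

lemma sgn_sq (α : ℤˣ) : sgn α * sgn α = 1 := by
  rcases Int.units_eq_one_or α with rfl | rfl <;> simp [sgn]

lemma sgn_neg (α : ℤˣ) : sgn (-α) = -sgn α := by simp [sgn]

lemma sgn_ne_zero (α : ℤˣ) : sgn α ≠ 0 := fun h => by simpa [h] using sgn_sq α

lemma qInt_zero (p : ℕ) : qInt p 0 = 0 := by simp [qInt]

lemma qInt_comm (p : ℕ) (s i : ℤ) :
    qInt p (i + 1) * qInt p (s - (i + 1)) - qInt p i * qInt p (s - i) = qInt p (s - 1 - 2 * i) := by
  by_cases h : q p - (q p)⁻¹ = 0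
  · simp [qInt, h]
  · have h0 := q_ne_zero p
    have e1 : qInt p (i + 1) = (q p ^ i * q p - (q p ^ i)⁻¹ * (q p)⁻¹) / (q p - (q p)⁻¹) := by
      rw [qInt, zpow_neg, zpow_add₀ h0, zpow_one, mul_inv]
    have e2 : qInt p (s - (i + 1)) = (q p ^ s * (q p ^ i)⁻¹ * (q p)⁻¹
        - (q p ^ s)⁻¹ * q p ^ i * q p) / (q p - (q p)⁻¹) := by
      rw [qInt, zpow_neg, zpow_sub₀ h0, zpow_add₀ h0, zpow_one]
      simp only [div_eq_mul_inv, mul_inv, inv_inv]; ring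
    have e3 : qInt p (s - i) = (q p ^ s * (q p ^ i)⁻¹
        - (q p ^ s)⁻¹ * q p ^ i) / (q p - (q p)⁻¹) := by
      rw [qInt, zpow_neg, zpow_sub₀ h0]
      simp only [div_eq_mul_inv, mul_inv, inv_inv]
    have e4 : qInt p i = (q p ^ i - (q p ^ i)⁻¹) / (q p - (q p)⁻¹) := by
      rw [qInt, zpow_neg]
    have e5 : qInt p (s - 1 - 2 * i) = (q p ^ s * (q p)⁻¹ * (q p ^ i)⁻¹ * (q p ^ i)⁻¹
        - (q p ^ s)⁻¹ * q p * q p ^ i * q p ^ i) / (q p - (q p)⁻¹) := by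
      rw [qInt, zpow_neg, zpow_sub₀ h0, zpow_sub₀ h0, zpow_one, two_mul, zpow_add₀ h0]
      simp only [div_eq_mul_inv, mul_inv, inv_inv]; ring
    rw [e1, e2, e3, e4, e5]
    have hi : q p ^ i ≠ 0 := zpow_ne_zero _ h0
    have hs : q p ^ s ≠ 0 := zpow_ne_zero _ h0
    rw [div_mul_div_comm, div_mul_div_comm, ← sub_div, div_eq_div_iff (mul_ne_zero h h) h]
    generalize q p ^ i = a at *
    generalize q p ^ s = b at *
    generalize q p = x at *
    field_simp
    ring

/-! ### The algebra `Ū_q(sl₂)` -/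

/-- The defining relations of `Ū_q(sl₂)`, for three elements of a `ℂ`-algebra.  Here `K⁻¹` is
`K^{2p-1}`, which is the inverse of `K` because `K^{2p} = 1`. -/
structure UqRelations (p : ℕ) {A : Type*} [Ring A] [Algebra ℂ A] (e f k : A) : Prop where
  E_pow : e ^ p = 0
  F_pow : f ^ p = 0
  K_pow : k ^ (2 * p) = 1
  KE : k * e = (q p ^ 2) • (e * k)
  KF : k * f = ((q p ^ 2)⁻¹) • (f * k)
  EF : e * f = f * e + (q p - (q p)⁻¹)⁻¹ • (k - k ^ (2 * p - 1))

/-- The three generators. -/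
inductive Gen
  | E
  | F
  | K

/-- The same relations, as a relation on the free algebra generated by `E`, `F`, `K`. -/
inductive Rel (p : ℕ) : FreeAlgebra ℂ Gen → FreeAlgebra ℂ Gen → Prop
  | E_pow : Rel p (FreeAlgebra.ι ℂ Gen.E ^ p) 0
  | F_pow : Rel p (FreeAlgebra.ι ℂ Gen.F ^ p) 0
  | K_pow : Rel p (FreeAlgebra.ι ℂ Gen.K ^ (2 * p)) 1
  | KE : Rel p (FreeAlgebra.ι ℂ Gen.K * FreeAlgebra.ι ℂ Gen.E)
      ((q p ^ 2) • (FreeAlgebra.ι ℂ Gen.E * FreeAlgebra.ι ℂ Gen.K))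
  | KF : Rel p (FreeAlgebra.ι ℂ Gen.K * FreeAlgebra.ι ℂ Gen.F)
      (((q p ^ 2)⁻¹) • (FreeAlgebra.ι ℂ Gen.F * FreeAlgebra.ι ℂ Gen.K))
  | EF : Rel p (FreeAlgebra.ι ℂ Gen.E * FreeAlgebra.ι ℂ Gen.F)
      (FreeAlgebra.ι ℂ Gen.F * FreeAlgebra.ι ℂ Gen.E + (q p - (q p)⁻¹)⁻¹ •
        (FreeAlgebra.ι ℂ Gen.K - FreeAlgebra.ι ℂ Gen.K ^ (2 * p - 1)))

/-- The restricted quantum group `Ū_q(sl₂)` at `q = exp(iπ/p)`: the `ℂ`-algebra generated by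
`E`, `F`, `K` with the relations `Rel p`. -/
def Uq (p : ℕ) : Type := RingQuot (Rel p)

instance (p : ℕ) : Ring (Uq p) := inferInstanceAs (Ring (RingQuot (Rel p)))

instance (p : ℕ) : Algebra ℂ (Uq p) := inferInstanceAs (Algebra ℂ (RingQuot (Rel p)))

namespace Uq

/-- The projection from the free algebra. -/
def mk (p : ℕ) : FreeAlgebra ℂ Gen →ₐ[ℂ] Uq p := RingQuot.mkAlgHom ℂ (Rel p)

def E (p : ℕ) : Uq p := mk p (FreeAlgebra.ι ℂ Gen.E)

def F (p : ℕ) : Uq p := mk p (FreeAlgebra.ι ℂ Gen.F)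

def K (p : ℕ) : Uq p := mk p (FreeAlgebra.ι ℂ Gen.K)

/-- `K⁻¹ = K^{2p-1}`. -/
def Kinv (p : ℕ) : Uq p := K p ^ (2 * p - 1)

lemma mk_rel {p : ℕ} {x y : FreeAlgebra ℂ Gen} (h : Rel p x y) : mk p x = mk p y :=
  RingQuot.mkAlgHom_rel ℂ h

lemma relations (p : ℕ) : UqRelations p (E p) (F p) (K p) where
  E_pow := by simpa [E] using mk_rel (Rel.E_pow (p := p))
  F_pow := by simpa [F] using mk_rel (Rel.F_pow (p := p))
  K_pow := by simpa [K] using mk_rel (Rel.K_pow (p := p))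
  KE := by simpa [E, K] using mk_rel (Rel.KE (p := p))
  KF := by simpa [F, K] using mk_rel (Rel.KF (p := p))
  EF := by simpa [E, F, K] using mk_rel (Rel.EF (p := p))

/-- The images of the three generators. -/
def genMap {A : Type*} (e f k : A) : Gen → A
  | Gen.E => e
  | Gen.F => f
  | Gen.K => k

/-- The universal property of `Ū_q`. -/
def lift {p : ℕ} {A : Type*} [Ring A] [Algebra ℂ A] (e f k : A) (h : UqRelations p e f k) :
    Uq p →ₐ[ℂ] A :=
  RingQuot.liftAlgHom ℂ (s := Rel p) ⟨FreeAlgebra.lift ℂ (genMap e f k), by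
    intro x y hxy
    cases hxy
    · simpa [genMap] using h.E_pow
    · simpa [genMap] using h.F_pow
    · simpa [genMap] using h.K_pow
    · simpa [genMap] using h.KE
    · simpa [genMap] using h.KF
    · simpa [genMap] using h.EF⟩

section lift

variable {p : ℕ} {A : Type*} [Ring A] [Algebra ℂ A] {e f k : A} (h : UqRelations p e f k)

lemma lift_mk (x : FreeAlgebra ℂ Gen) :
    lift e f k h (mk p x) = FreeAlgebra.lift ℂ (genMap e f k) x :=
  RingQuot.liftAlgHom_mkAlgHom_apply ℂ _ _ x

@[simp] lemma lift_E : lift e f k h (E p) = e := by simp [E, lift_mk, genMap]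

@[simp] lemma lift_F : lift e f k h (F p) = f := by simp [F, lift_mk, genMap]

@[simp] lemma lift_K : lift e f k h (K p) = k := by simp [K, lift_mk, genMap]

end lift

lemma induction_gen {p : ℕ} (C : Uq p → Prop) (hc : ∀ r : ℂ, C (algebraMap ℂ _ r))
    (hE : C (E p)) (hF : C (F p)) (hK : C (K p)) (hadd : ∀ x y, C x → C y → C (x + y))
    (hmul : ∀ x y, C x → C y → C (x * y)) (x : Uq p) : C x := by
  obtain ⟨x, rfl⟩ : ∃ z, mk p z = x := RingQuot.mkAlgHom_surjective ℂ (Rel p) x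
  induction x using FreeAlgebra.induction with
  | grade0 r => rw [AlgHom.commutes]; exact hc r
  | grade1 g => cases g <;> assumption
  | mul a b ha hb => rw [map_mul]; exact hmul _ _ ha hb
  | add a b ha hb => rw [map_add]; exact hadd _ _ ha hb

lemma algHom_ext {p : ℕ} {A : Type*} [Ring A] [Algebra ℂ A] {u v : Uq p →ₐ[ℂ] A}
    (hE : u (E p) = v (E p)) (hF : u (F p) = v (F p)) (hK : u (K p) = v (K p)) : u = v := by
  ext x
  induction x using induction_gen with
  | hc r => rw [AlgHom.commutes, AlgHom.commutes]
  | hE => exact hE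
  | hF => exact hF
  | hK => exact hK
  | hadd x y hx hy => rw [map_add, map_add, hx, hy]
  | hmul x y hx hy => rw [map_mul, map_mul, hx, hy]

end Uq

/-! ### The noncommutative binomial formula at a root of unity -/

/-- Gaussian binomial coefficients. -/
def gaussBinom (r : ℂ) : ℕ → ℕ → ℂ
  | _, 0 => 1
  | 0, _ + 1 => 0
  | n + 1, k + 1 => gaussBinom r n k + r ^ (k + 1) * gaussBinom r n (k + 1)

lemma gaussBinom_zero_right (r : ℂ) (n : ℕ) : gaussBinom r n 0 = 1 := by
  cases n <;> rfl

lemma gaussBinom_of_lt (r : ℂ) (n k : ℕ) (h : n < k) : gaussBinom r n k = 0 := by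
  induction n generalizing k with
  | zero => obtain ⟨k, rfl⟩ := Nat.exists_eq_succ_of_ne_zero h.ne'; rfl
  | succ n ih =>
    obtain ⟨k, rfl⟩ := Nat.exists_eq_succ_of_ne_zero (Nat.ne_zero_of_lt h)
    rw [gaussBinom, ih k (by omega), ih (k + 1) (by omega)]; simp

lemma gaussBinom_self (r : ℂ) (n : ℕ) : gaussBinom r n n = 1 := by
  induction n with
  | zero => rfl
  | succ n ih => rw [gaussBinom, ih, gaussBinom_of_lt r n (n + 1) (by omega)]; simp

lemma gaussBinom_rec (r : ℂ) (n k : ℕ) :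
    gaussBinom r n (k + 1) * (1 - r ^ (k + 1)) * r ^ k = gaussBinom r n k * (r ^ k - r ^ n) := by
  induction n generalizing k with
  | zero =>
    cases k with
    | zero => simp [gaussBinom]
    | succ k => simp [gaussBinom]
  | succ n ih =>
    cases k with
    | zero =>
      have := ih 0
      simp only [gaussBinom_zero_right, gaussBinom] at this ⊢
      simp only [zero_add, pow_one, pow_zero, mul_one, one_mul] at this ⊢
      rw [add_mul, mul_assoc, this]; ring
    | succ k =>
      have h1 := ih (k + 1)
      have h2 := ih k
      rw [show gaussBinom r (n + 1) (k + 1 + 1) = gaussBinom r n (k + 1)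
        + r ^ (k + 1 + 1) * gaussBinom r n (k + 1 + 1) from rfl,
        show gaussBinom r (n + 1) (k + 1) = gaussBinom r n k
        + r ^ (k + 1) * gaussBinom r n (k + 1) from rfl]
      linear_combination r ^ (k + 1 + 1) * h1 + r * h2

lemma gaussBinom_vanish {r : ℂ} {p : ℕ} (hr : IsPrimitiveRoot r p) (k : ℕ) (hk : 0 < k)
    (hkp : k < p) : gaussBinom r p k = 0 := by
  have hr0 : r ≠ 0 := hr.ne_zero (by omega)
  induction k with
  | zero => omega
  | succ k ih =>
    have h := gaussBinom_rec r p k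
    have hz : gaussBinom r p k * (r ^ k - r ^ p) = 0 := by
      cases k with
      | zero => simp [hr.pow_eq_one]
      | succ k => rw [ih (by omega) (by omega), zero_mul]
    rw [hz] at h
    have h1 : (1 - r ^ (k + 1)) ≠ 0 := fun h0 =>
      hr.pow_ne_one_of_pos_of_lt (by omega) hkp (sub_eq_zero.mp h0).symm
    simpa [h1, hr0] using h

lemma skew_comm {A : Type*} [Ring A] [Algebra ℂ A] {r : ℂ} {x y : A} (h : y * x = r • (x * y))
    (k : ℕ) : y * x ^ k = r ^ k • (x ^ k * y) := by
  induction k with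
  | zero => simp
  | succ k ih =>
    rw [pow_succ, ← mul_assoc, ih, smul_mul_assoc, mul_assoc, h, mul_smul_comm, smul_smul,
      ← pow_succ, mul_assoc]

lemma skew_add_pow {A : Type*} [Ring A] [Algebra ℂ A] {r : ℂ} {x y : A}
    (h : y * x = r • (x * y)) (n : ℕ) :
    (x + y) ^ n = ∑ k ∈ Finset.range (n + 1), gaussBinom r n k • (x ^ k * y ^ (n - k)) := by
  induction n with
  | zero => simp [gaussBinom]
  | succ n ih =>
    rw [pow_succ', ih, add_mul, Finset.mul_sum, Finset.mul_sum]
    have hx : ∀ k ∈ Finset.range (n + 1), x * gaussBinom r n k • (x ^ k * y ^ (n - k))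
        = gaussBinom r n k • (x ^ (k + 1) * y ^ (n - k)) := fun k _ => by
      rw [mul_smul_comm, ← mul_assoc, ← pow_succ']
    have hy : ∀ k ∈ Finset.range (n + 1), y * gaussBinom r n k • (x ^ k * y ^ (n - k))
        = (r ^ k * gaussBinom r n k) • (x ^ k * y ^ (n + 1 - k)) := fun k hk => by
      rw [mul_smul_comm, ← mul_assoc, skew_comm h, smul_mul_assoc, mul_assoc, ← pow_succ',
        smul_smul, mul_comm (r ^ k),
        show n - k + 1 = n + 1 - k by have := Finset.mem_range.mp hk; omega]
    rw [Finset.sum_congr rfl hx, Finset.sum_congr rfl hy]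
    have hy2 : ∑ k ∈ Finset.range (n + 1), (r ^ k * gaussBinom r n k) • (x ^ k * y ^ (n + 1 - k))
        = ∑ k ∈ Finset.range (n + 2), (r ^ k * gaussBinom r n k) • (x ^ k * y ^ (n + 1 - k)) := by
      rw [Finset.sum_range_succ _ (n + 1), gaussBinom_of_lt r n (n + 1) (by omega)]; simp
    rw [hy2, Finset.sum_range_succ' _ (n + 1), Finset.sum_range_succ' _ (n + 1), ← add_assoc,
      ← Finset.sum_add_distrib]
    congr 1
    · refine Finset.sum_congr rfl fun k _ => ?_
      rw [gaussBinom, add_smul, show n + 1 - (k + 1) = n - k by omega]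
    · simp [gaussBinom_zero_right]

lemma skew_add_pow_root {A : Type*} [Ring A] [Algebra ℂ A] {r : ℂ} {x y : A} {p : ℕ}
    (hp : p ≠ 0) (hr : IsPrimitiveRoot r p) (h : y * x = r • (x * y)) :
    (x + y) ^ p = x ^ p + y ^ p := by
  rw [skew_add_pow h, Finset.sum_range_succ, gaussBinom_self]
  obtain ⟨m, rfl⟩ := Nat.exists_eq_succ_of_ne_zero hp
  rw [Finset.sum_range_succ', Finset.sum_eq_zero]
  · simp [gaussBinom_zero_right, add_comm]
  · intro k hk
    rw [gaussBinom_vanish hr (k + 1) (by omega) (by have := Finset.mem_range.mp hk; omega),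
      zero_smul]

/-! ### The bialgebra structure of `Ū_q(sl₂)` -/

namespace Uq

section

variable (p : ℕ)

lemma K_mul_Kinv (hp : p ≠ 0) : K p * Kinv p = 1 := by
  rw [Kinv, ← pow_succ', show 2 * p - 1 + 1 = 2 * p by omega, (relations p).K_pow]

lemma Kinv_mul_K (hp : p ≠ 0) : Kinv p * K p = 1 := by
  rw [Kinv, ← pow_succ, show 2 * p - 1 + 1 = 2 * p by omega, (relations p).K_pow]

lemma EK : E p * K p = (q p ^ 2)⁻¹ • (K p * E p) := by
  rw [(relations p).KE, smul_smul, inv_mul_cancel₀ (pow_ne_zero _ (q_ne_zero p)), one_smul]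

lemma FK : F p * K p = (q p ^ 2) • (K p * F p) := by
  rw [(relations p).KF, smul_smul, mul_inv_cancel₀ (pow_ne_zero _ (q_ne_zero p)), one_smul]

lemma Kinv_E (hp : p ≠ 0) : Kinv p * E p = (q p ^ 2)⁻¹ • (E p * Kinv p) := by
  calc Kinv p * E p = Kinv p * (E p * K p) * Kinv p := by
        rw [mul_assoc, mul_assoc, K_mul_Kinv p hp, mul_one]
    _ = _ := by
        rw [EK, mul_smul_comm, ← mul_assoc, Kinv_mul_K p hp, one_mul, smul_mul_assoc]

lemma Kinv_F (hp : p ≠ 0) : Kinv p * F p = (q p ^ 2) • (F p * Kinv p) := by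
  calc Kinv p * F p = Kinv p * (F p * K p) * Kinv p := by
        rw [mul_assoc, mul_assoc, K_mul_Kinv p hp, mul_one]
    _ = _ := by
        rw [FK, mul_smul_comm, ← mul_assoc, Kinv_mul_K p hp, one_mul, smul_mul_assoc]

lemma E_Kinv (hp : p ≠ 0) : E p * Kinv p = (q p ^ 2) • (Kinv p * E p) := by
  rw [Kinv_E p hp, smul_smul, mul_inv_cancel₀ (pow_ne_zero _ (q_ne_zero p)), one_smul]

lemma comul_relations [NeZero p] :
    UqRelations p (1 ⊗ₜ[ℂ] E p + E p ⊗ₜ[ℂ] K p) (F p ⊗ₜ[ℂ] 1 + Kinv p ⊗ₜ[ℂ] F p)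
      (K p ⊗ₜ[ℂ] K p) := by
  have hp : p ≠ 0 := NeZero.ne p
  have hq2 : q p ^ 2 ≠ 0 := pow_ne_zero _ (q_ne_zero p)
  have R := relations p
  refine ⟨?_, ?_, ?_, ?_, ?_, ?_⟩
  · rw [skew_add_pow_root hp (q_sq_primitive p hp)]
    · simp [Algebra.TensorProduct.tmul_pow, R.E_pow]
    · simp [R.KE]
  · rw [skew_add_pow_root hp (q_sq_primitive p hp)]
    · simp [Algebra.TensorProduct.tmul_pow, R.F_pow]
    · simp [Kinv_F p hp, TensorProduct.smul_tmul']
  · simp [Algebra.TensorProduct.tmul_pow, R.K_pow, Algebra.TensorProduct.one_def]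
  · simp [mul_add, add_mul, R.KE, TensorProduct.smul_tmul']
  · have hc : K p * Kinv p = Kinv p * K p := by rw [K_mul_Kinv p hp, Kinv_mul_K p hp]
    simp [mul_add, add_mul, R.KF, TensorProduct.smul_tmul', hc]
  · have hcross : (E p * Kinv p) ⊗ₜ[ℂ] (K p * F p) = (Kinv p * E p) ⊗ₜ[ℂ] (F p * K p) := by
      rw [E_Kinv p hp, R.KF, TensorProduct.smul_tmul, smul_smul, mul_inv_cancel₀ hq2, one_smul]
    rw [Algebra.TensorProduct.tmul_pow]
    change _ = _ + (q p - (q p)⁻¹)⁻¹ • (K p ⊗ₜ[ℂ] K p - Kinv p ⊗ₜ[ℂ] Kinv p)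
    have hEF : E p * F p = F p * E p + (q p - (q p)⁻¹)⁻¹ • (K p - Kinv p) := R.EF
    simp only [mul_add, add_mul, Algebra.TensorProduct.tmul_mul_tmul, mul_one, one_mul, hcross]
    rw [hEF, TensorProduct.tmul_add, TensorProduct.add_tmul, TensorProduct.tmul_smul,
      ← TensorProduct.smul_tmul', TensorProduct.tmul_sub, TensorProduct.sub_tmul, smul_sub,
      smul_sub, smul_sub]
    abel

/-- The comultiplication: `Δ(E) = 1 ⊗ E + E ⊗ K`, `Δ(F) = F ⊗ 1 + K⁻¹ ⊗ F`, `Δ(K) = K ⊗ K`. -/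
def comulHom [NeZero p] : Uq p →ₐ[ℂ] Uq p ⊗[ℂ] Uq p :=
  lift (1 ⊗ₜ[ℂ] E p + E p ⊗ₜ[ℂ] K p) (F p ⊗ₜ[ℂ] 1 + Kinv p ⊗ₜ[ℂ] F p) (K p ⊗ₜ[ℂ] K p)
    (comul_relations p)

lemma counit_relations [NeZero p] : UqRelations p (0 : ℂ) 0 1 := by
  have hp : p ≠ 0 := NeZero.ne p
  constructor <;> simp [hp]

/-- The counit: `ε(E) = ε(F) = 0`, `ε(K) = 1`. -/
def counitHom [NeZero p] : Uq p →ₐ[ℂ] ℂ := lift 0 0 1 (counit_relations p)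

@[simp] lemma comulHom_E [NeZero p] : comulHom p (E p) = 1 ⊗ₜ[ℂ] E p + E p ⊗ₜ[ℂ] K p :=
  lift_E _

@[simp] lemma comulHom_F [NeZero p] : comulHom p (F p) = F p ⊗ₜ[ℂ] 1 + Kinv p ⊗ₜ[ℂ] F p :=
  lift_F _

@[simp] lemma comulHom_K [NeZero p] : comulHom p (K p) = K p ⊗ₜ[ℂ] K p := lift_K _

@[simp] lemma comulHom_Kinv [NeZero p] : comulHom p (Kinv p) = Kinv p ⊗ₜ[ℂ] Kinv p := by
  simp [Kinv, Algebra.TensorProduct.tmul_pow]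

@[simp] lemma counitHom_E [NeZero p] : counitHom p (E p) = 0 := lift_E _

@[simp] lemma counitHom_F [NeZero p] : counitHom p (F p) = 0 := lift_F _

@[simp] lemma counitHom_K [NeZero p] : counitHom p (K p) = 1 := lift_K _

@[simp] lemma counitHom_Kinv [NeZero p] : counitHom p (Kinv p) = 1 := by simp [Kinv]

end

/-- The bialgebra structure of `Ū_q(sl₂)`. -/
instance (p : ℕ) [NeZero p] : Bialgebra ℂ (Uq p) :=
  Bialgebra.ofAlgHom (comulHom p) (counitHom p)
    (by
      apply algHom_ext <;>
        simp [TensorProduct.add_tmul, TensorProduct.tmul_add, Algebra.TensorProduct.one_def,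
          add_assoc])
    (by apply algHom_ext <;> simp)
    (by apply algHom_ext <;> simp)

lemma comul_apply (p : ℕ) [NeZero p] (x : Uq p) :
    Coalgebra.comul (R := ℂ) x = comulHom p x := rfl

lemma comul_mul (p : ℕ) [NeZero p] (x y : Uq p) :
    Coalgebra.comul (R := ℂ) (x * y) = comulHom p x * comulHom p y := map_mul (comulHom p) x y

end Uq

/-! ### Symmetric linear forms -/

/-- The algebra `SLF(Ū_q)` of symmetric linear forms, a subalgebra of the dual algebra `Ū_q*`,
whose product is `(φψ)(x) = (φ ⊗ ψ)(Δ(x))` and whose unit is the counit `ε` (in Mathlib, `Ū_q*`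
with this product is written `WithConv (Uq p →ₗ[ℂ] ℂ)`). -/
def SLF (p : ℕ) [NeZero p] : Subalgebra ℂ (WithConv (Uq p →ₗ[ℂ] ℂ)) where
  carrier := {φ | ∀ x y : Uq p, φ.ofConv (x * y) = φ.ofConv (y * x)}
  mul_mem' := by
    intro φ ψ hφ hψ x y
    have key : ∀ u v : Uq p ⊗[ℂ] Uq p,
        LinearMap.mul' ℂ ℂ (TensorProduct.map φ.ofConv ψ.ofConv (u * v))
          = LinearMap.mul' ℂ ℂ (TensorProduct.map φ.ofConv ψ.ofConv (v * u)) := by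
      intro u v
      induction u using TensorProduct.induction_on with
      | zero => simp
      | add a b ha hb => rw [add_mul, mul_add, map_add, map_add, map_add, map_add, ha, hb]
      | tmul a b =>
        induction v using TensorProduct.induction_on with
        | zero => simp
        | add c d hc hd => rw [add_mul, mul_add, map_add, map_add, map_add, map_add, hc, hd]
        | tmul c d =>
          simp only [Algebra.TensorProduct.tmul_mul_tmul, TensorProduct.map_tmul,
            LinearMap.mul'_apply]
          rw [hφ, hψ]
    change LinearMap.mul' ℂ ℂ (TensorProduct.map φ.ofConv ψ.ofConv (Coalgebra.comul (x * y)))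
      = LinearMap.mul' ℂ ℂ (TensorProduct.map φ.ofConv ψ.ofConv (Coalgebra.comul (y * x)))
    rw [Uq.comul_mul, Uq.comul_mul, key]
  add_mem' := by
    intro φ ψ hφ hψ x y
    change φ.ofConv (x * y) + ψ.ofConv (x * y) = φ.ofConv (y * x) + ψ.ofConv (y * x)
    rw [hφ, hψ]
  algebraMap_mem' := by
    intro r x y
    change r • Coalgebra.counit (R := ℂ) (x * y) = r • Coalgebra.counit (R := ℂ) (y * x)
    rw [Bialgebra.counit_mul, Bialgebra.counit_mul, mul_comm]

/-! ### Auxiliary facts on linear operators given on a basis -/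

/-- The operator on the free vector space on `ι` sending the basis vector `i` to `g i`. -/
def op {ι : Type} (g : ι → (ι →₀ ℂ)) : Module.End ℂ (ι →₀ ℂ) := Finsupp.linearCombination ℂ g

/-- The basis vectors `f 0, …, f (n-1)`, extended by `0` to all natural indices. -/
def bvec {ι : Type} {n : ℕ} (f : Fin n → ι) (i : ℕ) : ι →₀ ℂ :=
  if h : i < n then Finsupp.single (f ⟨i, h⟩) 1 else 0

section

variable {ι : Type}

@[simp] lemma op_single (g : ι → (ι →₀ ℂ)) (i : ι) : op g (Finsupp.single i 1) = g i := by
  simp [op]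

lemma end_ext {ι' : Type} {S T : (ι →₀ ℂ) →ₗ[ℂ] (ι' →₀ ℂ)}
    (h : ∀ i, S (Finsupp.single i 1) = T (Finsupp.single i 1)) : S = T :=
  Finsupp.lhom_ext' fun i => LinearMap.ext_ring (h i)

lemma bvec_of_lt {n : ℕ} (f : Fin n → ι) {i : ℕ} (h : i < n) :
    bvec f i = Finsupp.single (f ⟨i, h⟩) 1 := dif_pos h

lemma bvec_of_le {n : ℕ} (f : Fin n → ι) {i : ℕ} (h : n ≤ i) : bvec f i = 0 :=
  dif_neg (by omega)

lemma op_bvec {n : ℕ} (g : ι → (ι →₀ ℂ)) (f : Fin n → ι) {i : ℕ} (h : i < n) :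
    op g (bvec f i) = g (f ⟨i, h⟩) := by rw [bvec_of_lt f h, op_single]

lemma bvec_mem {n : ℕ} (f : Fin n → ι) (S : Set ι) (i : ℕ) (h : ∀ hi : i < n, f ⟨i, hi⟩ ∈ S) :
    bvec f i ∈ Finsupp.supported ℂ ℂ S := by
  by_cases hi : i < n
  · rw [bvec_of_lt f hi]; exact Finsupp.single_mem_supported ℂ 1 (h hi)
  · rw [bvec_of_le f (by omega)]; exact zero_mem _

/-- An operator that strictly lowers a degree with values in `{0, …, p-1}` has `p`-th power `0`. -/
lemma op_pow_eq_zero (g : ι → (ι →₀ ℂ)) (d : ι → ℕ) (p : ℕ) (hd : ∀ i, d i < p)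
    (hg : ∀ i, g i ∈ Finsupp.supported ℂ ℂ {j | d j < d i}) : op g ^ p = 0 := by
  have key : ∀ n k v, v ∈ Finsupp.supported ℂ ℂ {j | d j < n + k} →
      (op g ^ k) v ∈ Finsupp.supported ℂ ℂ {j | d j < n} := by
    intro n k
    induction k with
    | zero => intro v hv; simpa using hv
    | succ k ih =>
      intro v hv
      rw [pow_succ, Module.End.mul_apply]
      apply ih
      rw [op, Finsupp.linearCombination_apply, Finsupp.sum]
      refine Submodule.sum_mem _ fun i hi => Submodule.smul_mem _ _ ?_
      have hi' : d i < n + (k + 1) := (Finsupp.mem_supported ℂ v).mp hv hi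
      refine Finsupp.supported_mono ?_ (hg i)
      intro j hj
      have hj' : d j < d i := hj
      change d j < n + k
      omega
  ext1 v
  have h := key 0 p (Finsupp.single v 1) (Finsupp.single_mem_supported ℂ 1 (by simpa using hd v))
  ext j
  have : (Finsupp.supported ℂ ℂ {j | d j < 0}) = ⊥ := by simp
  rw [this, Submodule.mem_bot] at h
  simp [h]

lemma op_pow_diag (c : ι → ℂ) (n : ℕ) (i : ι) :
    (op (fun i => c i • Finsupp.single i 1) ^ n) (Finsupp.single i 1)
      = c i ^ n • Finsupp.single i 1 := by
  induction n with
  | zero => simp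
  | succ n ih =>
    rw [pow_succ, Module.End.mul_apply, op_single, map_smul, ih, smul_smul, pow_succ']

end

/-- The weight `α q^m`, an eigenvalue of `K`. -/
def wt (p : ℕ) (α : ℤˣ) (m : ℤ) : ℂ := sgn α * q p ^ m

lemma wt_ne_zero (p : ℕ) (α : ℤˣ) (m : ℤ) : wt p α m ≠ 0 :=
  mul_ne_zero (sgn_ne_zero α) (zpow_ne_zero _ (q_ne_zero p))

lemma wt_pow (p : ℕ) (hp : p ≠ 0) (α : ℤˣ) (m : ℤ) : wt p α m ^ (2 * p) = 1 := by
  rw [wt, mul_pow, ← zpow_natCast (q p ^ m), ← zpow_mul, mul_comm m, zpow_mul, zpow_natCast,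
    q_pow_two_p p hp, one_zpow, pow_mul, pow_two, sgn_sq, one_pow, one_mul]

lemma wt_sub_inv (p : ℕ) (hp : p ≠ 0) (α : ℤˣ) (m : ℤ) :
    (q p - (q p)⁻¹)⁻¹ * (wt p α m - wt p α m ^ (2 * p - 1)) = sgn α * qInt p m := by
  have h : wt p α m ^ (2 * p - 1) = sgn α * q p ^ (-m) := by
    have h1 : wt p α m ^ (2 * p - 1) * wt p α m = 1 := by
      rw [← pow_succ, show 2 * p - 1 + 1 = 2 * p by omega, wt_pow p hp]
    refine mul_right_cancel₀ (wt_ne_zero p α m) ?_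
    rw [h1, wt, zpow_neg, mul_mul_mul_comm, sgn_sq,
      inv_mul_cancel₀ (zpow_ne_zero _ (q_ne_zero p)), one_mul]
  rw [h, wt, qInt]; ring

lemma wt_add_two (p : ℕ) (α : ℤˣ) (m : ℤ) : wt p α (m + 2) = q p ^ 2 * wt p α m := by
  rw [wt, wt, zpow_add₀ (q_ne_zero p)]
  norm_cast
  ring

lemma wt_sub_two (p : ℕ) (α : ℤˣ) (m : ℤ) : wt p α (m - 2) = (q p ^ 2)⁻¹ * wt p α m := by
  rw [eq_inv_mul_iff_mul_eq₀ (pow_ne_zero _ (q_ne_zero p)), ← wt_add_two, sub_add_cancel]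

lemma wt_neg (p : ℕ) (hp : p ≠ 0) (α : ℤˣ) (m : ℤ) : wt p (-α) m = wt p α (m + p) := by
  rw [wt, wt, zpow_add₀ (q_ne_zero p), zpow_natCast, q_pow_p p hp, sgn_neg]; ring

/-! ### The simple modules `𝒳^α(s)` -/

/-- `E` on `𝒳^α(s)`: `E v_i = α [i][s-i] v_{i-1}` (so `E v_0 = 0`, as `[0] = 0`). -/
def simpleE (p : ℕ) (α : ℤˣ) (s : ℕ) : Module.End ℂ (Fin s →₀ ℂ) :=
  op fun i => (sgn α * qInt p i * qInt p (s - i)) • bvec id ((i : ℕ) - 1)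

/-- `F` on `𝒳^α(s)`: `F v_i = v_{i+1}`, where `v_s = 0`. -/
def simpleF (s : ℕ) : Module.End ℂ (Fin s →₀ ℂ) := op fun i => bvec id ((i : ℕ) + 1)

/-- `K` on `𝒳^α(s)`: `K v_i = α q^{s-1-2i} v_i`. -/
def simpleK (p : ℕ) (α : ℤˣ) (s : ℕ) : Module.End ℂ (Fin s →₀ ℂ) :=
  op fun i => wt p α (s - 1 - 2 * (i : ℤ)) • Finsupp.single i 1

lemma simple_relations (p : ℕ) (α : ℤˣ) (s : ℕ) (hs : s ≤ p) :
    UqRelations p (simpleE p α s) (simpleF s) (simpleK p α s) := by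
  have hE : ∀ i, i < s → simpleE p α s (bvec id i)
      = (sgn α * qInt p i * qInt p (s - i)) • bvec id (i - 1) := fun i hi => op_bvec _ _ hi
  have hF : ∀ i, simpleF s (bvec id i) = bvec id (i + 1) := fun i => by
    by_cases hi : i < s
    · exact op_bvec _ _ hi
    · rw [bvec_of_le _ (by omega), bvec_of_le _ (by omega), map_zero]
  have hK : ∀ i, simpleK p α s (bvec id i) = wt p α (s - 1 - 2 * (i : ℤ)) • bvec id i := fun i => by
    by_cases hi : i < s
    · rw [simpleK, op_bvec _ _ hi, bvec_of_lt _ hi]; rfl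
    · rw [bvec_of_le _ (by omega), map_zero, smul_zero]
  have hsing : ∀ i : Fin s, (Finsupp.single i 1 : Fin s →₀ ℂ) = bvec id i := fun i =>
    (bvec_of_lt id i.2).symm
  refine ⟨?_, ?_, ?_, ?_, ?_, ?_⟩
  · refine op_pow_eq_zero _ (fun i : Fin s => (i : ℕ)) p (fun i => by have := i.2; omega) fun i => ?_
    by_cases hi : (i : ℕ) = 0
    · rw [hi]; simp [qInt_zero]
    · refine Submodule.smul_mem _ _ (bvec_mem _ _ _ fun h => ?_)
      change (i : ℕ) - 1 < i
      omega
  · refine op_pow_eq_zero _ (fun i : Fin s => s - 1 - (i : ℕ)) p (fun i => by have := i.2; omega) fun i => ?_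
    refine bvec_mem _ _ _ fun h => ?_
    change s - 1 - ((i : ℕ) + 1) < s - 1 - i
    omega
  · refine end_ext fun i => ?_
    have hp : p ≠ 0 := by have := i.2; omega
    rw [simpleK, op_pow_diag, wt_pow p hp, one_smul]; rfl
  · refine end_ext fun i => ?_
    simp only [Module.End.mul_apply, LinearMap.smul_apply, hsing, hK, hE i i.2, map_smul, smul_smul]
    by_cases hi : (i : ℕ) = 0
    · rw [hi]; simp [qInt_zero]
    · congr 1
      rw [show ((s : ℤ) - 1 - 2 * ((i - 1 : ℕ) : ℤ)) = (s - 1 - 2 * (i : ℕ)) + 2 by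
        push_cast [show 1 ≤ (i : ℕ) by omega]; ring, wt_add_two]
      ring
  · refine end_ext fun i => ?_
    simp only [Module.End.mul_apply, LinearMap.smul_apply, hsing, hK, hF, map_smul, smul_smul]
    congr 1
    rw [← wt_sub_two]
    congr 1; push_cast; ring
  · refine end_ext fun i => ?_
    have hp : p ≠ 0 := by have := i.2; omega
    have hKK : (simpleK p α s - simpleK p α s ^ (2 * p - 1)) (Finsupp.single i 1)
        = (wt p α (s - 1 - 2 * (i : ℤ)) - wt p α (s - 1 - 2 * (i : ℤ)) ^ (2 * p - 1))
          • Finsupp.single i 1 := by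
      rw [LinearMap.sub_apply, sub_smul, simpleK, op_pow_diag, op_single]
    have hEF : simpleE p α s (bvec id ((i : ℕ) + 1))
        = (sgn α * qInt p (i + 1) * qInt p (s - (i + 1))) • bvec id (i : ℕ) := by
      by_cases h : (i : ℕ) + 1 < s
      · rw [hE _ h]; push_cast; rfl
      · rw [bvec_of_le _ (by omega), map_zero,
          show ((s : ℤ) - ((i : ℕ) + 1)) = 0 by have := i.2; omega, qInt_zero]; simp
    have hFE : (sgn α * qInt p i * qInt p (s - i)) • bvec (id : Fin s → Fin s) ((i : ℕ) - 1 + 1)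
        = (sgn α * qInt p i * qInt p (s - i)) • bvec id (i : ℕ) := by
      by_cases hi : (i : ℕ) = 0
      · rw [hi]; simp [qInt_zero]
      · rw [show (i : ℕ) - 1 + 1 = i by omega]
    rw [LinearMap.add_apply, LinearMap.smul_apply, hKK, smul_smul, wt_sub_inv p hp]
    simp only [Module.End.mul_apply, hsing]
    rw [hF, hEF, hE i i.2, map_smul, hF, hFE, ← add_smul, ← qInt_comm]
    congr 1; ring

/-- The simple module `𝒳^α(s)` (`s ≤ p`), as a representation. -/
def simpleRep (p : ℕ) (α : ℤˣ) (s : ℕ) (hs : s ≤ p) : Uq p →ₐ[ℂ] Module.End ℂ (Fin s →₀ ℂ) :=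
  Uq.lift _ _ _ (simple_relations p α s hs)

/-! ### The projective modules `𝒫^α(s)` -/

/-- Indices of the standard basis `(b_i, x_j, y_k, a_l)` of `𝒫^α(s)`, where `t = p - s`. -/
abbrev PIdx (s t : ℕ) : Type := Fin s ⊕ Fin t ⊕ Fin t ⊕ Fin s

section

variable (s t : ℕ)

def ib (i : Fin s) : PIdx s t := Sum.inl i

def ix (j : Fin t) : PIdx s t := Sum.inr (Sum.inl j)

def iy (k : Fin t) : PIdx s t := Sum.inr (Sum.inr (Sum.inl k))

def ia (l : Fin s) : PIdx s t := Sum.inr (Sum.inr (Sum.inr l))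

/-- The basis vectors `b_i`, `x_j`, `y_k`, `a_l` (zero out of range). -/
def vb (i : ℕ) : PIdx s t →₀ ℂ := bvec (ib s t) i

def vx (j : ℕ) : PIdx s t →₀ ℂ := bvec (ix s t) j

def vy (k : ℕ) : PIdx s t →₀ ℂ := bvec (iy s t) k

def va (l : ℕ) : PIdx s t →₀ ℂ := bvec (ia s t) l

/-- A function on the standard basis from its values on the four families. -/
def pcases {X : Type} (fb : ℕ → X) (fx : ℕ → X) (fy : ℕ → X) (fa : ℕ → X) : PIdx s t → X
  | Sum.inl i => fb i
  | Sum.inr (Sum.inl j) => fx j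
  | Sum.inr (Sum.inr (Sum.inl k)) => fy k
  | Sum.inr (Sum.inr (Sum.inr l)) => fa l

/-- `E` on `𝒫^α(s)`, with `t = p - s`. -/
def projE (p : ℕ) (α : ℤˣ) : Module.End ℂ (PIdx s t →₀ ℂ) :=
  op (pcases s t
    (fun i => if i = 0 then vx s t (t - 1)
      else (sgn α * qInt p i * qInt p (s - i)) • vb s t (i - 1) + va s t (i - 1))
    (fun j => if j = 0 then 0 else (-sgn α * qInt p j * qInt p (t - j)) • vx s t (j - 1))
    (fun k => if k = 0 then va s t (s - 1)
      else (-sgn α * qInt p k * qInt p (t - k)) • vy s t (k - 1))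
    (fun l => if l = 0 then 0 else (sgn α * qInt p l * qInt p (s - l)) • va s t (l - 1)))

/-- `F` on `𝒫^α(s)`, with `t = p - s`. -/
def projF : Module.End ℂ (PIdx s t →₀ ℂ) :=
  op (pcases s t
    (fun i => if i + 1 = s then vy s t 0 else vb s t (i + 1))
    (fun j => if j + 1 = t then va s t 0 else vx s t (j + 1))
    (fun k => if k + 1 = t then 0 else vy s t (k + 1))
    (fun l => if l + 1 = s then 0 else va s t (l + 1)))

/-- The weights of the standard basis vectors of `𝒫^α(s)`, with `t = p - s`. -/
def projWt (p : ℕ) (α : ℤˣ) : PIdx s t → ℂ :=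
  pcases s t (fun i => wt p α (s - 1 - 2 * i)) (fun j => wt p (-α) (t - 1 - 2 * j))
    (fun k => wt p (-α) (t - 1 - 2 * k)) (fun l => wt p α (s - 1 - 2 * l))

/-- `K` on `𝒫^α(s)`, with `t = p - s`. -/
def projK (p : ℕ) (α : ℤˣ) : Module.End ℂ (PIdx s t →₀ ℂ) :=
  op fun i => projWt s t p α i • Finsupp.single i 1

lemma proj_E_pow (p : ℕ) (α : ℤˣ) (h : s + t = p) : projE s t p α ^ p = 0 := by
  refine op_pow_eq_zero _ (pcases s t (fun i => t + i) (fun j => j) (fun k => s + k) (fun l => l))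
    p ?_ ?_
  · rintro (i | i | i | i) <;> have := i.2 <;> simp only [pcases] <;> omega
  · have mb : ∀ (i : ℕ) (S : Set (PIdx s t)), (∀ hi : i < s, ib s t ⟨i, hi⟩ ∈ S) →
      vb s t i ∈ Finsupp.supported ℂ ℂ S := fun i S hS => bvec_mem _ _ _ hS
    have mx : ∀ (i : ℕ) (S : Set (PIdx s t)), (∀ hi : i < t, ix s t ⟨i, hi⟩ ∈ S) →
      vx s t i ∈ Finsupp.supported ℂ ℂ S := fun i S hS => bvec_mem _ _ _ hS
    have my : ∀ (i : ℕ) (S : Set (PIdx s t)), (∀ hi : i < t, iy s t ⟨i, hi⟩ ∈ S) →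
      vy s t i ∈ Finsupp.supported ℂ ℂ S := fun i S hS => bvec_mem _ _ _ hS
    have ma : ∀ (i : ℕ) (S : Set (PIdx s t)), (∀ hi : i < s, ia s t ⟨i, hi⟩ ∈ S) →
      va s t i ∈ Finsupp.supported ℂ ℂ S := fun i S hS => bvec_mem _ _ _ hS
    rintro (i | i | i | i) <;> have hi2 := i.2 <;> simp only [pcases] <;> split_ifs with hi
    · refine mx _ _ fun hh => ?_
      change t - 1 < t + i
      omega
    · refine add_mem (Submodule.smul_mem _ _ (mb _ _ fun hh => ?_)) (ma _ _ fun hh => ?_)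
      · change t + (i - 1) < t + (i : ℕ)
        omega
      · change (i - 1) < t + (i : ℕ)
        omega
    · exact zero_mem _
    · refine Submodule.smul_mem _ _ (mx _ _ fun hh => ?_)
      change (i - 1) < (i : ℕ)
      omega
    · refine ma _ _ fun hh => ?_
      change s - 1 < s + i
      omega
    · refine Submodule.smul_mem _ _ (my _ _ fun hh => ?_)
      change s + (i - 1) < s + (i : ℕ)
      omega
    · exact zero_mem _
    · refine Submodule.smul_mem _ _ (ma _ _ fun hh => ?_)
      change (i - 1) < (i : ℕ)
      omega

lemma proj_F_pow (p : ℕ) (h : s + t = p) : projF s t ^ p = 0 := by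
  refine op_pow_eq_zero _ (pcases s t (fun i => p - 1 - i) (fun j => p - 1 - j)
    (fun k => t - 1 - k) (fun l => s - 1 - l)) p ?_ ?_
  · rintro (i | i | i | i) <;> have := i.2 <;> simp only [pcases] <;> omega
  · rintro (i | i | i | i) <;> have hi2 := i.2 <;> simp only [pcases] <;> split_ifs with hi
    · refine bvec_mem _ _ _ fun hh => ?_
      change t - 1 - 0 < p - 1 - i
      omega
    · refine bvec_mem _ _ _ fun hh => ?_
      change p - 1 - (i + 1) < p - 1 - (i : ℕ)
      omega
    · refine bvec_mem _ _ _ fun hh => ?_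
      change s - 1 - 0 < p - 1 - i
      omega
    · refine bvec_mem _ _ _ fun hh => ?_
      change p - 1 - (i + 1) < p - 1 - (i : ℕ)
      omega
    · exact zero_mem _
    · refine bvec_mem _ _ _ fun hh => ?_
      change t - 1 - (i + 1) < t - 1 - (i : ℕ)
      omega
    · exact zero_mem _
    · refine bvec_mem _ _ _ fun hh => ?_
      change s - 1 - (i + 1) < s - 1 - (i : ℕ)
      omega

section actions

variable (p : ℕ) (α : ℤˣ)

lemma projE_b {i : ℕ} (hi : i < s) : projE s t p α (vb s t i) = if i = 0 then vx s t (t - 1)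
    else (sgn α * qInt p i * qInt p (s - i)) • vb s t (i - 1) + va s t (i - 1) :=
  op_bvec _ _ hi

lemma projE_x {j : ℕ} (hj : j < t) : projE s t p α (vx s t j) = if j = 0 then 0
    else (-sgn α * qInt p j * qInt p (t - j)) • vx s t (j - 1) := op_bvec _ _ hj

lemma projE_y {k : ℕ} (hk : k < t) : projE s t p α (vy s t k) = if k = 0 then va s t (s - 1)
    else (-sgn α * qInt p k * qInt p (t - k)) • vy s t (k - 1) := op_bvec _ _ hk

lemma projE_a {l : ℕ} (hl : l < s) : projE s t p α (va s t l) = if l = 0 then 0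
    else (sgn α * qInt p l * qInt p (s - l)) • va s t (l - 1) := op_bvec _ _ hl

lemma projF_b {i : ℕ} (hi : i < s) :
    projF s t (vb s t i) = if i + 1 = s then vy s t 0 else vb s t (i + 1) := op_bvec _ _ hi

lemma projF_x {j : ℕ} (hj : j < t) :
    projF s t (vx s t j) = if j + 1 = t then va s t 0 else vx s t (j + 1) := op_bvec _ _ hj

lemma projF_y {k : ℕ} (hk : k < t) :
    projF s t (vy s t k) = if k + 1 = t then 0 else vy s t (k + 1) := op_bvec _ _ hk

lemma projF_a {l : ℕ} (hl : l < s) :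
    projF s t (va s t l) = if l + 1 = s then 0 else va s t (l + 1) := op_bvec _ _ hl

lemma projK_b {i : ℕ} (hi : i < s) :
    projK s t p α (vb s t i) = wt p α (s - 1 - 2 * i) • vb s t i := by
  rw [vb, projK, op_bvec _ _ hi, bvec_of_lt _ hi]; rfl

lemma projK_x {j : ℕ} (hj : j < t) :
    projK s t p α (vx s t j) = wt p (-α) (t - 1 - 2 * j) • vx s t j := by
  rw [vx, projK, op_bvec _ _ hj, bvec_of_lt _ hj]; rfl

lemma projK_y {k : ℕ} (hk : k < t) :
    projK s t p α (vy s t k) = wt p (-α) (t - 1 - 2 * k) • vy s t k := by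
  rw [vy, projK, op_bvec _ _ hk, bvec_of_lt _ hk]; rfl

lemma projK_a {l : ℕ} (hl : l < s) :
    projK s t p α (va s t l) = wt p α (s - 1 - 2 * l) • va s t l := by
  rw [va, projK, op_bvec _ _ hl, bvec_of_lt _ hl]; rfl

lemma single_b (i : Fin s) : (Finsupp.single (Sum.inl i) 1 : PIdx s t →₀ ℂ) = vb s t i :=
  (bvec_of_lt (ib s t) i.2).symm

lemma single_x (i : Fin t) :
    (Finsupp.single (Sum.inr (Sum.inl i)) 1 : PIdx s t →₀ ℂ) = vx s t i :=
  (bvec_of_lt (ix s t) i.2).symm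

lemma single_y (i : Fin t) :
    (Finsupp.single (Sum.inr (Sum.inr (Sum.inl i))) 1 : PIdx s t →₀ ℂ) = vy s t i :=
  (bvec_of_lt (iy s t) i.2).symm

lemma single_a (i : Fin s) :
    (Finsupp.single (Sum.inr (Sum.inr (Sum.inr i))) 1 : PIdx s t →₀ ℂ) = va s t i :=
  (bvec_of_lt (ia s t) i.2).symm

/-- To compare two linear maps on `𝒫^α(s)` it suffices to compare them on the standard basis. -/
lemma proj_ext {ι : Type} {S T : (PIdx s t →₀ ℂ) →ₗ[ℂ] (ι →₀ ℂ)}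
    (hb : ∀ i < s, S (vb s t i) = T (vb s t i)) (hx : ∀ i < t, S (vx s t i) = T (vx s t i))
    (hy : ∀ i < t, S (vy s t i) = T (vy s t i)) (ha : ∀ i < s, S (va s t i) = T (va s t i)) :
    S = T := by
  refine end_ext ?_
  rintro (i | i | i | i)
  · rw [single_b]; exact hb i i.2
  · rw [single_x]; exact hx i i.2
  · rw [single_y]; exact hy i i.2
  · rw [single_a]; exact ha i i.2

variable {s t p}

lemma proj_KE (h : s + t = p) (hs : 0 < s) (ht : 0 < t) :
    projK s t p α * projE s t p α = (q p ^ 2) • (projE s t p α * projK s t p α) := by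
  have hp : p ≠ 0 := by omega
  have hpc : (p : ℤ) = s + t := by rw [← h]; push_cast; ring
  refine proj_ext s t ?_ ?_ ?_ ?_ <;> intro i hi <;>
    simp only [Module.End.mul_apply, LinearMap.smul_apply]
  · rw [projK_b s t p α hi, map_smul, smul_smul, ← wt_add_two, projE_b s t p α hi]
    split_ifs with h0
    · rw [projK_x s t p α (by omega), h0, wt_neg p hp]
      congr 2; rw [hpc]; push_cast [show 1 ≤ t from ht]; ring
    · rw [map_add, map_smul, projK_b s t p α (by omega), projK_a s t p α (by omega), smul_add,
        smul_comm]
      have e : ((s : ℤ) - 1 - 2 * ((i - 1 : ℕ) : ℤ)) = s - 1 - 2 * i + 2 := by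
        push_cast [show 1 ≤ i by omega]; ring
      rw [e]
  · rw [projK_x s t p α hi, map_smul, smul_smul, ← wt_add_two, projE_x s t p α hi]
    split_ifs with h0
    · simp
    · rw [map_smul, projK_x s t p α (by omega), smul_comm]
      congr 3; push_cast [show 1 ≤ i by omega]; ring
  · rw [projK_y s t p α hi, map_smul, smul_smul, ← wt_add_two, projE_y s t p α hi]
    split_ifs with h0
    · rw [projK_a s t p α (by omega), h0, ← neg_neg α, wt_neg p hp (-α), neg_neg]
      congr 2; rw [hpc]; push_cast [show 1 ≤ s from hs]; ring
    · rw [map_smul, projK_y s t p α (by omega), smul_comm]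
      congr 3; push_cast [show 1 ≤ i by omega]; ring
  · rw [projK_a s t p α hi, map_smul, smul_smul, ← wt_add_two, projE_a s t p α hi]
    split_ifs with h0
    · simp
    · rw [map_smul, projK_a s t p α (by omega), smul_comm]
      congr 3; push_cast [show 1 ≤ i by omega]; ring

lemma proj_KF (h : s + t = p) (hs : 0 < s) (ht : 0 < t) :
    projK s t p α * projF s t = ((q p ^ 2)⁻¹) • (projF s t * projK s t p α) := by
  have hp : p ≠ 0 := by omega
  have hpc : (p : ℤ) = s + t := by rw [← h]; push_cast; ring
  refine proj_ext s t ?_ ?_ ?_ ?_ <;> intro i hi <;>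
    simp only [Module.End.mul_apply, LinearMap.smul_apply]
  · rw [projK_b s t p α hi, map_smul, smul_smul, ← wt_sub_two, projF_b s t hi]
    split_ifs with h0
    · rw [projK_y s t p α (by omega), ← neg_neg α, wt_neg p hp (-α), neg_neg]
      congr 2; rw [hpc, ← h0]; push_cast; ring
    · rw [projK_b s t p α (by omega)]
      congr 2; push_cast; ring
  · rw [projK_x s t p α hi, map_smul, smul_smul, ← wt_sub_two, projF_x s t hi]
    split_ifs with h0
    · rw [projK_a s t p α (by omega), wt_neg p hp]
      congr 2; rw [hpc, ← h0]; push_cast; ring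
    · rw [projK_x s t p α (by omega)]
      congr 2; push_cast; ring
  · rw [projK_y s t p α hi, map_smul, smul_smul, ← wt_sub_two, projF_y s t hi]
    split_ifs with h0
    · simp
    · rw [projK_y s t p α (by omega)]
      congr 2; push_cast; ring
  · rw [projK_a s t p α hi, map_smul, smul_smul, ← wt_sub_two, projF_a s t hi]
    split_ifs with h0
    · simp
    · rw [projK_a s t p α (by omega)]
      congr 2; push_cast; ring

lemma projWt_pow (hp : p ≠ 0) (i : PIdx s t) : projWt s t p α i ^ (2 * p) = 1 := by
  rcases i with i | i | i | i <;> exact wt_pow p hp _ _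

lemma projK_sub_single (i : PIdx s t) :
    (projK s t p α - projK s t p α ^ (2 * p - 1)) (Finsupp.single i 1)
      = (projWt s t p α i - projWt s t p α i ^ (2 * p - 1)) • Finsupp.single i 1 := by
  rw [LinearMap.sub_apply, sub_smul, projK, op_pow_diag, op_single]

lemma projK_sub (hp : p ≠ 0) :
    (∀ i < s, ((q p - (q p)⁻¹)⁻¹ • (projK s t p α - projK s t p α ^ (2 * p - 1))) (vb s t i)
      = (sgn α * qInt p (s - 1 - 2 * i)) • vb s t i) ∧
    (∀ i < t, ((q p - (q p)⁻¹)⁻¹ • (projK s t p α - projK s t p α ^ (2 * p - 1))) (vx s t i)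
      = (-sgn α * qInt p (t - 1 - 2 * i)) • vx s t i) ∧
    (∀ i < t, ((q p - (q p)⁻¹)⁻¹ • (projK s t p α - projK s t p α ^ (2 * p - 1))) (vy s t i)
      = (-sgn α * qInt p (t - 1 - 2 * i)) • vy s t i) ∧
    (∀ i < s, ((q p - (q p)⁻¹)⁻¹ • (projK s t p α - projK s t p α ^ (2 * p - 1))) (va s t i)
      = (sgn α * qInt p (s - 1 - 2 * i)) • va s t i) := by
  refine ⟨fun i hi => ?_, fun i hi => ?_, fun i hi => ?_, fun i hi => ?_⟩
  · rw [vb, bvec_of_lt _ hi, LinearMap.smul_apply, projK_sub_single, smul_smul, ← wt_sub_inv p hp]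
    rfl
  · rw [vx, bvec_of_lt _ hi, LinearMap.smul_apply, projK_sub_single, smul_smul, ← sgn_neg,
      ← wt_sub_inv p hp]
    rfl
  · rw [vy, bvec_of_lt _ hi, LinearMap.smul_apply, projK_sub_single, smul_smul, ← sgn_neg,
      ← wt_sub_inv p hp]
    rfl
  · rw [va, bvec_of_lt _ hi, LinearMap.smul_apply, projK_sub_single, smul_smul, ← wt_sub_inv p hp]
    rfl

lemma proj_EF (h : s + t = p) (hs : 0 < s) (ht : 0 < t) :
    projE s t p α * projF s t = projF s t * projE s t p α
      + (q p - (q p)⁻¹)⁻¹ • (projK s t p α - projK s t p α ^ (2 * p - 1)) := by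
  have hp : p ≠ 0 := by omega
  obtain ⟨kb, kx, ky, ka⟩ := projK_sub (s := s) (t := t) α hp
  refine proj_ext s t ?_ ?_ ?_ ?_ <;> intro i hi <;>
    rw [LinearMap.add_apply, Module.End.mul_apply, Module.End.mul_apply]
  · have e1 : projE s t p α (projF s t (vb s t i))
        = (sgn α * qInt p (i + 1) * qInt p (s - (i + 1))) • vb s t i + va s t i := by
      rw [projF_b s t hi]
      split_ifs with h1
      · rw [projE_y s t p α ht, if_pos rfl, show (s : ℤ) - (i + 1) = 0 by omega, qInt_zero,
          show s - 1 = i by omega]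
        simp
      · rw [projE_b s t p α (by omega), if_neg (by omega)]
        push_cast; rfl
    have e2 : projF s t (projE s t p α (vb s t i))
        = (sgn α * qInt p i * qInt p (s - i)) • vb s t i + va s t i := by
      rw [projE_b s t p α hi]
      split_ifs with h1
      · rw [projF_x s t (by omega), if_pos (by omega), h1]; simp [qInt_zero]
      · rw [map_add, map_smul, projF_b s t (by omega), projF_a s t (by omega),
          if_neg (by omega), if_neg (by omega), show i - 1 + 1 = i by omega]
    rw [e1, e2, kb i hi, ← qInt_comm]
    module
  · have e1 : projE s t p α (projF s t (vx s t i))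
        = (-sgn α * qInt p (i + 1) * qInt p (t - (i + 1))) • vx s t i := by
      rw [projF_x s t hi]
      split_ifs with h1
      · rw [projE_a s t p α hs, if_pos rfl, show (t : ℤ) - (i + 1) = 0 by omega, qInt_zero]
        simp
      · rw [projE_x s t p α (by omega), if_neg (by omega)]
        push_cast; rfl
    have e2 : projF s t (projE s t p α (vx s t i))
        = (-sgn α * qInt p i * qInt p (t - i)) • vx s t i := by
      rw [projE_x s t p α hi]
      split_ifs with h1
      · rw [h1]; simp [qInt_zero]
      · rw [map_smul, projF_x s t (by omega), if_neg (by omega), show i - 1 + 1 = i by omega]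
    rw [e1, e2, kx i hi, ← qInt_comm]
    module
  · have e1 : projE s t p α (projF s t (vy s t i))
        = (-sgn α * qInt p (i + 1) * qInt p (t - (i + 1))) • vy s t i := by
      rw [projF_y s t hi]
      split_ifs with h1
      · rw [show (t : ℤ) - (i + 1) = 0 by omega, qInt_zero]
        simp
      · rw [projE_y s t p α (by omega), if_neg (by omega)]
        push_cast; rfl
    have e2 : projF s t (projE s t p α (vy s t i))
        = (-sgn α * qInt p i * qInt p (t - i)) • vy s t i := by
      rw [projE_y s t p α hi]
      split_ifs with h1
      · rw [projF_a s t (by omega), if_pos (by omega), h1]; simp [qInt_zero]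
      · rw [map_smul, projF_y s t (by omega), if_neg (by omega), show i - 1 + 1 = i by omega]
    rw [e1, e2, ky i hi, ← qInt_comm]
    module
  · have e1 : projE s t p α (projF s t (va s t i))
        = (sgn α * qInt p (i + 1) * qInt p (s - (i + 1))) • va s t i := by
      rw [projF_a s t hi]
      split_ifs with h1
      · rw [show (s : ℤ) - (i + 1) = 0 by omega, qInt_zero]
        simp
      · rw [projE_a s t p α (by omega), if_neg (by omega)]
        push_cast; rfl
    have e2 : projF s t (projE s t p α (va s t i))
        = (sgn α * qInt p i * qInt p (s - i)) • va s t i := by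
      rw [projE_a s t p α hi]
      split_ifs with h1
      · rw [h1]; simp [qInt_zero]
      · rw [map_smul, projF_a s t (by omega), if_neg (by omega), show i - 1 + 1 = i by omega]
    rw [e1, e2, ka i hi, ← qInt_comm]
    module

lemma proj_relations (h : s + t = p) (hs : 0 < s) (ht : 0 < t) :
    UqRelations p (projE s t p α) (projF s t) (projK s t p α) where
  E_pow := proj_E_pow s t p α h
  F_pow := proj_F_pow s t p h
  K_pow := end_ext fun i => by
    rw [projK, op_pow_diag, projWt_pow α (by omega), one_smul]; rfl
  KE := proj_KE α h hs ht
  KF := proj_KF α h hs ht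
  EF := proj_EF α h hs ht

end actions

end

/-- The projective module `𝒫^α(s)` for `1 ≤ s ≤ p - 1`, as a representation (here `t = p - s`). -/
def projRep (p : ℕ) (α : ℤˣ) (s t : ℕ) (h : s + t = p) (hs : 0 < s) (ht : 0 < t) :
    Uq p →ₐ[ℂ] Module.End ℂ (PIdx s t →₀ ℂ) :=
  Uq.lift _ _ _ (proj_relations α h hs ht)

/-- The `(u, v)` matrix coefficient of `x` acting on `𝒫^α(s)`, in the standard basis. -/
def projCoeff (p : ℕ) (α : ℤˣ) (s t : ℕ) (h : s + t = p) (hs : 0 < s) (ht : 0 < t)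
    (u v : PIdx s t) : Uq p →ₗ[ℂ] ℂ where
  toFun x := projRep p α s t h hs ht x (Finsupp.single v 1) u
  map_add' x y := by simp
  map_smul' c x := by simp

/-- The trace of the block `H^α_s`, which is formed by the components along `(a_l)` of the images
of `(b_i)`. -/
def trH (p : ℕ) (α : ℤˣ) (s t : ℕ) (h : s + t = p) (hs : 0 < s) (ht : 0 < t) : Uq p →ₗ[ℂ] ℂ :=
  ∑ i : Fin s, projCoeff p α s t h hs ht (ia s t i) (ib s t i)

section

variable {p : ℕ} (α : ℤˣ) {s t : ℕ} (h : s + t = p) (hs : 0 < s) (ht : 0 < t)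

lemma intertwine {V W : Type*} [AddCommGroup V] [Module ℂ V] [AddCommGroup W] [Module ℂ W]
    (ρ : Uq p →ₐ[ℂ] Module.End ℂ V) (σ : Uq p →ₐ[ℂ] Module.End ℂ W) (T : V →ₗ[ℂ] W)
    (hE : T ∘ₗ ρ (Uq.E p) = σ (Uq.E p) ∘ₗ T) (hF : T ∘ₗ ρ (Uq.F p) = σ (Uq.F p) ∘ₗ T)
    (hK : T ∘ₗ ρ (Uq.K p) = σ (Uq.K p) ∘ₗ T) (x : Uq p) (v : V) : T (ρ x v) = σ x (T v) := by
  induction x using Uq.induction_gen generalizing v with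
  | hc r => simp [AlgHom.commutes, Module.algebraMap_end_apply]
  | hE => exact LinearMap.congr_fun hE v
  | hF => exact LinearMap.congr_fun hF v
  | hK => exact LinearMap.congr_fun hK v
  | hadd x y hx hy => simp [hx, hy]
  | hmul x y hx hy => simp [hx, hy]

lemma projCoeff_mul (u v : PIdx s t) (x y : Uq p) :
    projCoeff p α s t h hs ht u v (x * y)
      = ∑ w, projCoeff p α s t h hs ht u w x * projCoeff p α s t h hs ht w v y := by
  change projRep p α s t h hs ht (x * y) (Finsupp.single v 1) u = _
  rw [map_mul, Module.End.mul_apply]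
  conv_lhs => rw [← Finsupp.univ_sum_single (projRep p α s t h hs ht y (Finsupp.single v 1))]
  rw [map_sum, Finsupp.finsetSum_apply]
  refine Finset.sum_congr rfl fun w _ => ?_
  rw [← mul_one (projRep p α s t h hs ht y (Finsupp.single v 1) w), ← smul_eq_mul,
    ← Finsupp.smul_single, map_smul, Finsupp.smul_apply, smul_eq_mul, mul_comm]
  rfl

/-- A linear map given by its values on the standard basis of `𝒫^α(s)`. -/
def pmap {ι : Type} (s t : ℕ) (fb fx fy fa : ℕ → (ι →₀ ℂ)) : (PIdx s t →₀ ℂ) →ₗ[ℂ] (ι →₀ ℂ) :=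
  Finsupp.linearCombination ℂ (pcases s t fb fx fy fa)

section pmap

variable {ι : Type} (fb fx fy fa : ℕ → (ι →₀ ℂ))

lemma pmap_b {i : ℕ} (hi : i < s) : pmap s t fb fx fy fa (vb s t i) = fb i := by
  rw [vb, bvec_of_lt _ hi, pmap, Finsupp.linearCombination_single, one_smul]; rfl

lemma pmap_x {i : ℕ} (hi : i < t) : pmap s t fb fx fy fa (vx s t i) = fx i := by
  rw [vx, bvec_of_lt _ hi, pmap, Finsupp.linearCombination_single, one_smul]; rfl

lemma pmap_y {i : ℕ} (hi : i < t) : pmap s t fb fx fy fa (vy s t i) = fy i := by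
  rw [vy, bvec_of_lt _ hi, pmap, Finsupp.linearCombination_single, one_smul]; rfl

lemma pmap_a {i : ℕ} (hi : i < s) : pmap s t fb fx fy fa (va s t i) = fa i := by
  rw [va, bvec_of_lt _ hi, pmap, Finsupp.linearCombination_single, one_smul]; rfl

end pmap

lemma coeff_ba (l i : Fin s) (x : Uq p) :
    projCoeff p α s t h hs ht (ia s t l) (ia s t i) x
      = projCoeff p α s t h hs ht (ib s t l) (ib s t i) x := by
  set T : (PIdx s t →₀ ℂ) →ₗ[ℂ] (PIdx s t →₀ ℂ) := pmap s t (va s t) 0 0 0 with hT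
  have key := intertwine (projRep p α s t h hs ht) (projRep p α s t h hs ht) T
    (by
      rw [projRep, Uq.lift_E]
      refine proj_ext s t ?_ ?_ ?_ ?_ <;> intro i hi <;>
        rw [LinearMap.comp_apply, LinearMap.comp_apply]
      · rw [projE_b s t p α hi, hT, pmap_b _ _ _ _ hi, projE_a s t p α hi]
        split_ifs with h0
        · rw [pmap_x _ _ _ _ (by omega)]; rfl
        · rw [map_add, map_smul, pmap_b _ _ _ _ (by omega), pmap_a _ _ _ _ (by omega)]
          exact add_zero _
      · rw [projE_x s t p α hi, hT, pmap_x _ _ _ _ hi]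
        split_ifs with h0
        · simp
        · rw [map_smul, pmap_x _ _ _ _ (by omega)]; simp
      · rw [projE_y s t p α hi, hT, pmap_y _ _ _ _ hi]
        split_ifs with h0
        · rw [pmap_a _ _ _ _ (by omega)]; simp
        · rw [map_smul, pmap_y _ _ _ _ (by omega)]; simp
      · rw [projE_a s t p α hi, hT, pmap_a _ _ _ _ hi]
        split_ifs with h0
        · simp
        · rw [map_smul, pmap_a _ _ _ _ (by omega)]; simp)
    (by
      rw [projRep, Uq.lift_F]
      refine proj_ext s t ?_ ?_ ?_ ?_ <;> intro i hi <;>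
        rw [LinearMap.comp_apply, LinearMap.comp_apply]
      · rw [projF_b s t hi, hT, pmap_b _ _ _ _ hi, projF_a s t hi]
        split_ifs with h0
        · rw [pmap_y _ _ _ _ (by omega)]; rfl
        · rw [pmap_b _ _ _ _ (by omega)]
      · rw [projF_x s t hi, hT, pmap_x _ _ _ _ hi]
        split_ifs with h0
        · rw [pmap_a _ _ _ _ (by omega)]; simp
        · rw [pmap_x _ _ _ _ (by omega)]; simp
      · rw [projF_y s t hi, hT, pmap_y _ _ _ _ hi]
        split_ifs with h0
        · simp
        · rw [pmap_y _ _ _ _ (by omega)]; simp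
      · rw [projF_a s t hi, hT, pmap_a _ _ _ _ hi]
        split_ifs with h0
        · simp
        · rw [pmap_a _ _ _ _ (by omega)]; simp)
    (by
      rw [projRep, Uq.lift_K]
      refine proj_ext s t ?_ ?_ ?_ ?_ <;> intro i hi <;>
        rw [LinearMap.comp_apply, LinearMap.comp_apply]
      · rw [projK_b s t p α hi, hT, map_smul, pmap_b _ _ _ _ hi, projK_a s t p α hi]
      · rw [projK_x s t p α hi, hT, map_smul, pmap_x _ _ _ _ hi]; simp
      · rw [projK_y s t p α hi, hT, map_smul, pmap_y _ _ _ _ hi]; simp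
      · rw [projK_a s t p α hi, hT, map_smul, pmap_a _ _ _ _ hi]; simp)
  have hcoord : (Finsupp.lapply (ia s t l) : (PIdx s t →₀ ℂ) →ₗ[ℂ] ℂ) ∘ₗ T
      = Finsupp.lapply (ib s t l) := by
    refine Finsupp.lhom_ext' fun w => LinearMap.ext_ring ?_
    rcases w with w | w | w | w <;>
      simp [hT, pmap, pcases, va, bvec, ia, ib, Finsupp.single_apply]
  have := congrArg (fun v => v (ia s t l)) (key x (vb s t i))
  have h2 := LinearMap.congr_fun hcoord (projRep p α s t h hs ht x (vb s t i))
  have h3 : T (vb s t i) = va s t i := pmap_b _ _ _ _ i.2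
  simp only [h3] at this
  simp only [LinearMap.comp_apply, Finsupp.lapply_apply] at h2
  rw [h2] at this
  change projRep p α s t h hs ht x (Finsupp.single (ia s t i) 1) (ia s t l)
    = projRep p α s t h hs ht x (Finsupp.single (ib s t i) 1) (ib s t l)
  rw [show Finsupp.single (ia s t i) (1 : ℂ) = va s t i from single_a s t i,
    show Finsupp.single (ib s t i) (1 : ℂ) = vb s t i from single_b s t i]
  exact this.symm

lemma coeff_yx (h' : t + s = p) (l : Fin t) (i : Fin s) (x : Uq p) :
    projCoeff p α s t h hs ht (iy s t l) (ib s t i) x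
      = projCoeff p (-α) t s h' ht hs (ia t s l) (ix t s i) x := by
  set T : (PIdx s t →₀ ℂ) →ₗ[ℂ] (PIdx t s →₀ ℂ) := pmap s t (vx t s) 0 (va t s) 0 with hT
  have key := intertwine (projRep p α s t h hs ht) (projRep p (-α) t s h' ht hs) T
    (by
      rw [projRep, projRep, Uq.lift_E, Uq.lift_E]
      refine proj_ext s t ?_ ?_ ?_ ?_ <;> intro i hi <;>
        rw [LinearMap.comp_apply, LinearMap.comp_apply]
      · rw [projE_b s t p α hi, hT, pmap_b _ _ _ _ hi, projE_x t s p (-α) hi]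
        split_ifs with h0
        · rw [pmap_x _ _ _ _ (by omega)]; rfl
        · rw [map_add, map_smul, pmap_b _ _ _ _ (by omega), pmap_a _ _ _ _ (by omega), sgn_neg,
            neg_neg]
          exact add_zero _
      · rw [projE_x s t p α hi, hT, pmap_x _ _ _ _ hi]
        split_ifs with h0
        · simp
        · rw [map_smul, pmap_x _ _ _ _ (by omega)]; simp
      · rw [projE_y s t p α hi, hT, pmap_y _ _ _ _ hi, projE_a t s p (-α) hi]
        split_ifs with h0
        · rw [pmap_a _ _ _ _ (by omega)]; simp
        · rw [map_smul, pmap_y _ _ _ _ (by omega), sgn_neg]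
      · rw [projE_a s t p α hi, hT, pmap_a _ _ _ _ hi]
        split_ifs with h0
        · simp
        · rw [map_smul, pmap_a _ _ _ _ (by omega)]; simp)
    (by
      rw [projRep, projRep, Uq.lift_F, Uq.lift_F]
      refine proj_ext s t ?_ ?_ ?_ ?_ <;> intro i hi <;>
        rw [LinearMap.comp_apply, LinearMap.comp_apply]
      · rw [projF_b s t hi, hT, pmap_b _ _ _ _ hi, projF_x t s hi]
        split_ifs with h0
        · rw [pmap_y _ _ _ _ (by omega)]
        · rw [pmap_b _ _ _ _ (by omega)]
      · rw [projF_x s t hi, hT, pmap_x _ _ _ _ hi]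
        split_ifs with h0
        · rw [pmap_a _ _ _ _ (by omega)]; simp
        · rw [pmap_x _ _ _ _ (by omega)]; simp
      · rw [projF_y s t hi, hT, pmap_y _ _ _ _ hi, projF_a t s hi]
        split_ifs with h0
        · simp
        · rw [pmap_y _ _ _ _ (by omega)]
      · rw [projF_a s t hi, hT, pmap_a _ _ _ _ hi]
        split_ifs with h0
        · simp
        · rw [pmap_a _ _ _ _ (by omega)]; simp)
    (by
      rw [projRep, projRep, Uq.lift_K, Uq.lift_K]
      refine proj_ext s t ?_ ?_ ?_ ?_ <;> intro i hi <;>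
        rw [LinearMap.comp_apply, LinearMap.comp_apply]
      · rw [projK_b s t p α hi, hT, map_smul, pmap_b _ _ _ _ hi, projK_x t s p (-α) hi, neg_neg]
      · rw [projK_x s t p α hi, hT, map_smul, pmap_x _ _ _ _ hi]; simp
      · rw [projK_y s t p α hi, hT, map_smul, pmap_y _ _ _ _ hi, projK_a t s p (-α) hi]
      · rw [projK_a s t p α hi, hT, map_smul, pmap_a _ _ _ _ hi]; simp)
  have hcoord : (Finsupp.lapply (ia t s l) : (PIdx t s →₀ ℂ) →ₗ[ℂ] ℂ) ∘ₗ T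
      = Finsupp.lapply (iy s t l) := by
    refine Finsupp.lhom_ext' fun w => LinearMap.ext_ring ?_
    rcases w with w | w | w | w <;>
      simp [hT, pmap, pcases, va, vx, bvec, ia, ix, iy, Finsupp.single_apply]
  have := congrArg (fun v => v (ia t s l)) (key x (vb s t i))
  have h2 := LinearMap.congr_fun hcoord (projRep p α s t h hs ht x (vb s t i))
  have h3 : T (vb s t i) = vx t s i := pmap_b _ _ _ _ i.2
  simp only [h3] at this
  simp only [LinearMap.comp_apply, Finsupp.lapply_apply] at h2
  rw [h2] at this
  change projRep p α s t h hs ht x (Finsupp.single (ib s t i) 1) (iy s t l)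
    = projRep p (-α) t s h' ht hs x (Finsupp.single (ix t s i) 1) (ia t s l)
  rw [show Finsupp.single (ib s t i) (1 : ℂ) = vb s t i from single_b s t i,
    show Finsupp.single (ix t s i) (1 : ℂ) = vx t s i from single_x t s i]
  exact this

lemma coeff_xy (h' : t + s = p) (l : Fin t) (i : Fin s) (x : Uq p) :
    projCoeff p α s t h hs ht (ix s t l) (ib s t i) x
      = projCoeff p (-α) t s h' ht hs (ia t s l) (iy t s i) x := by
  set T : (PIdx s t →₀ ℂ) →ₗ[ℂ] (PIdx t s →₀ ℂ) := pmap s t (vy t s) (va t s) 0 0 with hT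
  have key := intertwine (projRep p α s t h hs ht) (projRep p (-α) t s h' ht hs) T
    (by
      rw [projRep, projRep, Uq.lift_E, Uq.lift_E]
      refine proj_ext s t ?_ ?_ ?_ ?_ <;> intro i hi <;>
        rw [LinearMap.comp_apply, LinearMap.comp_apply]
      · rw [projE_b s t p α hi, hT, pmap_b _ _ _ _ hi, projE_y t s p (-α) hi]
        split_ifs with h0
        · rw [pmap_x _ _ _ _ (by omega)]
        · rw [map_add, map_smul, pmap_b _ _ _ _ (by omega), pmap_a _ _ _ _ (by omega), sgn_neg,
            neg_neg]
          exact add_zero _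
      · rw [projE_x s t p α hi, hT, pmap_x _ _ _ _ hi, projE_a t s p (-α) hi]
        split_ifs with h0
        · simp
        · rw [map_smul, pmap_x _ _ _ _ (by omega), sgn_neg]
      · rw [projE_y s t p α hi, hT, pmap_y _ _ _ _ hi]
        split_ifs with h0
        · rw [pmap_a _ _ _ _ (by omega)]; simp
        · rw [map_smul, pmap_y _ _ _ _ (by omega)]; simp
      · rw [projE_a s t p α hi, hT, pmap_a _ _ _ _ hi]
        split_ifs with h0
        · simp
        · rw [map_smul, pmap_a _ _ _ _ (by omega)]; simp)
    (by
      rw [projRep, projRep, Uq.lift_F, Uq.lift_F]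
      refine proj_ext s t ?_ ?_ ?_ ?_ <;> intro i hi <;>
        rw [LinearMap.comp_apply, LinearMap.comp_apply]
      · rw [projF_b s t hi, hT, pmap_b _ _ _ _ hi, projF_y t s hi]
        split_ifs with h0
        · rw [pmap_y _ _ _ _ (by omega)]; rfl
        · rw [pmap_b _ _ _ _ (by omega)]
      · rw [projF_x s t hi, hT, pmap_x _ _ _ _ hi, projF_a t s hi]
        split_ifs with h0
        · rw [pmap_a _ _ _ _ (by omega)]; simp
        · rw [pmap_x _ _ _ _ (by omega)]
      · rw [projF_y s t hi, hT, pmap_y _ _ _ _ hi]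
        split_ifs with h0
        · simp
        · rw [pmap_y _ _ _ _ (by omega)]; simp
      · rw [projF_a s t hi, hT, pmap_a _ _ _ _ hi]
        split_ifs with h0
        · simp
        · rw [pmap_a _ _ _ _ (by omega)]; simp)
    (by
      rw [projRep, projRep, Uq.lift_K, Uq.lift_K]
      refine proj_ext s t ?_ ?_ ?_ ?_ <;> intro i hi <;>
        rw [LinearMap.comp_apply, LinearMap.comp_apply]
      · rw [projK_b s t p α hi, hT, map_smul, pmap_b _ _ _ _ hi, projK_y t s p (-α) hi, neg_neg]
      · rw [projK_x s t p α hi, hT, map_smul, pmap_x _ _ _ _ hi, projK_a t s p (-α) hi]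
      · rw [projK_y s t p α hi, hT, map_smul, pmap_y _ _ _ _ hi]; simp
      · rw [projK_a s t p α hi, hT, map_smul, pmap_a _ _ _ _ hi]; simp)
  have hcoord : (Finsupp.lapply (ia t s l) : (PIdx t s →₀ ℂ) →ₗ[ℂ] ℂ) ∘ₗ T
      = Finsupp.lapply (ix s t l) := by
    refine Finsupp.lhom_ext' fun w => LinearMap.ext_ring ?_
    rcases w with w | w | w | w <;>
      simp [hT, pmap, pcases, va, vy, bvec, ia, ix, iy, Finsupp.single_apply]
  have := congrArg (fun v => v (ia t s l)) (key x (vb s t i))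
  have h2 := LinearMap.congr_fun hcoord (projRep p α s t h hs ht x (vb s t i))
  have h3 : T (vb s t i) = vy t s i := pmap_b _ _ _ _ i.2
  simp only [h3] at this
  simp only [LinearMap.comp_apply, Finsupp.lapply_apply] at h2
  rw [h2] at this
  change projRep p α s t h hs ht x (Finsupp.single (ib s t i) 1) (ix s t l)
    = projRep p (-α) t s h' ht hs x (Finsupp.single (iy t s i) 1) (ia t s l)
  rw [show Finsupp.single (ib s t i) (1 : ℂ) = vb s t i from single_b s t i,
    show Finsupp.single (iy t s i) (1 : ℂ) = vy t s i from single_y t s i]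
  exact this

/-- The trace of `H^α_s` on a product, in terms of the blocks of the two factors. -/
lemma trH_mul (x y : Uq p) : trH p α s t h hs ht (x * y)
    = (∑ i : Fin s, ∑ j : Fin s, projCoeff p α s t h hs ht (ia s t i) (ib s t j) x
        * projCoeff p α s t h hs ht (ib s t j) (ib s t i) y)
    + (∑ i : Fin s, ∑ j : Fin t, projCoeff p α s t h hs ht (ia s t i) (ix s t j) x
        * projCoeff p α s t h hs ht (ix s t j) (ib s t i) y)
    + (∑ i : Fin s, ∑ j : Fin t, projCoeff p α s t h hs ht (ia s t i) (iy s t j) x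
        * projCoeff p α s t h hs ht (iy s t j) (ib s t i) y)
    + (∑ i : Fin s, ∑ j : Fin s, projCoeff p α s t h hs ht (ib s t i) (ib s t j) x
        * projCoeff p α s t h hs ht (ia s t j) (ib s t i) y) := by
  simp only [trH, LinearMap.sum_apply, projCoeff_mul, Fintype.sum_sum_type,
    ← Finset.sum_add_distrib]
  refine Finset.sum_congr rfl fun i _ => ?_
  rw [← add_assoc, ← add_assoc]
  refine congrArg₂ (· + ·) rfl (Finset.sum_congr rfl fun j _ => ?_)
  rw [← coeff_ba]
  rfl

lemma trH_symm (h' : t + s = p) (x y : Uq p) :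
    trH p 1 s t h hs ht (x * y) + trH p (-1) t s h' ht hs (x * y)
      = trH p 1 s t h hs ht (y * x) + trH p (-1) t s h' ht hs (y * x) := by
  have e1 : ∀ (l : Fin s) (i : Fin t) (x : Uq p),
      projCoeff p 1 s t h hs ht (ia s t l) (ix s t i) x
        = projCoeff p (-1) t s h' ht hs (iy t s l) (ib t s i) x := fun l i x => by
    rw [coeff_yx (-1) h' ht hs h]; simp only [neg_neg]
  have e2 : ∀ (l : Fin s) (i : Fin t) (x : Uq p),
      projCoeff p 1 s t h hs ht (ia s t l) (iy s t i) x
        = projCoeff p (-1) t s h' ht hs (ix t s l) (ib t s i) x := fun l i x => by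
    rw [coeff_xy (-1) h' ht hs h]; simp only [neg_neg]
  have e3 : ∀ (l : Fin t) (i : Fin s) (x : Uq p),
      projCoeff p 1 s t h hs ht (iy s t l) (ib s t i) x
        = projCoeff p (-1) t s h' ht hs (ia t s l) (ix t s i) x := fun l i x =>
    coeff_yx 1 h hs ht h' l i x
  have e4 : ∀ (l : Fin t) (i : Fin s) (x : Uq p),
      projCoeff p 1 s t h hs ht (ix s t l) (ib s t i) x
        = projCoeff p (-1) t s h' ht hs (ia t s l) (iy t s i) x := fun l i x =>
    coeff_xy 1 h hs ht h' l i x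
  simp only [trH_mul, e1, e2, e3, e4]
  have c1 : ∀ (n m : ℕ) (f : Fin n → Fin m → ℂ) (g : Fin m → Fin n → ℂ),
      ∑ i, ∑ j, f i j * g j i = ∑ j, ∑ i, g j i * f i j := fun n m f g => by
    rw [Finset.sum_comm]
    exact Finset.sum_congr rfl fun _ _ => Finset.sum_congr rfl fun _ _ => mul_comm _ _
  rw [c1 s s _ (fun j i => projCoeff p 1 s t h hs ht (ib s t j) (ib s t i) y),
    c1 s t _ (fun j i => projCoeff p (-1) t s h' ht hs (ia t s j) (iy t s i) y),
    c1 s t _ (fun j i => projCoeff p (-1) t s h' ht hs (ia t s j) (ix t s i) y),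
    c1 s s _ (fun j i => projCoeff p 1 s t h hs ht (ia s t j) (ib s t i) y),
    c1 t t _ (fun j i => projCoeff p (-1) t s h' ht hs (ib t s j) (ib t s i) y),
    c1 t s _ (fun j i => projCoeff p (-1) t s h' ht hs (ix t s j) (ib t s i) y),
    c1 t s _ (fun j i => projCoeff p (-1) t s h' ht hs (iy t s j) (ib t s i) y),
    c1 t t _ (fun j i => projCoeff p (-1) t s h' ht hs (ia t s j) (ib t s i) y)]
  ring

end

/-! ### The elements of the GTA basis -/

/-- The trace of a representation of `Ū_q`, an element of `SLF(Ū_q)`. -/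
def traceForm {p : ℕ} [NeZero p] {V : Type} [AddCommGroup V] [Module ℂ V]
    (ρ : Uq p →ₐ[ℂ] Module.End ℂ V) : SLF p :=
  ⟨WithConv.toConv (LinearMap.trace ℂ V ∘ₗ ρ.toLinearMap), fun x y => by
    change LinearMap.trace ℂ V (ρ (x * y)) = LinearMap.trace ℂ V (ρ (y * x))
    rw [map_mul ρ, map_mul ρ, LinearMap.trace_mul_comm]⟩

/-- The character `χ^α_s` of `𝒳^α(s)`, for `1 ≤ s ≤ p` (zero out of this range). -/
def chi (p : ℕ) [NeZero p] (α : ℤˣ) (s : ℕ) : SLF p :=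
  if h : s ≤ p then traceForm (simpleRep p α s h) else 0

/-- The symmetric linear form `G_s = tr(H^+_s) + tr(H^-_{p-s})`, for `1 ≤ s ≤ p - 1` (zero out of
this range). -/
def G (p : ℕ) [NeZero p] (s : ℕ) : SLF p :=
  if h : 0 < s ∧ s < p then
    ⟨WithConv.toConv
      (trH p 1 s (p - s) (by omega) h.1 (by omega) + trH p (-1) (p - s) s (by omega) (by omega) h.1),
      fun x y => trH_symm (by omega) h.1 (by omega) (by omega) x y⟩
  else 0

/-- The multiplication rules in the GTA basis, for a bilinear product `m` on `SLF(Ū_q)`: the unit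
rule and the fusion rules of the characters `χ^α_s`, and the rules that involve the `G_s`. -/
structure GTARules (p : ℕ) [NeZero p] (m : SLF p →ₗ[ℂ] SLF p →ₗ[ℂ] SLF p) : Prop where
  unit : ∀ φ, m (chi p 1 1) φ = φ
  chi_minus_chi : ∀ (α : ℤˣ) (s : ℕ), 1 ≤ s → s ≤ p → m (chi p (-1) 1) (chi p α s) = chi p (-α) s
  chi_two_chi : ∀ (α : ℤˣ) (s : ℕ), 2 ≤ s → s ≤ p - 1 →
    m (chi p 1 2) (chi p α s) = chi p α (s - 1) + chi p α (s + 1)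
  chi_two_chi_p : ∀ α : ℤˣ,
    m (chi p 1 2) (chi p α p) = (2 : ℂ) • chi p α (p - 1) + (2 : ℂ) • chi p (-α) 1
  chi_two_G_one : m (chi p 1 2) (G p 1) = qInt p 2 • G p 2
  chi_two_G : ∀ s : ℕ, 2 ≤ s → s ≤ p - 2 → m (chi p 1 2) (G p s)
    = (qInt p (s - 1) / qInt p s) • G p (s - 1) + (qInt p (s + 1) / qInt p s) • G p (s + 1)
  chi_two_G_last : m (chi p 1 2) (G p (p - 1)) = qInt p 2 • G p (p - 2)
  chi_minus_G : ∀ s : ℕ, 1 ≤ s → s ≤ p - 1 → m (chi p (-1) 1) (G p s) = -G p (p - s)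
  G_mul_G : ∀ s t : ℕ, 1 ≤ s → s ≤ p - 1 → 1 ≤ t → t ≤ p - 1 → m (G p s) (G p t) = 0

end RestrictedQuantumGroup

end

open RestrictedQuantumGroup

set_option linter.unusedSectionVars false

noncomputable section

namespace RestrictedQuantumGroup

/-! Write η = iπ/p, so that q = e^η. The product rules come from a deformation in the highest
weight. In `UqT` the relation K^{2p} = 1 is dropped while E^p = F^p = 0 are kept; this algebra has,
for every complex a, a p-dimensional module with highest weight e^{a-η}, on which the Casimir
element C is the scalar `casVal p a`. Its trace `phi a` is an entire function of a with values in
symmetric forms. At a = sη it is χ^+_s + χ^-_{p-s} (`phi_nat`). For `psi a` = `phi a` + `phi (-a)`,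
the derivative at sη is 2[s]/(q-q⁻¹) times G_s (`dpsi_nat`): C acts on 𝒫^α(s) by Jordan blocks, so
G_s takes the derivative of γ^j where the characters take γ^j.

Tensoring such a module with one whose weights are the e^{β_k} gives a module filtered by highest
weight modules, so the trace is the sum of the `phi (a + β_k)` (`formMul_phi`). With 𝒳^+(2) this
reads `phi a` · χ^+_2 = `phi (a + η)` + `phi (a - η)`; the derivative of the symmetrised identity
gives χ^+_2 G_s. With a second deformed module it shows that b ↦ `psi a` · `psi b` is even about
each tη, hence `psi a` · `dpsi (tη)` = 0 for all a; one more derivative in a gives G_s G_t = 0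
(`formMul_dpsi_dpsi`).

The other rules use automorphisms and weights. Multiplication by χ^-_1 is composition with E ↦ E, F
↦ -F, K ↦ -K. The automorphism `flip` reverses the coproduct and fixes every element of the GTA
basis, which yields commutativity. The fusion rules with χ^+_2 away from s = p - 1 and s = p follow
from the characters and from the vanishing of the relevant forms at weights that do not occur; these
two boundary cases come from `phi`.

All identities of symmetric forms are checked on the C^j K^n only (`Uq.form_ext`), since a monomial
of nonzero weight is killed by conjugation with K. For the basis statement, let e_m be the
idempotent of weight q^m. Independence is tested on the f(C) e_m with interpolating polynomials f.
The bound 3p - 1 on the dimension (`SLF.coords_injective`) comes from three facts: e_m is killed by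
a polynomial of degree p in C; the differences of a form at e_{n+1} and e_{n-1} govern the passage
between weights of one parity; and p - 1 of these differences determine the others. Uniqueness holds
because χ^+_1, χ^-_1 and χ^+_2 generate the characters. -/

/-! ### Scalars -/

/-- `iπ/p`, a logarithm of `q`. -/
def logq (p : ℕ) : ℂ := Real.pi * Complex.I / p

lemma exp_logq (p : ℕ) : Complex.exp (logq p) = q p := rfl

lemma q_primitive {p : ℕ} (hp : p ≠ 0) : IsPrimitiveRoot (q p) (2 * p) := by
  have h := Complex.isPrimitiveRoot_exp (2 * p) (by omega)
  have h0 : (p : ℂ) ≠ 0 := by exact_mod_cast hp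
  have e : 2 * (Real.pi : ℂ) * Complex.I / ((2 * p : ℕ) : ℂ) = Real.pi * Complex.I / p := by
    push_cast; field_simp
  rwa [e] at h

lemma q_zpow_eq_one_iff {p : ℕ} (hp : p ≠ 0) (n : ℤ) : q p ^ n = 1 ↔ (2 * p : ℤ) ∣ n := by
  rw [(q_primitive hp).zpow_eq_one_iff_dvd]; push_cast; rfl

lemma q_zpow_eq_iff {p : ℕ} (hp : p ≠ 0) (m n : ℤ) :
    q p ^ m = q p ^ n ↔ (2 * p : ℤ) ∣ m - n := by
  rw [← q_zpow_eq_one_iff hp, zpow_sub₀ (q_ne_zero p),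
    div_eq_one_iff_eq (zpow_ne_zero _ (q_ne_zero p))]

/-- For p = 1 one has q = -1 and the claim fails; every division by q - q⁻¹ below rests on it. -/
lemma q_sub_inv_ne_zero {p : ℕ} (hp : 2 ≤ p) : q p - (q p)⁻¹ ≠ 0 := by
  intro h
  have h1 : q p ^ (2 : ℤ) = 1 := by
    have h2 : q p = (q p)⁻¹ := sub_eq_zero.mp h
    rw [zpow_ofNat, pow_two]; nth_rewrite 2 [h2]; exact mul_inv_cancel₀ (q_ne_zero p)
  rw [q_zpow_eq_one_iff (by omega)] at h1
  have := Int.le_of_dvd (by norm_num) h1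
  omega

lemma exp_int_mul_logq (p : ℕ) (n : ℤ) : Complex.exp (n * logq p) = q p ^ n := by
  rw [Complex.exp_int_mul, exp_logq]

lemma qInt_eq_zero_iff {p : ℕ} (hp : 2 ≤ p) (n : ℤ) : qInt p n = 0 ↔ (p : ℤ) ∣ n := by
  rw [qInt, div_eq_zero_iff, or_iff_left (q_sub_inv_ne_zero hp), sub_eq_zero,
    q_zpow_eq_iff (by omega), sub_neg_eq_add, ← two_mul]
  exact mul_dvd_mul_iff_left two_ne_zero

lemma qInt_one {p : ℕ} (hp : 2 ≤ p) : qInt p 1 = 1 := by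
  rw [qInt, zpow_one, zpow_neg_one, div_self (q_sub_inv_ne_zero hp)]

lemma qInt_sub_left {p : ℕ} (hp : p ≠ 0) (n : ℤ) : qInt p (p - n) = qInt p n := by
  have h : q p ^ (p : ℤ) = -1 := by rw [zpow_natCast, q_pow_p p hp]
  rw [qInt, qInt, zpow_neg, zpow_sub₀ (q_ne_zero p), h, zpow_neg]
  congr 1
  field_simp
  ring

/-- `(e^a + e^{-a}) / (q - q⁻¹)²`. -/
def casVal (p : ℕ) (a : ℂ) : ℂ :=
  (Complex.exp a + Complex.exp (-a)) / (q p - (q p)⁻¹) ^ 2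

lemma casVal_neg (p : ℕ) (a : ℂ) : casVal p (-a) = casVal p a := by
  rw [casVal, casVal, neg_neg, add_comm]

/-- The eigenvalue `(q^n + q^{-n}) / (q - q⁻¹)²` of the Casimir element. -/
def gam (p : ℕ) (n : ℤ) : ℂ := (q p ^ n + q p ^ (-n)) / (q p - (q p)⁻¹) ^ 2

lemma casVal_int (p : ℕ) (n : ℤ) : casVal p (n * logq p) = gam p n := by
  rw [casVal, gam, exp_int_mul_logq, ← neg_mul, ← Int.cast_neg, exp_int_mul_logq]

lemma gam_neg (p : ℕ) (n : ℤ) : gam p (-n) = gam p n := by rw [gam, gam, neg_neg, add_comm]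

lemma gam_add_p {p : ℕ} (hp : p ≠ 0) (n : ℤ) : gam p (n + p) = -gam p n := by
  have h : q p ^ (p : ℤ) = -1 := by rw [zpow_natCast, q_pow_p p hp]
  rw [gam, gam, neg_add, zpow_add₀ (q_ne_zero p), zpow_add₀ (q_ne_zero p), zpow_neg _ (p : ℤ), h]
  norm_num
  ring

lemma gam_p_sub {p : ℕ} (hp : p ≠ 0) (n : ℤ) : gam p (p - n) = -gam p n := by
  rw [sub_eq_neg_add, gam_add_p hp, gam_neg]

lemma gam_eq_iff {p : ℕ} (hp : 2 ≤ p) (m n : ℤ) :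
    gam p m = gam p n ↔ (2 * p : ℤ) ∣ m - n ∨ (2 * p : ℤ) ∣ m + n := by
  have h0 := q_ne_zero p
  rw [gam, gam, div_left_inj' (pow_ne_zero _ (q_sub_inv_ne_zero hp)),
    ← q_zpow_eq_iff (by omega), ← sub_neg_eq_add m n, ← q_zpow_eq_iff (by omega)]
  simp only [zpow_neg]
  have hm : q p ^ m ≠ 0 := zpow_ne_zero _ h0
  have hn : q p ^ n ≠ 0 := zpow_ne_zero _ h0
  generalize q p ^ m = x at *
  generalize q p ^ n = y at *
  rw [← sub_eq_zero, ← @sub_eq_zero _ _ x y, ← @sub_eq_zero _ _ x y⁻¹, ← mul_eq_zero]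
  -- The function x + x⁻¹ takes equal values only at x and x⁻¹, which gives the two divisibility
  -- conditions.
  have : x + x⁻¹ - (y + y⁻¹) = (x - y) * (x - y⁻¹) * x⁻¹ := by field_simp; ring
  rw [this, mul_eq_zero, or_iff_left (inv_ne_zero hm)]

/-- These p + 1 distinct values are the Casimir eigenvalues of the blocks, so interpolation at them
separates the blocks. -/
lemma gam_injOn {p : ℕ} (hp : 2 ≤ p) {m n : ℤ} (hm : 0 ≤ m) (hm' : m ≤ p) (hn : 0 ≤ n)
    (hn' : n ≤ p) (h : gam p m = gam p n) : m = n := by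
  rcases (gam_eq_iff hp m n).mp h with h | h
  · have := Int.eq_zero_of_abs_lt_dvd h (by rw [abs_lt]; constructor <;> omega)
    omega
  · obtain ⟨c, hc⟩ := h
    rcases lt_trichotomy c 0 with h1 | h1 | h1
    · nlinarith
    · subst h1; omega
    · have : m + n ≥ 2 * p := by nlinarith
      omega

/-! ### The algebra without the relation `K^{2p} = 1` -/

/-- The relations of `Ū_q(sl₂)` without `K^{2p} = 1`, where `l` is the inverse of `k`. -/
structure UqTRelations (p : ℕ) {A : Type*} [Ring A] [Algebra ℂ A] (e f k l : A) : Prop where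
  E_pow : e ^ p = 0
  F_pow : f ^ p = 0
  KL : k * l = 1
  LK : l * k = 1
  KE : k * e = (q p ^ 2) • (e * k)
  KF : k * f = ((q p ^ 2)⁻¹) • (f * k)
  EF : e * f = f * e + (q p - (q p)⁻¹)⁻¹ • (k - l)

/-- The generators `E`, `F`, `K` and `L = K⁻¹`. -/
inductive GenT
  | E
  | F
  | K
  | L

/-- The relations `UqTRelations`, on the free algebra. -/
inductive RelT (p : ℕ) : FreeAlgebra ℂ GenT → FreeAlgebra ℂ GenT → Prop
  | E_pow : RelT p (FreeAlgebra.ι ℂ GenT.E ^ p) 0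
  | F_pow : RelT p (FreeAlgebra.ι ℂ GenT.F ^ p) 0
  | KL : RelT p (FreeAlgebra.ι ℂ GenT.K * FreeAlgebra.ι ℂ GenT.L) 1
  | LK : RelT p (FreeAlgebra.ι ℂ GenT.L * FreeAlgebra.ι ℂ GenT.K) 1
  | KE : RelT p (FreeAlgebra.ι ℂ GenT.K * FreeAlgebra.ι ℂ GenT.E)
      ((q p ^ 2) • (FreeAlgebra.ι ℂ GenT.E * FreeAlgebra.ι ℂ GenT.K))
  | KF : RelT p (FreeAlgebra.ι ℂ GenT.K * FreeAlgebra.ι ℂ GenT.F)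
      (((q p ^ 2)⁻¹) • (FreeAlgebra.ι ℂ GenT.F * FreeAlgebra.ι ℂ GenT.K))
  | EF : RelT p (FreeAlgebra.ι ℂ GenT.E * FreeAlgebra.ι ℂ GenT.F)
      (FreeAlgebra.ι ℂ GenT.F * FreeAlgebra.ι ℂ GenT.E + (q p - (q p)⁻¹)⁻¹ •
        (FreeAlgebra.ι ℂ GenT.K - FreeAlgebra.ι ℂ GenT.L))

/-- The algebra with the generators and relations of `Ū_q(sl₂)` except `K^{2p} = 1`; its modules
include the highest weight modules of dimension `p` with an arbitrary highest weight. -/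
def UqT (p : ℕ) : Type := RingQuot (RelT p)

instance (p : ℕ) : Ring (UqT p) := inferInstanceAs (Ring (RingQuot (RelT p)))

instance (p : ℕ) : Algebra ℂ (UqT p) := inferInstanceAs (Algebra ℂ (RingQuot (RelT p)))

namespace UqT

/-- The projection from the free algebra. -/
def mk (p : ℕ) : FreeAlgebra ℂ GenT →ₐ[ℂ] UqT p := RingQuot.mkAlgHom ℂ (RelT p)

def E (p : ℕ) : UqT p := mk p (FreeAlgebra.ι ℂ GenT.E)

def F (p : ℕ) : UqT p := mk p (FreeAlgebra.ι ℂ GenT.F)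

def K (p : ℕ) : UqT p := mk p (FreeAlgebra.ι ℂ GenT.K)

def L (p : ℕ) : UqT p := mk p (FreeAlgebra.ι ℂ GenT.L)

lemma mk_rel {p : ℕ} {x y : FreeAlgebra ℂ GenT} (h : RelT p x y) : mk p x = mk p y :=
  RingQuot.mkAlgHom_rel ℂ h

lemma relations (p : ℕ) : UqTRelations p (E p) (F p) (K p) (L p) where
  E_pow := by simpa [E] using mk_rel (RelT.E_pow (p := p))
  F_pow := by simpa [F] using mk_rel (RelT.F_pow (p := p))
  KL := by simpa [K, L] using mk_rel (RelT.KL (p := p))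
  LK := by simpa [K, L] using mk_rel (RelT.LK (p := p))
  KE := by simpa [E, K] using mk_rel (RelT.KE (p := p))
  KF := by simpa [F, K] using mk_rel (RelT.KF (p := p))
  EF := by simpa [E, F, K, L] using mk_rel (RelT.EF (p := p))

/-- The images of the generators. -/
def genMap {A : Type*} (e f k l : A) : GenT → A
  | GenT.E => e
  | GenT.F => f
  | GenT.K => k
  | GenT.L => l

/-- The universal property. -/
def lift {p : ℕ} {A : Type*} [Ring A] [Algebra ℂ A] (e f k l : A)
    (h : UqTRelations p e f k l) : UqT p →ₐ[ℂ] A :=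
  RingQuot.liftAlgHom ℂ (s := RelT p) ⟨FreeAlgebra.lift ℂ (genMap e f k l), by
    intro x y hxy
    cases hxy
    · simpa [genMap] using h.E_pow
    · simpa [genMap] using h.F_pow
    · simpa [genMap] using h.KL
    · simpa [genMap] using h.LK
    · simpa [genMap] using h.KE
    · simpa [genMap] using h.KF
    · simpa [genMap] using h.EF⟩

section lift

variable {p : ℕ} {A : Type*} [Ring A] [Algebra ℂ A] {e f k l : A} (h : UqTRelations p e f k l)

lemma lift_mk (x : FreeAlgebra ℂ GenT) :
    lift e f k l h (mk p x) = FreeAlgebra.lift ℂ (genMap e f k l) x :=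
  RingQuot.liftAlgHom_mkAlgHom_apply ℂ _ _ x

@[simp] lemma lift_E : lift e f k l h (E p) = e := by simp [E, lift_mk, genMap]

@[simp] lemma lift_F : lift e f k l h (F p) = f := by simp [F, lift_mk, genMap]

@[simp] lemma lift_K : lift e f k l h (K p) = k := by simp [K, lift_mk, genMap]

@[simp] lemma lift_L : lift e f k l h (L p) = l := by simp [L, lift_mk, genMap]

end lift

lemma induction_gen {p : ℕ} (P : UqT p → Prop) (hc : ∀ r : ℂ, P (algebraMap ℂ _ r))
    (hE : P (E p)) (hF : P (F p)) (hK : P (K p)) (hL : P (L p))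
    (hadd : ∀ x y, P x → P y → P (x + y)) (hmul : ∀ x y, P x → P y → P (x * y))
    (x : UqT p) : P x := by
  obtain ⟨x, rfl⟩ : ∃ z, mk p z = x := RingQuot.mkAlgHom_surjective ℂ (RelT p) x
  induction x using FreeAlgebra.induction with
  | grade0 r => rw [AlgHom.commutes]; exact hc r
  | grade1 g => cases g <;> assumption
  | mul a b ha hb => rw [map_mul]; exact hmul _ _ ha hb
  | add a b ha hb => rw [map_add]; exact hadd _ _ ha hb

lemma algHom_ext {p : ℕ} {A : Type*} [Ring A] [Algebra ℂ A] {u v : UqT p →ₐ[ℂ] A}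
    (hE : u (E p) = v (E p)) (hF : u (F p) = v (F p)) (hK : u (K p) = v (K p))
    (hL : u (L p) = v (L p)) : u = v := by
  ext x
  induction x using induction_gen with
  | hc r => rw [AlgHom.commutes, AlgHom.commutes]
  | hE => exact hE
  | hF => exact hF
  | hK => exact hK
  | hL => exact hL
  | hadd x y hx hy => rw [map_add, map_add, hx, hy]
  | hmul x y hx hy => rw [map_mul, map_mul, hx, hy]

end UqT

/-! ### Consequences of the relations -/

namespace UqTRelations

variable {p : ℕ} {A : Type*} [Ring A] [Algebra ℂ A] {e f k l : A} (h : UqTRelations p e f k l)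
include h

lemma EK : e * k = (q p ^ 2)⁻¹ • (k * e) := by
  rw [h.KE, smul_smul, inv_mul_cancel₀ (pow_ne_zero _ (q_ne_zero p)), one_smul]

lemma FK : f * k = (q p ^ 2) • (k * f) := by
  rw [h.KF, smul_smul, mul_inv_cancel₀ (pow_ne_zero _ (q_ne_zero p)), one_smul]

lemma LE : l * e = (q p ^ 2)⁻¹ • (e * l) := by
  calc l * e = l * (e * k) * l := by rw [mul_assoc, mul_assoc, h.KL, mul_one]
    _ = _ := by rw [h.EK, mul_smul_comm, ← mul_assoc, h.LK, one_mul, smul_mul_assoc]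

lemma LF : l * f = (q p ^ 2) • (f * l) := by
  calc l * f = l * (f * k) * l := by rw [mul_assoc, mul_assoc, h.KL, mul_one]
    _ = _ := by rw [h.FK, mul_smul_comm, ← mul_assoc, h.LK, one_mul, smul_mul_assoc]

lemma EL : e * l = (q p ^ 2) • (l * e) := by
  rw [h.LE, smul_smul, mul_inv_cancel₀ (pow_ne_zero _ (q_ne_zero p)), one_smul]

end UqTRelations

/-- The Casimir element `FE + (qK + q⁻¹K⁻¹) / (q - q⁻¹)²`. -/
def casimir (p : ℕ) {A : Type*} [Ring A] [Algebra ℂ A] (e f k l : A) : A :=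
  f * e + ((q p - (q p)⁻¹) ^ 2)⁻¹ • (q p • k + (q p)⁻¹ • l)

lemma map_casimir (p : ℕ) {A B : Type*} [Ring A] [Algebra ℂ A] [Ring B] [Algebra ℂ B]
    (ρ : A →ₐ[ℂ] B) (e f k l : A) :
    ρ (casimir p e f k l) = casimir p (ρ e) (ρ f) (ρ k) (ρ l) := by
  simp [casimir]

namespace UqTRelations

variable {p : ℕ} {A : Type*} [Ring A] [Algebra ℂ A] {e f k l : A} (h : UqTRelations p e f k l)
include h

/-- Together with `FE_casimir` this replaces any adjacent pair of E and F by the Casimir element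
minus a combination of K and K⁻¹, so mixed monomials never need to be reordered. -/
lemma EF_casimir (hp : 2 ≤ p) : e * f = casimir p e f k l
    - ((q p - (q p)⁻¹) ^ 2)⁻¹ • ((q p)⁻¹ • k + q p • l) := by
  have h0 : q p - (q p)⁻¹ ≠ 0 := q_sub_inv_ne_zero hp
  rw [h.EF, casimir]
  have e1 : (q p - (q p)⁻¹)⁻¹ = ((q p - (q p)⁻¹) ^ 2)⁻¹ * (q p - (q p)⁻¹) := by
    field_simp
  rw [e1]
  module

omit h in
lemma FE_casimir : f * e = casimir p e f k l
    - ((q p - (q p)⁻¹) ^ 2)⁻¹ • (q p • k + (q p)⁻¹ • l) := by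
  rw [casimir, add_sub_cancel_right]

end UqTRelations

/-! ### Centrality of the Casimir element -/

namespace UqTRelations

variable {p : ℕ} {A : Type*} [Ring A] [Algebra ℂ A] {e f k l : A} (h : UqTRelations p e f k l)
include h

lemma commute_kl : Commute k l := by rw [Commute, SemiconjBy, h.KL, h.LK]

lemma k_pow_mul_e_pow (n : ℕ) : k * e ^ n = (q p ^ 2) ^ n • (e ^ n * k) := skew_comm h.KE n

lemma l_mul_e_pow (n : ℕ) : l * e ^ n = ((q p ^ 2)⁻¹) ^ n • (e ^ n * l) := skew_comm h.LE n

lemma k_mul_f_pow (n : ℕ) : k * f ^ n = ((q p ^ 2)⁻¹) ^ n • (f ^ n * k) := skew_comm h.KF n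

lemma l_mul_f_pow (n : ℕ) : l * f ^ n = (q p ^ 2) ^ n • (f ^ n * l) := skew_comm h.LF n

lemma casimir_commute_k : Commute (casimir p e f k l) k := by
  have h1 : f * e * k = k * (f * e) := by
    rw [mul_assoc, h.EK, mul_smul_comm, ← mul_assoc, h.FK, smul_mul_assoc, smul_smul,
      inv_mul_cancel₀ (pow_ne_zero _ (q_ne_zero p)), one_smul, mul_assoc]
  rw [Commute, SemiconjBy, casimir]
  simp only [add_mul, mul_add, smul_mul_assoc, mul_smul_comm, h1, h.KL, h.LK]

lemma casimir_commute_l : Commute (casimir p e f k l) l := by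
  have h1 := h.casimir_commute_k
  calc casimir p e f k l * l = l * (k * casimir p e f k l) * l := by
        rw [← mul_assoc, h.LK, one_mul]
    _ = l * casimir p e f k l := by
        rw [← h1.eq, mul_assoc, mul_assoc, h.KL, mul_one]

/-- In C·F = F(EF) + …, the Cartan part of EF carries q⁻¹K + qK⁻¹; moving F to the left through qK +
q⁻¹K⁻¹ produces exactly that combination, and the two cancel. -/
lemma casimir_commute_f (hp : 2 ≤ p) : Commute (casimir p e f k l) f := by
  have h0 := q_ne_zero p
  rw [Commute, SemiconjBy]
  nth_rewrite 1 [casimir]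
  rw [add_mul, mul_assoc, h.EF_casimir hp, smul_mul_assoc, add_mul, smul_mul_assoc,
    smul_mul_assoc, h.KF, h.LF, mul_sub, mul_smul_comm, mul_add, mul_smul_comm, mul_smul_comm]
  have e1 : q p * (q p ^ 2)⁻¹ = (q p)⁻¹ := by field_simp
  have e2 : (q p)⁻¹ * (q p ^ 2) = q p := by field_simp
  rw [smul_smul (q p), smul_smul (q p)⁻¹, e1, e2, sub_add_cancel]

lemma casimir_commute_e (hp : 2 ≤ p) : Commute (casimir p e f k l) e := by
  have h0 := q_ne_zero p
  have h1 : casimir p e f k l = e * f + ((q p - (q p)⁻¹) ^ 2)⁻¹ • ((q p)⁻¹ • k + q p • l) := by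
    rw [h.EF_casimir hp, sub_add_cancel]
  rw [Commute, SemiconjBy]
  nth_rewrite 1 [h1]
  rw [add_mul, mul_assoc, FE_casimir (p := p) (e := e) (f := f) (k := k) (l := l),
    smul_mul_assoc, add_mul, smul_mul_assoc,
    smul_mul_assoc, h.KE, h.LE, mul_sub, mul_smul_comm, mul_add, mul_smul_comm, mul_smul_comm]
  have e1 : q p * (q p ^ 2)⁻¹ = (q p)⁻¹ := by field_simp
  have e2 : (q p)⁻¹ * (q p ^ 2) = q p := by field_simp
  rw [smul_smul (q p), smul_smul (q p)⁻¹, e1, e2, sub_add_cancel]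

end UqTRelations

/-! ### A symmetric form is determined by its values on the Cartan part and the Casimir -/

namespace UqT

variable (p : ℕ)

/-- The Casimir element of `UqT p`. -/
def C : UqT p := casimir p (E p) (F p) (K p) (L p)

/-- The monomials `C^j K^a L^b`. -/
def cartan (j a b : ℕ) : UqT p := C p ^ j * K p ^ a * L p ^ b

variable {p}

lemma C_comm (hp : 2 ≤ p) (x : UqT p) : Commute (C p) x := by
  have R := relations p
  induction x using induction_gen with
  | hc r => exact Algebra.commute_algebraMap_right r _
  | hE => exact R.casimir_commute_e hp
  | hF => exact R.casimir_commute_f hp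
  | hK => exact R.casimir_commute_k
  | hL => exact R.casimir_commute_l
  | hadd x y hx hy => exact hx.add_right hy
  | hmul x y hx hy => exact hx.mul_right hy

lemma K_mul_cartan (j a b : ℕ) : K p * cartan p j a b = cartan p j (a + 1) b := by
  rw [cartan, cartan, ← mul_assoc, ← mul_assoc,
    show K p * C p ^ j = C p ^ j * K p from
      ((relations p).casimir_commute_k.pow_left j).symm.eq, mul_assoc (_ ^ j), ← pow_succ']

lemma L_mul_cartan (j a b : ℕ) : L p * cartan p j a b = cartan p j a (b + 1) := by
  rw [cartan, cartan, ← mul_assoc, ← mul_assoc,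
    show L p * C p ^ j = C p ^ j * L p from
      ((relations p).casimir_commute_l.pow_left j).symm.eq, mul_assoc (_ ^ j),
    ((relations p).commute_kl.pow_left a).symm.eq, ← mul_assoc, mul_assoc _ (L p), ← pow_succ']

lemma C_mul_cartan (j a b : ℕ) : C p * cartan p j a b = cartan p (j + 1) a b := by
  rw [cartan, cartan, ← mul_assoc, ← mul_assoc, ← pow_succ']

/-- The span of the elements `E^n C^j K^a L^b` and `F^n C^j K^a L^b`. -/
def triSpan (p : ℕ) : Submodule ℂ (UqT p) :=
  Submodule.span ℂ {x | ∃ n j a b, x = E p ^ n * cartan p j a b ∨ x = F p ^ n * cartan p j a b}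

lemma E_mem_triSpan (n j a b : ℕ) : E p ^ n * cartan p j a b ∈ triSpan p :=
  Submodule.subset_span ⟨n, j, a, b, Or.inl rfl⟩

lemma F_mem_triSpan (n j a b : ℕ) : F p ^ n * cartan p j a b ∈ triSpan p :=
  Submodule.subset_span ⟨n, j, a, b, Or.inr rfl⟩

lemma mul_mem_triSpan (x : UqT p)
    (hE : ∀ n j a b, x * (E p ^ n * cartan p j a b) ∈ triSpan p)
    (hF : ∀ n j a b, x * (F p ^ n * cartan p j a b) ∈ triSpan p) (y : UqT p)
    (hy : y ∈ triSpan p) : x * y ∈ triSpan p := by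
  have : triSpan p ≤ (triSpan p).comap (LinearMap.mulLeft ℂ x) := by
    refine Submodule.span_le.mpr ?_
    rintro _ ⟨n, j, a, b, rfl | rfl⟩
    · exact hE n j a b
    · exact hF n j a b
  exact this hy

lemma K_mul_triSpan (y : UqT p) (hy : y ∈ triSpan p) : K p * y ∈ triSpan p := by
  refine mul_mem_triSpan _ (fun n j a b => ?_) (fun n j a b => ?_) y hy
  · rw [← mul_assoc, (relations p).k_pow_mul_e_pow, smul_mul_assoc, mul_assoc, K_mul_cartan]
    exact Submodule.smul_mem _ _ (E_mem_triSpan _ _ _ _)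
  · rw [← mul_assoc, (relations p).k_mul_f_pow, smul_mul_assoc, mul_assoc, K_mul_cartan]
    exact Submodule.smul_mem _ _ (F_mem_triSpan _ _ _ _)

lemma L_mul_triSpan (y : UqT p) (hy : y ∈ triSpan p) : L p * y ∈ triSpan p := by
  refine mul_mem_triSpan _ (fun n j a b => ?_) (fun n j a b => ?_) y hy
  · rw [← mul_assoc, (relations p).l_mul_e_pow, smul_mul_assoc, mul_assoc, L_mul_cartan]
    exact Submodule.smul_mem _ _ (E_mem_triSpan _ _ _ _)
  · rw [← mul_assoc, (relations p).l_mul_f_pow, smul_mul_assoc, mul_assoc, L_mul_cartan]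
    exact Submodule.smul_mem _ _ (F_mem_triSpan _ _ _ _)

lemma C_mul_triSpan (hp : 2 ≤ p) (y : UqT p) (hy : y ∈ triSpan p) : C p * y ∈ triSpan p := by
  refine mul_mem_triSpan _ (fun n j a b => ?_) (fun n j a b => ?_) y hy
  · rw [← mul_assoc, (C_comm hp _).eq, mul_assoc, C_mul_cartan]
    exact E_mem_triSpan _ _ _ _
  · rw [← mul_assoc, (C_comm hp _).eq, mul_assoc, C_mul_cartan]
    exact F_mem_triSpan _ _ _ _

/-- On E^n nothing happens; on F^{n+1} the product EF is traded for C, K and K⁻¹, each of which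
preserves the span. -/
lemma E_mul_triSpan (hp : 2 ≤ p) (y : UqT p) (hy : y ∈ triSpan p) : E p * y ∈ triSpan p := by
  refine mul_mem_triSpan _ (fun n j a b => ?_) (fun n j a b => ?_) y hy
  · rw [← mul_assoc, ← pow_succ']
    exact E_mem_triSpan _ _ _ _
  · cases n with
    | zero => simpa using E_mem_triSpan (p := p) 1 j a b
    | succ n =>
      have hm := F_mem_triSpan (p := p) n j a b
      rw [pow_succ', ← mul_assoc, ← mul_assoc, (relations p).EF_casimir hp, mul_assoc, sub_mul,
        smul_mul_assoc, add_mul, smul_mul_assoc, smul_mul_assoc]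
      exact sub_mem (C_mul_triSpan hp _ hm) (Submodule.smul_mem _ _ (add_mem
        (Submodule.smul_mem _ _ (K_mul_triSpan _ hm)) (Submodule.smul_mem _ _ (L_mul_triSpan _ hm))))

lemma F_mul_triSpan (hp : 2 ≤ p) (y : UqT p) (hy : y ∈ triSpan p) : F p * y ∈ triSpan p := by
  refine mul_mem_triSpan _ (fun n j a b => ?_) (fun n j a b => ?_) y hy
  · cases n with
    | zero => simpa using F_mem_triSpan (p := p) 1 j a b
    | succ n =>
      have hm := E_mem_triSpan (p := p) n j a b
      rw [pow_succ', ← mul_assoc, ← mul_assoc, UqTRelations.FE_casimir (p := p) (e := E p)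
        (f := F p) (k := K p) (l := L p), mul_assoc, sub_mul, smul_mul_assoc, add_mul, smul_mul_assoc, smul_mul_assoc]
      exact sub_mem (C_mul_triSpan hp _ hm) (Submodule.smul_mem _ _ (add_mem
        (Submodule.smul_mem _ _ (K_mul_triSpan _ hm)) (Submodule.smul_mem _ _ (L_mul_triSpan _ hm))))
  · rw [← mul_assoc, ← pow_succ']
    exact F_mem_triSpan _ _ _ _

/-- The span contains 1 and is stable under left multiplication by the generators, hence is a left
ideal containing 1. -/
lemma triSpan_eq_top (hp : 2 ≤ p) : triSpan p = ⊤ := by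
  refine Submodule.eq_top_iff'.mpr fun x => ?_
  suffices H : ∀ y ∈ triSpan p, x * y ∈ triSpan p by
    have h1 : (1 : UqT p) ∈ triSpan p := by simpa [cartan] using E_mem_triSpan (p := p) 0 0 0 0
    simpa using H 1 h1
  induction x using induction_gen with
  | hc r =>
    intro y hy
    rw [← Algebra.smul_def]
    exact Submodule.smul_mem _ _ hy
  | hE => exact E_mul_triSpan hp
  | hF => exact F_mul_triSpan hp
  | hK => exact K_mul_triSpan
  | hL => exact L_mul_triSpan
  | hadd x y hx hy => intro z hz; rw [add_mul]; exact add_mem (hx z hz) (hy z hz)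
  | hmul x y hx hy => intro z hz; rw [mul_assoc]; exact hx _ (hy z hz)

/-- A symmetric form is invariant under conjugation by K, which multiplies x by c; hence θ(x) = c
θ(x). -/
lemma form_eq_zero_of_skew (θ : UqT p →ₗ[ℂ] ℂ) (hθ : ∀ x y, θ (x * y) = θ (y * x)) (x : UqT p)
    (c : ℂ) (hc : c ≠ 1) (hx : K p * x = c • (x * K p)) : θ x = 0 := by
  have h1 : θ (K p * (x * L p)) = θ x := by
    rw [hθ, mul_assoc, (relations p).LK, mul_one]
  rw [← mul_assoc, hx, smul_mul_assoc, mul_assoc, (relations p).KL, mul_one, map_smul,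
    smul_eq_mul] at h1
  have h2 : (c - 1) * θ x = 0 := by rw [sub_mul, h1, one_mul, sub_self]
  exact (mul_eq_zero.mp h2).resolve_left (sub_ne_zero.mpr hc)

/-- By `triSpan_eq_top` only the E^n or F^n times a Cartan monomial matter. For 0 < n < p
conjugation by K scales them by q^{±2n} ≠ 1, because q² is a primitive p-th root of unity; for n ≥ p
they vanish. -/
lemma form_eq_zero (hp : 2 ≤ p) (θ : UqT p →ₗ[ℂ] ℂ) (hθ : ∀ x y, θ (x * y) = θ (y * x))
    (h0 : ∀ j a b, θ (cartan p j a b) = 0) : θ = 0 := by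
  have R := relations p
  have hprim := q_sq_primitive p (by omega)
  have hcK : ∀ j a b, cartan p j a b * K p = K p * cartan p j a b := fun j a b => by
    refine Commute.eq (Commute.mul_left (Commute.mul_left ?_ ?_) ?_)
    · exact (R.casimir_commute_k).pow_left j
    · exact (Commute.refl _).pow_left a
    · exact R.commute_kl.symm.pow_left b
  refine LinearMap.ext_on (s := {x | ∃ n j a b, x = E p ^ n * cartan p j a b ∨
    x = F p ^ n * cartan p j a b}) (triSpan_eq_top hp) ?_
  rintro _ ⟨n, j, a, b, rfl | rfl⟩
  · rcases Nat.eq_zero_or_pos n with rfl | hn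
    · simpa using h0 j a b
    rcases lt_or_ge n p with hnp | hnp
    · refine form_eq_zero_of_skew θ hθ _ ((q p ^ 2) ^ n)
        (hprim.pow_ne_one_of_pos_of_lt (by omega) hnp) ?_
      rw [← mul_assoc, R.k_pow_mul_e_pow, smul_mul_assoc, mul_assoc, mul_assoc, hcK]
    · rw [pow_eq_zero_of_le hnp R.E_pow, zero_mul, map_zero, map_zero]
  · rcases Nat.eq_zero_or_pos n with rfl | hn
    · simpa using h0 j a b
    rcases lt_or_ge n p with hnp | hnp
    · refine form_eq_zero_of_skew θ hθ _ (((q p ^ 2)⁻¹) ^ n) ?_ ?_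
      · rw [inv_pow, Ne, inv_eq_one]
        exact hprim.pow_ne_one_of_pos_of_lt (by omega) hnp
      · rw [← mul_assoc, R.k_mul_f_pow, smul_mul_assoc, mul_assoc, mul_assoc, hcK]
    · rw [pow_eq_zero_of_le hnp R.F_pow, zero_mul, map_zero, map_zero]

lemma form_ext (hp : 2 ≤ p) {θ θ' : UqT p →ₗ[ℂ] ℂ} (hθ : ∀ x y, θ (x * y) = θ (y * x))
    (hθ' : ∀ x y, θ' (x * y) = θ' (y * x))
    (h0 : ∀ j a b, θ (cartan p j a b) = θ' (cartan p j a b)) : θ = θ' := by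
  rw [← sub_eq_zero]
  refine form_eq_zero hp _ (fun x y => ?_) (fun j a b => ?_)
  · rw [LinearMap.sub_apply, LinearMap.sub_apply, hθ, hθ']
  · rw [LinearMap.sub_apply, h0, sub_self]

lemma map_cartan {B : Type*} [Semiring B] [Algebra ℂ B] (ρ : UqT p →ₐ[ℂ] B) (j a b : ℕ) :
    ρ (cartan p j a b) = ρ (C p) ^ j * ρ (K p) ^ a * ρ (L p) ^ b := by
  simp [cartan]

/-! ### The coproduct of `UqT p` and the projection onto `Ū_q` -/

lemma comul_relations (hp : p ≠ 0) :
    UqTRelations p (1 ⊗ₜ[ℂ] E p + E p ⊗ₜ[ℂ] K p) (F p ⊗ₜ[ℂ] 1 + L p ⊗ₜ[ℂ] F p)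
      (K p ⊗ₜ[ℂ] K p) (L p ⊗ₜ[ℂ] L p) := by
  have hq2 : q p ^ 2 ≠ 0 := pow_ne_zero _ (q_ne_zero p)
  have R := relations p
  refine ⟨?_, ?_, ?_, ?_, ?_, ?_, ?_⟩
  · rw [skew_add_pow_root hp (q_sq_primitive p hp)]
    · simp [Algebra.TensorProduct.tmul_pow, R.E_pow]
    · simp [R.KE]
  · rw [skew_add_pow_root hp (q_sq_primitive p hp)]
    · simp [Algebra.TensorProduct.tmul_pow, R.F_pow]
    · simp [R.LF, TensorProduct.smul_tmul']
  · simp [R.KL, Algebra.TensorProduct.one_def]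
  · simp [R.LK, Algebra.TensorProduct.one_def]
  · simp [mul_add, add_mul, R.KE, TensorProduct.smul_tmul']
  · simp [mul_add, add_mul, R.KF, R.KL, R.LK, TensorProduct.smul_tmul']
  · have hcross : (E p * L p) ⊗ₜ[ℂ] (K p * F p) = (L p * E p) ⊗ₜ[ℂ] (F p * K p) := by
      rw [R.EL, R.KF, TensorProduct.smul_tmul, smul_smul, mul_inv_cancel₀ hq2, one_smul]
    simp only [mul_add, add_mul, Algebra.TensorProduct.tmul_mul_tmul, mul_one, one_mul, hcross]
    rw [R.EF, TensorProduct.tmul_add, TensorProduct.add_tmul, TensorProduct.tmul_smul,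
      ← TensorProduct.smul_tmul', TensorProduct.tmul_sub, TensorProduct.sub_tmul, smul_sub,
      smul_sub, smul_sub]
    abel

/-- The coproduct of `UqT p`. -/
def comulHom (p : ℕ) [NeZero p] : UqT p →ₐ[ℂ] UqT p ⊗[ℂ] UqT p :=
  lift _ _ _ _ (comul_relations (NeZero.ne p))

/-- The projection `UqT p → Ū_q`. -/
def toUq (p : ℕ) [NeZero p] : UqT p →ₐ[ℂ] Uq p :=
  lift (Uq.E p) (Uq.F p) (Uq.K p) (Uq.Kinv p)
    { E_pow := (Uq.relations p).E_pow
      F_pow := (Uq.relations p).F_pow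
      KL := Uq.K_mul_Kinv p (NeZero.ne p)
      LK := Uq.Kinv_mul_K p (NeZero.ne p)
      KE := (Uq.relations p).KE
      KF := (Uq.relations p).KF
      EF := (Uq.relations p).EF }

variable [NeZero p]

@[simp] lemma comulHom_E : comulHom p (E p) = 1 ⊗ₜ[ℂ] E p + E p ⊗ₜ[ℂ] K p := lift_E _
@[simp] lemma comulHom_F : comulHom p (F p) = F p ⊗ₜ[ℂ] 1 + L p ⊗ₜ[ℂ] F p := lift_F _
@[simp] lemma comulHom_K : comulHom p (K p) = K p ⊗ₜ[ℂ] K p := lift_K _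
@[simp] lemma comulHom_L : comulHom p (L p) = L p ⊗ₜ[ℂ] L p := lift_L _
@[simp] lemma toUq_E : toUq p (E p) = Uq.E p := lift_E _
@[simp] lemma toUq_F : toUq p (F p) = Uq.F p := lift_F _
@[simp] lemma toUq_K : toUq p (K p) = Uq.K p := lift_K _
@[simp] lemma toUq_L : toUq p (L p) = Uq.Kinv p := lift_L _

/-- Compatibility with the coproducts lets products in SLF(Ū_q) be computed after pulling back to
`UqT p`, where the deformed modules live. -/
lemma comulHom_toUq (z : UqT p) : Uq.comulHom p (toUq p z)
    = Algebra.TensorProduct.map (toUq p) (toUq p) (comulHom p z) := by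
  have : (Uq.comulHom p).comp (toUq p)
      = (Algebra.TensorProduct.map (toUq p) (toUq p)).comp (comulHom p) := by
    apply algHom_ext <;> simp
  exact DFunLike.congr_fun this z

lemma toUq_surjective : Function.Surjective (toUq p) := by
  intro x
  induction x using Uq.induction_gen with
  | hc r => exact ⟨algebraMap ℂ _ r, AlgHom.commutes _ _⟩
  | hE => exact ⟨_, toUq_E⟩
  | hF => exact ⟨_, toUq_F⟩
  | hK => exact ⟨_, toUq_K⟩
  | hadd x y hx hy =>
    obtain ⟨a, rfl⟩ := hx
    obtain ⟨b, rfl⟩ := hy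
    exact ⟨a + b, map_add _ _ _⟩
  | hmul x y hx hy =>
    obtain ⟨a, rfl⟩ := hx
    obtain ⟨b, rfl⟩ := hy
    exact ⟨a * b, map_mul _ _ _⟩

end UqT

/-! ### The Casimir element of Ū_q, and symmetric forms on Ū_q -/

namespace Uq

variable (p : ℕ)

/-- The Casimir element of `Ū_q`. -/
def C : Uq p := casimir p (E p) (F p) (K p) (Kinv p)

variable {p}
variable [NeZero p]

lemma toUq_C : UqT.toUq p (UqT.C p) = C p := by
  rw [UqT.C, map_casimir]; simp [C]

lemma toUq_cartan (j a b : ℕ) :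
    UqT.toUq p (UqT.cartan p j a b) = C p ^ j * K p ^ (a + (2 * p - 1) * b) := by
  rw [UqT.map_cartan, toUq_C, UqT.toUq_K, UqT.toUq_L, Kinv, ← pow_mul, mul_assoc, ← pow_add]

lemma C_comm (hp : 2 ≤ p) (x : Uq p) : Commute (C p) x := by
  obtain ⟨z, rfl⟩ := UqT.toUq_surjective x
  rw [← toUq_C]
  exact (UqT.C_comm hp z).map (UqT.toUq p)

/-- A symmetric form on `Ū_q` is determined by its values on the `C^j K^n`. -/
lemma form_ext (hp : 2 ≤ p) {θ θ' : Uq p →ₗ[ℂ] ℂ} (hθ : ∀ x y, θ (x * y) = θ (y * x))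
    (hθ' : ∀ x y, θ' (x * y) = θ' (y * x))
    (h0 : ∀ j n, θ (C p ^ j * K p ^ n) = θ' (C p ^ j * K p ^ n)) : θ = θ' := by
  have H : θ ∘ₗ (UqT.toUq p).toLinearMap = θ' ∘ₗ (UqT.toUq p).toLinearMap := by
    refine UqT.form_ext hp (fun x y => ?_) (fun x y => ?_) (fun j a b => ?_)
    · simp [hθ (UqT.toUq p x)]
    · simp [hθ' (UqT.toUq p x)]
    · simp only [LinearMap.comp_apply, AlgHom.toLinearMap_apply, toUq_cartan, h0]
  ext x
  obtain ⟨z, rfl⟩ := UqT.toUq_surjective x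
  exact LinearMap.congr_fun H z

end Uq

/-! ### Values of the GTA forms on the `C^j K^n` -/

section

variable {p : ℕ} [NeZero p]

lemma SLF.symm (φ : SLF p) (x y : Uq p) : φ.1.ofConv (x * y) = φ.1.ofConv (y * x) := φ.2 x y

lemma SLF.ext_cartan (hp : 2 ≤ p) {φ ψ : SLF p}
    (h : ∀ j n, φ.1.ofConv (Uq.C p ^ j * Uq.K p ^ n) = ψ.1.ofConv (Uq.C p ^ j * Uq.K p ^ n)) :
    φ = ψ := by
  have := Uq.form_ext hp φ.2 ψ.2 h
  exact Subtype.ext (WithConv.ofConv_injective this)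

lemma SLF.mul_apply (φ ψ : SLF p) (x : Uq p) : (φ * ψ).1.ofConv x
    = LinearMap.mul' ℂ ℂ (TensorProduct.map φ.1.ofConv ψ.1.ofConv (Uq.comulHom p x)) := rfl

lemma SLF.add_apply (φ ψ : SLF p) (x : Uq p) :
    (φ + ψ).1.ofConv x = φ.1.ofConv x + ψ.1.ofConv x := rfl

lemma SLF.sub_apply (φ ψ : SLF p) (x : Uq p) :
    (φ - ψ).1.ofConv x = φ.1.ofConv x - ψ.1.ofConv x := rfl

lemma SLF.neg_apply (φ : SLF p) (x : Uq p) : (-φ).1.ofConv x = -φ.1.ofConv x := rfl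

lemma SLF.zero_apply (x : Uq p) : (0 : SLF p).1.ofConv x = 0 := rfl

/-- Evaluation at an element, as a linear form on `SLF(Ū_q)`. -/
def SLF.eval (x : Uq p) : SLF p →ₗ[ℂ] ℂ where
  toFun φ := φ.1.ofConv x
  map_add' _ _ := rfl
  map_smul' _ _ := rfl

lemma traceForm_apply {V : Type} [AddCommGroup V] [Module ℂ V]
    (ρ : Uq p →ₐ[ℂ] Module.End ℂ V) (x : Uq p) :
    (traceForm ρ).1.ofConv x = LinearMap.trace ℂ V (ρ x) := rfl

lemma chi_apply {α : ℤˣ} {s : ℕ} (h : s ≤ p) (x : Uq p) : (chi p α s).1.ofConv x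
    = LinearMap.trace ℂ _ (simpleRep p α s h x) := by
  rw [chi, dif_pos h, traceForm_apply]

lemma trace_eq_sum {ι : Type} [Fintype ι] [DecidableEq ι] (f : Module.End ℂ (ι →₀ ℂ)) :
    LinearMap.trace ℂ _ f = ∑ i, f (Finsupp.single i 1) i := by
  rw [LinearMap.trace_eq_matrix_trace ℂ Finsupp.basisSingleOne, Matrix.trace]
  simp [LinearMap.toMatrix_apply]

lemma apply_Kinv {V : Type*} [AddCommGroup V] [Module ℂ V] (ρ : Uq p →ₐ[ℂ] Module.End ℂ V)
    {v : V} {c : ℂ} (hc : c ≠ 0) (h : ρ (Uq.K p) v = c • v) : ρ (Uq.Kinv p) v = c⁻¹ • v := by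
  have h1 : ρ (Uq.Kinv p) (ρ (Uq.K p) v) = v := by
    rw [← Module.End.mul_apply, ← map_mul, Uq.Kinv_mul_K p (NeZero.ne p), map_one,
      Module.End.one_apply]
  rw [h, map_smul] at h1
  rw [← h1, smul_smul, inv_mul_cancel₀ hc, one_smul, h1]

/-- The action of the Casimir element on a weight vector. -/
lemma apply_casimir {V : Type*} [AddCommGroup V] [Module ℂ V] (ρ : Uq p →ₐ[ℂ] Module.End ℂ V)
    {v : V} {c : ℂ} (hc : c ≠ 0) (h : ρ (Uq.K p) v = c • v) :
    ρ (Uq.C p) v = ρ (Uq.F p) (ρ (Uq.E p) v)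
      + ((q p * c + (q p * c)⁻¹) / (q p - (q p)⁻¹) ^ 2) • v := by
  rw [Uq.C, map_casimir, casimir]
  simp only [LinearMap.add_apply, LinearMap.smul_apply, Module.End.mul_apply, h,
    apply_Kinv ρ hc h]
  rw [mul_inv]
  module

lemma wt_inv (α : ℤˣ) (m : ℤ) : (wt p α m)⁻¹ = wt p α (-m) := by
  rw [wt, wt, mul_inv, zpow_neg, inv_eq_of_mul_eq_one_right (sgn_sq α)]

lemma q_mul_wt (α : ℤˣ) (m : ℤ) : q p * wt p α m = wt p α (m + 1) := by
  rw [wt, wt, zpow_add₀ (q_ne_zero p), zpow_one]; ring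

lemma wt_add_wt_neg (α : ℤˣ) (m : ℤ) :
    (wt p α m + (wt p α m)⁻¹) / (q p - (q p)⁻¹) ^ 2 = sgn α * gam p m := by
  rw [wt_inv, gam, wt, wt]; ring

lemma pow_apply_of_eigen {V : Type*} [AddCommGroup V] [Module ℂ V] {f : Module.End ℂ V} {v : V}
    {c : ℂ} (h : f v = c • v) (n : ℕ) : (f ^ n) v = c ^ n • v := by
  induction n with
  | zero => simp
  | succ n ih => rw [pow_succ, Module.End.mul_apply, h, map_smul, ih, smul_smul, pow_succ']

/-! ### Characters of the simple modules -/

section simple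

variable (α : ℤˣ) {s : ℕ} (h : s ≤ p)

lemma simpleRep_K (i : Fin s) : simpleRep p α s h (Uq.K p) (Finsupp.single i 1)
    = wt p α (s - 1 - 2 * (i : ℤ)) • Finsupp.single i 1 := by
  rw [simpleRep, Uq.lift_K, simpleK, op_single]

lemma simpleRep_E (i : Fin s) : simpleRep p α s h (Uq.E p) (Finsupp.single i 1)
    = (sgn α * qInt p i * qInt p (s - i)) • bvec id ((i : ℕ) - 1) := by
  rw [simpleRep, Uq.lift_E, simpleE, op_single]

lemma simpleRep_F (i : Fin s) : simpleRep p α s h (Uq.F p) (Finsupp.single i 1)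
    = bvec id ((i : ℕ) + 1) := by
  rw [simpleRep, Uq.lift_F, simpleF, op_single]

/-- The scalar is read off at v_0, which E kills, and centrality carries it along F to the other
v_i. -/
lemma simpleRep_C (hp : 2 ≤ p) :
    simpleRep p α s h (Uq.C p) = (sgn α * gam p s) • 1 := by
  refine end_ext fun ⟨i, hi⟩ => ?_
  induction i with
  | zero =>
    rw [apply_casimir _ (wt_ne_zero p α _) (simpleRep_K α h _), simpleRep_E, q_mul_wt,
      wt_add_wt_neg]
    simp [qInt_zero]
  | succ i ih =>
    have e : (Finsupp.single ⟨i + 1, hi⟩ 1 : Fin s →₀ ℂ)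
        = simpleRep p α s h (Uq.F p) (Finsupp.single ⟨i, by omega⟩ 1) := by
      rw [simpleRep_F, bvec_of_lt _ hi]; rfl
    rw [e, ← Module.End.mul_apply, ← map_mul, (Uq.C_comm hp _).eq, map_mul, Module.End.mul_apply,
      ih (by omega), LinearMap.smul_apply, LinearMap.smul_apply, Module.End.one_apply,
      Module.End.one_apply, map_smul]

include h in
lemma chi_cartan (hp : 2 ≤ p) (j n : ℕ) : (chi p α s).1.ofConv (Uq.C p ^ j * Uq.K p ^ n)
    = (sgn α * gam p s) ^ j * ∑ i ∈ Finset.range s, wt p α (s - 1 - 2 * (i : ℤ)) ^ n := by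
  rw [chi_apply h, map_mul, map_pow, map_pow, simpleRep_C α h hp, trace_eq_sum, Finset.mul_sum,
    Finset.sum_range]
  refine Finset.sum_congr rfl fun i _ => ?_
  rw [Module.End.mul_apply, pow_apply_of_eigen (simpleRep_K α h i)]
  simp [smul_pow, mul_comm]

end simple

/-! ### Jordan blocks of the Casimir element on 𝒫^α(s) -/

section proj

variable (α : ℤˣ) {s t : ℕ} (h : s + t = p) (hs : 0 < s) (ht : 0 < t)

lemma projRep_K_single (i : PIdx s t) : projRep p α s t h hs ht (Uq.K p) (Finsupp.single i 1)
    = projWt s t p α i • Finsupp.single i 1 := by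
  rw [projRep, Uq.lift_K, projK, op_single]

lemma projRep_C_a (hp : 2 ≤ p) (i : ℕ) (hi : i < s) :
    projRep p α s t h hs ht (Uq.C p) (va s t i) = (sgn α * gam p s) • va s t i := by
  induction i with
  | zero =>
    have hK : projRep p α s t h hs ht (Uq.K p) (va s t 0) = wt p α (s - 1) • va s t 0 := by
      rw [projRep, Uq.lift_K, projK_a s t p α hi]; simp
    rw [apply_casimir _ (wt_ne_zero p α _) hK, q_mul_wt, wt_add_wt_neg]
    nth_rewrite 2 [projRep]
    rw [Uq.lift_E, projE_a s t p α hi]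
    simp
  | succ i ih =>
    have e : va s t (i + 1) = projRep p α s t h hs ht (Uq.F p) (va s t i) := by
      rw [projRep, Uq.lift_F, projF_a s t (by omega), if_neg (by omega)]
    rw [e, ← Module.End.mul_apply, ← map_mul, (Uq.C_comm hp _).eq, map_mul, Module.End.mul_apply,
      ih (by omega), map_smul]

/-- The nilpotent part appears because FE b_0 = F x_{t-1} = a_0; centrality of C then moves the
formula along F to every b_i. This is the source of the forms G_s. -/
lemma projRep_C_b (hp : 2 ≤ p) (i : ℕ) (hi : i < s) :
    projRep p α s t h hs ht (Uq.C p) (vb s t i)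
      = (sgn α * gam p s) • vb s t i + va s t i := by
  induction i with
  | zero =>
    have hK : projRep p α s t h hs ht (Uq.K p) (vb s t 0) = wt p α (s - 1) • vb s t 0 := by
      rw [projRep, Uq.lift_K, projK_b s t p α hi]; simp
    rw [apply_casimir _ (wt_ne_zero p α _) hK, q_mul_wt, wt_add_wt_neg]
    nth_rewrite 1 [projRep]
    nth_rewrite 1 [projRep]
    rw [Uq.lift_E, Uq.lift_F, projE_b s t p α hi, if_pos rfl, projF_x s t (by omega),
      if_pos (by omega), sub_add_cancel, add_comm]
  | succ i ih =>
    have e : vb s t (i + 1) = projRep p α s t h hs ht (Uq.F p) (vb s t i) := by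
      rw [projRep, Uq.lift_F, projF_b s t (by omega), if_neg (by omega)]
    have e' : va s t (i + 1) = projRep p α s t h hs ht (Uq.F p) (va s t i) := by
      rw [projRep, Uq.lift_F, projF_a s t (by omega), if_neg (by omega)]
    rw [e, ← Module.End.mul_apply, ← map_mul, (Uq.C_comm hp _).eq, map_mul, Module.End.mul_apply,
      ih (by omega), map_add, map_smul, e']

/-- On a Jordan block of size 2 the off-diagonal entry of C^j is the derivative of γ^j. The
truncated exponent `j - 1` is harmless at j = 0, where the coefficient vanishes. -/
lemma projRep_C_pow_b (hp : 2 ≤ p) (i : ℕ) (hi : i < s) (j : ℕ) :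
    (projRep p α s t h hs ht (Uq.C p) ^ j) (vb s t i)
      = (sgn α * gam p s) ^ j • vb s t i
        + (j * (sgn α * gam p s) ^ (j - 1)) • va s t i := by
  induction j with
  | zero => simp
  | succ j ih =>
    rw [pow_succ', Module.End.mul_apply, ih, map_add, map_smul, map_smul,
      projRep_C_a α h hs ht hp i hi, projRep_C_b α h hs ht hp i hi]
    rcases j with _ | j
    · simp
    · simp only [Nat.add_sub_cancel]
      push_cast
      module

lemma trH_cartan (hp : 2 ≤ p) (j n : ℕ) :
    trH p α s t h hs ht (Uq.C p ^ j * Uq.K p ^ n)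
      = j * (sgn α * gam p s) ^ (j - 1)
        * ∑ i ∈ Finset.range s, wt p α (s - 1 - 2 * (i : ℤ)) ^ n := by
  rw [trH, LinearMap.sum_apply, Finset.mul_sum, Finset.sum_range]
  refine Finset.sum_congr rfl fun i _ => ?_
  change projRep p α s t h hs ht (Uq.C p ^ j * Uq.K p ^ n) (Finsupp.single (Sum.inl i) 1)
    (ia s t i) = _
  rw [map_mul, map_pow, map_pow, Module.End.mul_apply,
    pow_apply_of_eigen (projRep_K_single α h hs ht _), map_smul, single_b,
    projRep_C_pow_b α h hs ht hp i i.2, Finsupp.smul_apply, Finsupp.add_apply, Finsupp.smul_apply,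
    Finsupp.smul_apply, vb, va, bvec_of_lt _ i.2, bvec_of_lt _ i.2]
  simp [ib, ia, projWt, pcases, mul_comm]

end proj

/-- The sum of the `n`-th powers of the `p` weights `q^m` with `m ≡ s - 1` modulo `2`. -/
def clsSum (p : ℕ) (s : ℤ) (n : ℕ) : ℂ := ∑ i ∈ Finset.range p, (q p ^ (s - 1 - 2 * (i : ℤ))) ^ n

lemma wt_one (m : ℤ) : wt p 1 m = q p ^ m := by simp [wt, sgn]

/-- Since -1 = q^p, the weights of 𝒳^-(p-s) continue the string q^{s-1}, q^{s-3}, … of 𝒳^+(s) modulo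
q^{2p} = 1; together they exhaust one parity class of exponents. -/
lemma sum_range_add_sub (s : ℕ) (h : s ≤ p) (n : ℕ) :
    ∑ i ∈ Finset.range s, wt p 1 (s - 1 - 2 * (i : ℤ)) ^ n
      + ∑ i ∈ Finset.range (p - s), wt p (-1) ((p - s : ℕ) - 1 - 2 * (i : ℤ)) ^ n
    = clsSum p s n := by
  obtain ⟨t, ht⟩ := Nat.exists_eq_add_of_le h
  rw [clsSum]
  have e : Finset.range p = Finset.range (s + t) := by rw [ht]
  rw [e, Finset.sum_range_add, show p - s = t by omega]
  refine congrArg₂ (· + ·) (Finset.sum_congr rfl fun i _ => by rw [wt_one])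
    (Finset.sum_congr rfl fun i _ => ?_)
  rw [wt_neg p (NeZero.ne p), wt_one, (q_zpow_eq_iff (NeZero.ne p) _ _).mpr]
  exact ⟨1, by rw [ht]; push_cast; ring⟩

lemma sgn_neg_one : sgn (-1) = -1 := by simp [sgn]
lemma sgn_one : sgn 1 = 1 := by simp [sgn]

lemma sgn_neg_one_mul_gam (s : ℕ) (h : s ≤ p) : sgn (-1) * gam p (p - s : ℕ) = gam p s := by
  rw [Nat.cast_sub h, gam_p_sub (NeZero.ne p), sgn_neg_one]; ring

/-- The two traces in G_s belong to the same Casimir eigenvalue, because -γ_{p-s} = γ_s, so their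
weight sums combine into a full parity class. -/
lemma G_cartan (hp : 2 ≤ p) {s : ℕ} (h1 : 0 < s) (h2 : s < p) (j n : ℕ) :
    (G p s).1.ofConv (Uq.C p ^ j * Uq.K p ^ n) = j * gam p s ^ (j - 1) * clsSum p s n := by
  rw [G, dif_pos ⟨h1, h2⟩]
  change trH _ _ _ _ _ _ _ _ + trH _ _ _ _ _ _ _ _ = _
  rw [trH_cartan _ _ _ _ hp, trH_cartan _ _ _ _ hp, sgn_neg_one_mul_gam _ h2.le,
    ← sum_range_add_sub s h2.le, sgn_one, one_mul, mul_add]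

lemma chi_add_chi_cartan (hp : 2 ≤ p) {s : ℕ} (h : s ≤ p) (j n : ℕ) :
    (chi p 1 s + chi p (-1) (p - s)).1.ofConv (Uq.C p ^ j * Uq.K p ^ n)
      = gam p s ^ j * clsSum p s n := by
  rw [SLF.add_apply, chi_cartan _ h hp, chi_cartan _ (Nat.sub_le _ _) hp,
    sgn_neg_one_mul_gam _ h, ← sum_range_add_sub s h, sgn_one, one_mul, mul_add]

lemma G_zero : G p 0 = 0 := by rw [G, dif_neg (by omega)]
lemma G_p : G p p = 0 := by rw [G, dif_neg (by omega)]
lemma chi_zero (α : ℤˣ) : chi p α 0 = 0 := by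
  rw [chi, dif_pos (Nat.zero_le _)]
  refine Subtype.ext (WithConv.ofConv_injective (LinearMap.ext fun x => ?_))
  exact trace_eq_sum _

/-- `clsSum` is invariant under shifts by an even number. -/
lemma clsSum_add_two (s : ℤ) (n : ℕ) : clsSum p (s + 2) n = clsSum p s n := by
  obtain ⟨m, rfl⟩ := Nat.exists_eq_succ_of_ne_zero (NeZero.ne p)
  rw [clsSum, clsSum, Finset.sum_range_succ', Finset.sum_range_succ]
  refine congrArg₂ (· + ·) (Finset.sum_congr rfl fun i _ => ?_) ?_
  · congr 2; push_cast; ring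
  · rw [(q_zpow_eq_iff (NeZero.ne _) _ _).mpr]
    exact ⟨1, by push_cast; ring⟩

lemma clsSum_add_two_mul (s c : ℤ) (n : ℕ) : clsSum p (s + 2 * c) n = clsSum p s n := by
  induction c with
  | zero => simp
  | succ c ih => rw [← ih, mul_add, mul_one, ← add_assoc, clsSum_add_two]
  | pred c ih => rw [← ih, ← clsSum_add_two (s + 2 * (-c - 1))]; congr 1; ring

lemma clsSum_neg (s : ℤ) (n : ℕ) : clsSum p (-s) n = clsSum p s n := by
  rw [← clsSum_add_two_mul (-s) s]; congr 1; ring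

end

/-! ### Highest weight modules of dimension `p` -/

section

variable (p : ℕ) (a : ℂ)

/-- The weights `e^{a-η}q^{-2i}`, where `q = e^η`. -/
def vermaWt (i : ℕ) : ℂ := Complex.exp (a - logq p - 2 * i * logq p)

/-- `E` on the highest weight module: `FE = C - (qK + q⁻¹K⁻¹) / (q - q⁻¹)²` on `v_i`. -/
def vermaE : Module.End ℂ (Fin p →₀ ℂ) :=
  op fun i => (casVal p a - casVal p (a - 2 * (i : ℕ) * logq p)) • bvec id ((i : ℕ) - 1)

def vermaF : Module.End ℂ (Fin p →₀ ℂ) := op fun i => bvec id ((i : ℕ) + 1)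

def vermaK : Module.End ℂ (Fin p →₀ ℂ) := op fun i => vermaWt p a i • Finsupp.single i 1

def vermaL : Module.End ℂ (Fin p →₀ ℂ) := op fun i => (vermaWt p a i)⁻¹ • Finsupp.single i 1

variable {p a}

lemma vermaWt_ne_zero (i : ℕ) : vermaWt p a i ≠ 0 := Complex.exp_ne_zero _

lemma exp_two_mul_logq : Complex.exp (2 * logq p) = q p ^ 2 := by
  rw [two_mul, Complex.exp_add, exp_logq, pow_two]

lemma vermaWt_succ (i : ℕ) : vermaWt p a (i + 1) = (q p ^ 2)⁻¹ * vermaWt p a i := by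
  rw [vermaWt, vermaWt, ← exp_two_mul_logq, ← Complex.exp_neg, ← Complex.exp_add]
  congr 1; push_cast; ring

lemma exp_add_two_p (hp : p ≠ 0) (b : ℂ) : Complex.exp (b + 2 * p * logq p) = Complex.exp b := by
  have h : 2 * (p : ℂ) * logq p = 2 * Real.pi * Complex.I := by
    have : (p : ℂ) ≠ 0 := by exact_mod_cast hp
    rw [logq]; field_simp
  rw [Complex.exp_add, h, Complex.exp_two_pi_mul_I, mul_one]

lemma casVal_add_two_p (hp : p ≠ 0) (b : ℂ) : casVal p (b + 2 * p * logq p) = casVal p b := by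
  rw [casVal, casVal, exp_add_two_p hp, ← exp_add_two_p hp (-(b + 2 * p * logq p))]
  congr 3; ring

lemma casVal_sub_two_p (hp : p ≠ 0) (b : ℂ) : casVal p (b - 2 * p * logq p) = casVal p b := by
  rw [← casVal_add_two_p hp (b - _), sub_add_cancel]

/-- This is the commutation relation of E and F on a vector of weight e^{b-η}: both products are C
minus a scalar, and the scalars are two neighbouring Casimir values. -/
lemma casVal_sub_casVal (hp : 2 ≤ p) (b : ℂ) : casVal p b - casVal p (b - 2 * logq p)
    = (q p - (q p)⁻¹)⁻¹ * (Complex.exp (b - logq p) - (Complex.exp (b - logq p))⁻¹) := by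
  have h := q_sub_inv_ne_zero hp
  have h0 := q_ne_zero p
  rw [casVal, casVal, neg_sub, Complex.exp_sub b, Complex.exp_sub b, Complex.exp_sub _ b,
    Complex.exp_neg, exp_two_mul_logq, exp_logq]
  have hb := Complex.exp_ne_zero b
  generalize Complex.exp b = y at *
  rw [← sub_div, div_eq_iff (pow_ne_zero 2 h)]
  generalize q p = x at *
  have e : (x - x⁻¹)⁻¹ * (y / x - (y / x)⁻¹) * (x - x⁻¹) ^ 2
      = (y / x - (y / x)⁻¹) * (x - x⁻¹) := by field_simp
  rw [e]
  field_simp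
  ring

/-- There is no condition on a: the truncation v_p = 0 is consistent because `casVal` has period
2pη. Only K^{2p} = 1 would constrain a, which is why it was dropped. -/
lemma verma_relations (hp : 2 ≤ p) (a : ℂ) :
    UqTRelations p (vermaE p a) (vermaF p) (vermaK p a) (vermaL p a) := by
  have hp0 : p ≠ 0 := by omega
  have hE : ∀ i, i < p → vermaE p a (bvec id i)
      = (casVal p a - casVal p (a - 2 * i * logq p)) • bvec id (i - 1) := fun i hi => op_bvec _ _ hi
  have hF : ∀ i, vermaF p (bvec id i) = bvec id (i + 1) := fun i => by
    by_cases hi : i < p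
    · exact op_bvec _ _ hi
    · rw [bvec_of_le _ (by omega), bvec_of_le _ (by omega), map_zero]
  have hK : ∀ i, vermaK p a (bvec id i) = vermaWt p a i • bvec id i := fun i => by
    by_cases hi : i < p
    · rw [vermaK, op_bvec _ _ hi, bvec_of_lt _ hi]; rfl
    · rw [bvec_of_le _ (by omega), map_zero, smul_zero]
  have hL : ∀ i, vermaL p a (bvec id i) = (vermaWt p a i)⁻¹ • bvec id i := fun i => by
    by_cases hi : i < p
    · rw [vermaL, op_bvec _ _ hi, bvec_of_lt _ hi]; rfl
    · rw [bvec_of_le _ (by omega), map_zero, smul_zero]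
  have hsing : ∀ i : Fin p, (Finsupp.single i 1 : Fin p →₀ ℂ) = bvec id i := fun i =>
    (bvec_of_lt id i.2).symm
  refine ⟨?_, ?_, ?_, ?_, ?_, ?_, ?_⟩
  · refine op_pow_eq_zero _ (fun i : Fin p => (i : ℕ)) p (fun i => i.2) fun i => ?_
    by_cases hi : (i : ℕ) = 0
    · rw [hi]; simp
    · refine Submodule.smul_mem _ _ (bvec_mem _ _ _ fun h => ?_)
      change (i : ℕ) - 1 < i
      omega
  · refine op_pow_eq_zero _ (fun i : Fin p => p - 1 - (i : ℕ)) p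
      (fun i => by have := i.2; omega) fun i => ?_
    refine bvec_mem _ _ _ fun h => ?_
    change p - 1 - ((i : ℕ) + 1) < p - 1 - i
    omega
  · refine end_ext fun i => ?_
    rw [Module.End.mul_apply, hsing, hL, map_smul, hK, smul_smul,
      inv_mul_cancel₀ (vermaWt_ne_zero _), one_smul]; rfl
  · refine end_ext fun i => ?_
    rw [Module.End.mul_apply, hsing, hK, map_smul, hL, smul_smul,
      mul_inv_cancel₀ (vermaWt_ne_zero _), one_smul]; rfl
  · refine end_ext fun i => ?_
    simp only [Module.End.mul_apply, LinearMap.smul_apply, hsing, hK, hE i i.2, map_smul, smul_smul]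
    by_cases hi : (i : ℕ) = 0
    · rw [hi]; simp
    · congr 1
      obtain ⟨j, hj⟩ := Nat.exists_eq_succ_of_ne_zero hi
      rw [hj, Nat.succ_sub_one, Nat.succ_eq_add_one, vermaWt_succ, ← mul_assoc,
        ← mul_assoc, mul_inv_cancel₀ (pow_ne_zero 2 (q_ne_zero p)), one_mul, mul_comm]
  · refine end_ext fun i => ?_
    simp only [Module.End.mul_apply, LinearMap.smul_apply, hsing, hK, hF, map_smul, smul_smul]
    rw [vermaWt_succ]
  · refine end_ext fun i => ?_
    have hEF : vermaE p a (bvec id ((i : ℕ) + 1))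
        = (casVal p a - casVal p (a - 2 * ((i : ℕ) + 1) * logq p)) • bvec id (i : ℕ) := by
      by_cases h : (i : ℕ) + 1 < p
      · rw [hE _ h]; push_cast; rfl
      -- At the last vector F v_{p-1} = 0, so the coefficient with which E would return v_p must
      -- vanish; it does by periodicity.
      · have : (i : ℕ) + 1 = p := by have := i.2; omega
        have hc : ((i : ℕ) : ℂ) + 1 = p := by exact_mod_cast this
        rw [bvec_of_le _ (by omega), map_zero, hc, casVal_sub_two_p hp0, sub_self, zero_smul]
    have hFE : (casVal p a - casVal p (a - 2 * (i : ℕ) * logq p))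
          • bvec (id : Fin p → Fin p) ((i : ℕ) - 1 + 1)
        = (casVal p a - casVal p (a - 2 * (i : ℕ) * logq p)) • bvec id (i : ℕ) := by
      by_cases hi : (i : ℕ) = 0
      · rw [hi]; simp
      · rw [show (i : ℕ) - 1 + 1 = i by omega]
    rw [LinearMap.add_apply, LinearMap.smul_apply, LinearMap.sub_apply]
    simp only [Module.End.mul_apply, hsing]
    rw [hF, hEF, hE i i.2, map_smul, hF, hFE, hK, hL, ← sub_smul, smul_smul, ← add_smul]
    congr 1
    have := casVal_sub_casVal hp (a - 2 * (i : ℕ) * logq p)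
    rw [show a - 2 * ((i : ℕ) : ℂ) * logq p - 2 * logq p
      = a - 2 * (((i : ℕ) : ℂ) + 1) * logq p by ring,
      show a - 2 * ((i : ℕ) : ℂ) * logq p - logq p = a - logq p - 2 * ((i : ℕ) : ℂ) * logq p by ring,
      ← vermaWt] at this
    rw [← this]
    ring

/-- The module of dimension `p` with highest weight `e^{a-η}`. -/
def vermaRep (hp : 2 ≤ p) (a : ℂ) : UqT p →ₐ[ℂ] Module.End ℂ (Fin p →₀ ℂ) :=
  UqT.lift _ _ _ _ (verma_relations hp a)

variable (hp : 2 ≤ p)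

lemma vermaRep_E (i : Fin p) : vermaRep hp a (UqT.E p) (Finsupp.single i 1)
    = (casVal p a - casVal p (a - 2 * (i : ℕ) * logq p)) • bvec id ((i : ℕ) - 1) := by
  rw [vermaRep, UqT.lift_E, vermaE, op_single]

lemma vermaRep_F (i : Fin p) : vermaRep hp a (UqT.F p) (Finsupp.single i 1)
    = bvec id ((i : ℕ) + 1) := by
  rw [vermaRep, UqT.lift_F, vermaF, op_single]

lemma vermaRep_K (i : Fin p) : vermaRep hp a (UqT.K p) (Finsupp.single i 1)
    = vermaWt p a i • Finsupp.single i 1 := by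
  rw [vermaRep, UqT.lift_K, vermaK, op_single]

lemma vermaRep_L (i : Fin p) : vermaRep hp a (UqT.L p) (Finsupp.single i 1)
    = (vermaWt p a i)⁻¹ • Finsupp.single i 1 := by
  rw [vermaRep, UqT.lift_L, vermaL, op_single]

lemma exp_add_inv_div (b : ℂ) : (q p * Complex.exp (b - logq p)
    + (q p)⁻¹ * (Complex.exp (b - logq p))⁻¹) / (q p - (q p)⁻¹) ^ 2 = casVal p b := by
  rw [casVal, ← mul_inv, ← exp_logq, ← Complex.exp_add, add_sub_cancel, Complex.exp_neg]

/-- The action of the Casimir element on a weight vector of weight `e^{b-η}`. -/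
lemma UqT.apply_casimir {V : Type*} [AddCommGroup V] [Module ℂ V]
    (ρ : UqT p →ₐ[ℂ] Module.End ℂ V) {v : V} {b : ℂ}
    (hK : ρ (UqT.K p) v = Complex.exp (b - logq p) • v)
    (hL : ρ (UqT.L p) v = (Complex.exp (b - logq p))⁻¹ • v) :
    ρ (UqT.C p) v = ρ (UqT.F p) (ρ (UqT.E p) v) + casVal p b • v := by
  rw [UqT.C, map_casimir, casimir]
  simp only [LinearMap.add_apply, LinearMap.smul_apply, Module.End.mul_apply, hK, hL]
  rw [← exp_add_inv_div]
  module

/-- The coefficients of E were chosen so that FE and the Cartan part of C add up to `casVal p a` on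
each v_i. -/
lemma vermaRep_C : vermaRep hp a (UqT.C p) = casVal p a • 1 := by
  refine end_ext fun i => ?_
  have e : a - logq p - 2 * ((i : ℕ) : ℂ) * logq p = a - 2 * ((i : ℕ) : ℂ) * logq p - logq p := by
    ring
  rw [UqT.apply_casimir (b := a - 2 * (i : ℕ) * logq p), vermaRep_E, map_smul]
  · by_cases hi : (i : ℕ) = 0
    · rw [hi]; simp
    · have h : vermaRep hp a (UqT.F p) (bvec id ((i : ℕ) - 1)) = Finsupp.single i 1 := by
        rw [bvec_of_lt _ (show (i : ℕ) - 1 < p by omega), vermaRep_F]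
        simp only [id]
        rw [bvec_of_lt _ (show (i : ℕ) - 1 + 1 < p by omega)]
        congr 1; ext; simp; omega
      rw [h, ← add_smul, sub_add_cancel]; rfl
  · rw [vermaRep_K, vermaWt, e]
  · rw [vermaRep_L, vermaWt, e]

/-- The trace of the module of dimension `p` with highest weight `e^{a-η}`. -/
def phi (hp : 2 ≤ p) (a : ℂ) : UqT p →ₗ[ℂ] ℂ :=
  LinearMap.trace ℂ _ ∘ₗ (vermaRep hp a).toLinearMap

lemma phi_apply (z : UqT p) : phi hp a z = LinearMap.trace ℂ _ (vermaRep hp a z) := rfl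

lemma phi_symm (x y : UqT p) : phi hp a (x * y) = phi hp a (y * x) := by
  rw [phi_apply, phi_apply, map_mul (vermaRep hp a), map_mul (vermaRep hp a),
    LinearMap.trace_mul_comm]

lemma phi_cartan (j m n : ℕ) : phi hp a (UqT.cartan p j m n) = casVal p a ^ j
    * ∑ i ∈ Finset.range p, vermaWt p a i ^ m * (vermaWt p a i)⁻¹ ^ n := by
  rw [phi_apply, UqT.map_cartan, vermaRep_C, trace_eq_sum, Finset.mul_sum, Finset.sum_range]
  refine Finset.sum_congr rfl fun i _ => ?_
  rw [Module.End.mul_apply, pow_apply_of_eigen (vermaRep_L hp i), map_smul, Module.End.mul_apply,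
    pow_apply_of_eigen (vermaRep_K hp i)]
  simp [smul_pow]
  ring

lemma vermaWt_add_two_p (i : ℕ) (hp : p ≠ 0) :
    vermaWt p (a + 2 * p * logq p) i = vermaWt p a i := by
  rw [vermaWt, vermaWt, ← exp_add_two_p hp (a - _ - _)]; congr 1; ring

/-- The parameter a enters only through e^a, and e^{2pη} = 1. -/
lemma phi_add_two_p (a : ℂ) : phi hp (a + 2 * p * logq p) = phi hp a := by
  refine UqT.form_ext hp (phi_symm hp) (phi_symm hp) fun j m n => ?_
  rw [phi_cartan, phi_cartan, casVal_add_two_p (by omega)]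
  simp only [vermaWt_add_two_p _ (show p ≠ 0 by omega)]

end

/-! ### Block triangular operators on a tensor product -/

section blockTriangular

variable {V : Type} [AddCommGroup V] [Module ℂ V] {n : ℕ}

/-- The inclusion `v ↦ v ⊗ w_k`. -/
def tinc (V : Type) [AddCommGroup V] [Module ℂ V] {n : ℕ} (k : Fin n) :
    V →ₗ[ℂ] V ⊗[ℂ] (Fin n →₀ ℂ) :=
  (TensorProduct.mk ℂ V (Fin n →₀ ℂ)).flip (Finsupp.single k 1)

@[simp] lemma tinc_apply (k : Fin n) (v : V) : tinc V k v = v ⊗ₜ Finsupp.single k 1 := rfl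

/-- The coordinate `v ⊗ w ↦ w k • v`. -/
def tproj (V : Type) [AddCommGroup V] [Module ℂ V] {n : ℕ} (k : Fin n) :
    V ⊗[ℂ] (Fin n →₀ ℂ) →ₗ[ℂ] V :=
  (TensorProduct.rid ℂ V).toLinearMap ∘ₗ LinearMap.lTensor V (Finsupp.lapply k)

@[simp] lemma tproj_tmul (k : Fin n) (v : V) (w : Fin n →₀ ℂ) :
    tproj V k (v ⊗ₜ w) = w k • v := by simp [tproj]

lemma sum_tinc_tproj : ∑ k : Fin n, tinc V k ∘ₗ tproj V k = LinearMap.id := by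
  refine TensorProduct.ext' fun v w => ?_
  rw [LinearMap.sum_apply]
  simp only [LinearMap.comp_apply, tproj_tmul, tinc_apply, TensorProduct.smul_tmul,
    ← TensorProduct.tmul_sum, Finsupp.smul_single, smul_eq_mul, mul_one, LinearMap.id_apply,
    Finsupp.univ_sum_single]

/-- `T` is block triangular for the grading by the second factor, with diagonal blocks `t`. -/
def IsBlockTri (T : Module.End ℂ (V ⊗[ℂ] (Fin n →₀ ℂ))) (t : Fin n → Module.End ℂ V) : Prop :=
  ∀ k k' : Fin n, k ≤ k' → tproj V k' ∘ₗ T ∘ₗ tinc V k = if k = k' then t k else 0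

variable {T S : Module.End ℂ (V ⊗[ℂ] (Fin n →₀ ℂ))} {t s : Fin n → Module.End ℂ V}

lemma IsBlockTri.add (hT : IsBlockTri T t) (hS : IsBlockTri S s) :
    IsBlockTri (T + S) (t + s) := fun k k' h => by
  rw [LinearMap.add_comp, LinearMap.comp_add, hT k k' h, hS k k' h]
  split_ifs <;> simp

/-- In the block product from k to k' ≥ k, an intermediate index j < k' is killed by T and an index
j > k' ≥ k is killed by S; only j = k' survives. -/
lemma IsBlockTri.mul (hT : IsBlockTri T t) (hS : IsBlockTri S s) :
    IsBlockTri (T * S) (t * s) := fun k k' h => by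
  have e : tproj V k' ∘ₗ (T * S) ∘ₗ tinc V k
      = ∑ j, (tproj V k' ∘ₗ T ∘ₗ tinc V j) ∘ₗ (tproj V j ∘ₗ S ∘ₗ tinc V k) := by
    calc tproj V k' ∘ₗ (T * S) ∘ₗ tinc V k
        = (tproj V k' ∘ₗ T) ∘ₗ (∑ j, tinc V j ∘ₗ tproj V j) ∘ₗ (S ∘ₗ tinc V k) := by
          rw [sum_tinc_tproj]; rfl
      _ = _ := by
        refine LinearMap.ext fun x => ?_
        simp only [LinearMap.comp_apply, LinearMap.sum_apply, map_sum]
  rw [e, Finset.sum_eq_single k']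
  · rw [hT k' k' le_rfl, hS k k' h, if_pos rfl]
    split_ifs with hk
    · subst hk; rfl
    · exact LinearMap.comp_zero _
  · intro j _ hj
    rcases le_or_gt j k' with hjk | hjk
    · rw [hT j k' hjk, if_neg hj, LinearMap.zero_comp]
    · rw [hS k j (h.trans hjk.le), if_neg (by rintro rfl; exact absurd h (not_le.mpr hjk)),
        LinearMap.comp_zero]
  · exact fun h => absurd (Finset.mem_univ _) h

lemma IsBlockTri.one : IsBlockTri (1 : Module.End ℂ (V ⊗[ℂ] (Fin n →₀ ℂ))) 1 := fun k k' h => by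
  ext v
  by_cases hk : k = k'
  · subst hk; simp
  · simp [hk]

lemma IsBlockTri.pow (hT : IsBlockTri T t) (j : ℕ) : IsBlockTri (T ^ j) (t ^ j) := by
  induction j with
  | zero => rw [pow_zero, pow_zero]; exact IsBlockTri.one
  | succ j ih => rw [pow_succ, pow_succ]; exact ih.mul hT

lemma IsBlockTri.map (f : Module.End ℂ V) (g : Module.End ℂ (Fin n →₀ ℂ)) (c : Fin n → ℂ)
    (hg : ∀ k k' : Fin n, k ≤ k' → g (Finsupp.single k 1) k' = if k = k' then c k else 0) :
    IsBlockTri (TensorProduct.map f g) (fun k => c k • f) := fun k k' h => by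
  ext v
  simp only [LinearMap.comp_apply, tinc_apply, TensorProduct.map_tmul, tproj_tmul, hg k k' h]
  split_ifs <;> simp

/-- Inserting the resolution of the identity `sum_tinc_tproj` and moving each inclusion cyclically
under the trace leaves the diagonal blocks. -/
lemma IsBlockTri.trace [FiniteDimensional ℂ V] (hT : IsBlockTri T t) :
    LinearMap.trace ℂ _ T = ∑ k, LinearMap.trace ℂ _ (t k) := by
  have e : T = ∑ k, tinc V k ∘ₗ (tproj V k ∘ₗ T) := by
    calc T = (∑ k, tinc V k ∘ₗ tproj V k) ∘ₗ T := by rw [sum_tinc_tproj]; rfl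
      _ = _ := by
        refine LinearMap.ext fun x => ?_
        simp only [LinearMap.comp_apply, LinearMap.sum_apply]
  conv_lhs => rw [e]
  rw [map_sum]
  refine Finset.sum_congr rfl fun k _ => ?_
  rw [LinearMap.trace_comp_comm', LinearMap.comp_assoc, hT k k le_rfl, if_pos rfl]

end blockTriangular

/-! ### Products of forms on `UqT p` and tensor products of representations -/

section

variable {p : ℕ} [NeZero p]

/-- The product of two linear forms on `UqT p`. -/
def formMul (θ θ' : UqT p →ₗ[ℂ] ℂ) : UqT p →ₗ[ℂ] ℂ :=
  LinearMap.mul' ℂ ℂ ∘ₗ TensorProduct.map θ θ' ∘ₗ (UqT.comulHom p).toLinearMap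

lemma formMul_add_left (θ₁ θ₂ θ : UqT p →ₗ[ℂ] ℂ) :
    formMul (θ₁ + θ₂) θ = formMul θ₁ θ + formMul θ₂ θ := by
  rw [formMul, TensorProduct.map_add_left, LinearMap.add_comp, LinearMap.comp_add]; rfl

lemma formMul_add_right (θ θ₁ θ₂ : UqT p →ₗ[ℂ] ℂ) :
    formMul θ (θ₁ + θ₂) = formMul θ θ₁ + formMul θ θ₂ := by
  rw [formMul, TensorProduct.map_add_right, LinearMap.add_comp, LinearMap.comp_add]; rfl

/-- The pullback of a form on `Ū_q`. -/
def pull (φ : SLF p) : UqT p →ₗ[ℂ] ℂ := φ.1.ofConv ∘ₗ (UqT.toUq p).toLinearMap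

lemma pull_apply (φ : SLF p) (z : UqT p) : (pull φ) z = φ.1.ofConv (UqT.toUq p z) := rfl

lemma pull_injective : Function.Injective (pull (p := p)) := by
  intro φ ψ h
  refine Subtype.ext (WithConv.ofConv_injective (LinearMap.ext fun x => ?_))
  obtain ⟨z, rfl⟩ := UqT.toUq_surjective x
  exact LinearMap.congr_fun h z

lemma pull_symm (φ : SLF p) (x y : UqT p) : (pull φ) (x * y) = (pull φ) (y * x) := by
  rw [pull_apply, pull_apply, map_mul (UqT.toUq p), map_mul (UqT.toUq p), SLF.symm]

/-- With `pull_injective`, this transfers product identities proved on `UqT p` to SLF(Ū_q). -/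
lemma pull_mul (φ ψ : SLF p) : (pull (φ * ψ)) = formMul (pull φ) (pull ψ) := by
  ext z
  change LinearMap.mul' ℂ ℂ (TensorProduct.map φ.1.ofConv ψ.1.ofConv
    (Uq.comulHom p (UqT.toUq p z))) = _
  rw [UqT.comulHom_toUq]
  change _ = LinearMap.mul' ℂ ℂ (TensorProduct.map (pull φ) (pull ψ) (UqT.comulHom p z))
  rw [pull, pull, TensorProduct.map_comp]
  rfl

lemma pull_add (φ ψ : SLF p) : (pull (φ + ψ)) = (pull φ) + (pull ψ) := rfl

section tensorRep
variable {V W : Type} [AddCommGroup V] [Module ℂ V] [AddCommGroup W] [Module ℂ W]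
  (ρ : UqT p →ₐ[ℂ] Module.End ℂ V) (σ : UqT p →ₐ[ℂ] Module.End ℂ W)

/-- The tensor product of two representations. -/
def tensorRep : UqT p →ₐ[ℂ] Module.End ℂ (V ⊗[ℂ] W) :=
  ((Module.endTensorEndAlgHom (R := ℂ) (S := ℂ) (A := ℂ) (M := V) (N := W)).comp
    (Algebra.TensorProduct.map ρ σ)).comp (UqT.comulHom p)

lemma tensorRep_E : tensorRep ρ σ (UqT.E p)
    = TensorProduct.map 1 (σ (UqT.E p)) + TensorProduct.map (ρ (UqT.E p)) (σ (UqT.K p)) := by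
  simp [tensorRep]; rfl

lemma tensorRep_F : tensorRep ρ σ (UqT.F p)
    = TensorProduct.map (ρ (UqT.F p)) 1 + TensorProduct.map (ρ (UqT.L p)) (σ (UqT.F p)) := by
  simp [tensorRep]; rfl

lemma tensorRep_K : tensorRep ρ σ (UqT.K p)
    = TensorProduct.map (ρ (UqT.K p)) (σ (UqT.K p)) := by
  simp [tensorRep]; rfl

lemma tensorRep_L : tensorRep ρ σ (UqT.L p)
    = TensorProduct.map (ρ (UqT.L p)) (σ (UqT.L p)) := by
  simp [tensorRep]; rfl

/-- The trace of a representation, as a form on `UqT p`. -/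
def trForm : UqT p →ₗ[ℂ] ℂ := LinearMap.trace ℂ V ∘ₗ ρ.toLinearMap

lemma trForm_apply (z : UqT p) : trForm ρ z = LinearMap.trace ℂ V (ρ z) := rfl

lemma trForm_symm (x y : UqT p) : trForm ρ (x * y) = trForm ρ (y * x) := by
  rw [trForm_apply, trForm_apply, map_mul ρ, map_mul ρ, LinearMap.trace_mul_comm]

lemma trForm_tensorRep [FiniteDimensional ℂ V] [FiniteDimensional ℂ W] :
    trForm (tensorRep ρ σ) = formMul (trForm ρ) (trForm σ) := by
  have H : LinearMap.trace ℂ (V ⊗[ℂ] W) ∘ₗ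
      (((Module.endTensorEndAlgHom (R := ℂ) (S := ℂ) (A := ℂ) (M := V) (N := W)).comp
        (Algebra.TensorProduct.map ρ σ)).toLinearMap)
      = LinearMap.mul' ℂ ℂ ∘ₗ TensorProduct.map (trForm ρ) (trForm σ) := by
    refine TensorProduct.ext' fun x y => ?_
    simp only [LinearMap.comp_apply, AlgHom.toLinearMap_apply, AlgHom.comp_apply,
      Algebra.TensorProduct.map_tmul, Module.endTensorEndAlgHom_apply, TensorProduct.map_tmul,
      LinearMap.mul'_apply, trForm_apply]
    exact LinearMap.trace_tensorProduct' _ _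
  ext z
  exact LinearMap.congr_fun H (UqT.comulHom p z)

end tensorRep

/-! ### Tensor products with a highest weight module of dimension `p` -/

section tensorVerma

lemma tensor_mem_of_add_mem {V W : Type} [AddCommGroup V] [Module ℂ V] [AddCommGroup W]
    [Module ℂ W] (S : Submodule ℂ (V ⊗[ℂ] W)) {x y : V ⊗[ℂ] W} (h : x + y ∈ S) (hy : y ∈ S) :
    x ∈ S := (S.add_mem_iff_left hy).mp h

lemma trace_tensor_conj {V W : Type} [AddCommGroup V] [Module ℂ V] [AddCommGroup W]
    [Module ℂ W] (e : V ⊗[ℂ] W ≃ₗ[ℂ] V ⊗[ℂ] W) (T : Module.End ℂ (V ⊗[ℂ] W)) :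
    LinearMap.trace ℂ _ (e.conjAlgEquiv ℂ T) = LinearMap.trace ℂ _ T :=
  LinearMap.trace_conj' T e

lemma apply_casimir_tensor {V W : Type} [AddCommGroup V] [Module ℂ V] [AddCommGroup W]
    [Module ℂ W] (ρ : UqT p →ₐ[ℂ] Module.End ℂ (V ⊗[ℂ] W)) {v : V ⊗[ℂ] W} {b : ℂ}
    (hK : ρ (UqT.K p) v = Complex.exp (b - logq p) • v)
    (hL : ρ (UqT.L p) v = (Complex.exp (b - logq p))⁻¹ • v) :
    ρ (UqT.C p) v = ρ (UqT.F p) (ρ (UqT.E p) v) + casVal p b • v :=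
  UqT.apply_casimir ρ hK hL

variable (hp : 2 ≤ p) (a : ℂ) {n : ℕ} (σ : UqT p →ₐ[ℂ] Module.End ℂ (Fin n →₀ ℂ))

/-- The operator `v_i ⊗ w ↦ Δ(F)^i (v_0 ⊗ w)`. -/
def indMap : Module.End ℂ ((Fin p →₀ ℂ) ⊗[ℂ] (Fin n →₀ ℂ)) :=
  TensorProduct.lift (Finsupp.linearCombination ℂ fun i : Fin p =>
    (tensorRep (vermaRep hp a) σ (UqT.F p) ^ (i : ℕ))
      ∘ₗ TensorProduct.mk ℂ (Fin p →₀ ℂ) (Fin n →₀ ℂ) (bvec id 0))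

variable {hp a σ}

/-- The bound i = p is allowed, both sides being 0 there since F^p = 0; `F_indMap` needs this case.
-/
lemma indMap_bvec {i : ℕ} (hi : i ≤ p) (w : Fin n →₀ ℂ) : indMap hp a σ (bvec id i ⊗ₜ w)
    = (tensorRep (vermaRep hp a) σ (UqT.F p) ^ i) (bvec id 0 ⊗ₜ w) := by
  rcases lt_or_eq_of_le hi with h | h
  · rw [bvec_of_lt _ h, indMap, TensorProduct.lift.tmul, Finsupp.linearCombination_single, one_smul]
    rfl
  · rw [bvec_of_le _ h.ge, TensorProduct.zero_tmul, map_zero, h, ← map_pow,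
      (UqT.relations p).F_pow, map_zero, LinearMap.zero_apply]

lemma vermaRep_F_bvec (i : ℕ) : vermaRep hp a (UqT.F p) (bvec id i) = bvec id (i + 1) := by
  rcases lt_or_ge i p with h | h
  · rw [bvec_of_lt _ h, vermaRep_F]; rfl
  · rw [bvec_of_le _ h, map_zero, bvec_of_le _ (by omega)]

lemma vermaRep_K_bvec (i : ℕ) :
    vermaRep hp a (UqT.K p) (bvec id i) = vermaWt p a i • bvec id i := by
  rcases lt_or_ge i p with h | h
  · rw [bvec_of_lt _ h, vermaRep_K]; rfl
  · rw [bvec_of_le _ h, map_zero, smul_zero]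

lemma vermaRep_L_bvec (i : ℕ) :
    vermaRep hp a (UqT.L p) (bvec id i) = (vermaWt p a i)⁻¹ • bvec id i := by
  rcases lt_or_ge i p with h | h
  · rw [bvec_of_lt _ h, vermaRep_L]; rfl
  · rw [bvec_of_le _ h, map_zero, smul_zero]

lemma tensor_ext {M : Type} [AddCommMonoid M] [Module ℂ M]
    {S T : (Fin p →₀ ℂ) ⊗[ℂ] (Fin n →₀ ℂ) →ₗ[ℂ] M}
    (h : ∀ i < p, ∀ w, S (bvec id i ⊗ₜ w) = T (bvec id i ⊗ₜ w)) : S = T := by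
  refine TensorProduct.ext (Finsupp.lhom_ext' fun i => LinearMap.ext_ring (LinearMap.ext fun w => ?_))
  have := h i i.2 w
  rw [bvec_of_lt _ i.2] at this
  exact this

/-- The tensor product is freely generated, up to F^p = 0, by Δ(F) from v_0 ⊗ W; this map turns the
action of F on the first factor alone into Δ(F). -/
lemma F_indMap (x) :
    indMap hp a σ (TensorProduct.map (vermaRep hp a (UqT.F p)) 1 x)
      = tensorRep (vermaRep hp a) σ (UqT.F p) (indMap hp a σ x) := by
  revert x
  refine LinearMap.congr_fun (f := indMap hp a σ ∘ₗ TensorProduct.map (vermaRep hp a (UqT.F p)) 1)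
    (g := tensorRep (vermaRep hp a) σ (UqT.F p) ∘ₗ indMap hp a σ) (tensor_ext fun i hi w => ?_)
  simp only [LinearMap.comp_apply, TensorProduct.map_tmul, vermaRep_F_bvec, Module.End.one_apply]
  rw [indMap_bvec hi, indMap_bvec hi.le, pow_succ', Module.End.mul_apply]

/-- The range is stable under Δ(F), and Δ(F)(v_i ⊗ w) equals v_{i+1} ⊗ w plus a vector of the form
v_i ⊗ w'. Induction on i, for all w at once, reaches every v_i ⊗ w. -/
lemma indMap_surjective : Function.Surjective (indMap hp a σ) := by
  rw [← LinearMap.range_eq_top, Submodule.eq_top_iff']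
  have hF : ∀ x ∈ LinearMap.range (indMap hp a σ),
      tensorRep (vermaRep hp a) σ (UqT.F p) x ∈ LinearMap.range (indMap hp a σ) := by
    rintro _ ⟨y, rfl⟩
    exact ⟨_, F_indMap y⟩
  have key : ∀ i w, bvec id i ⊗ₜ w ∈ LinearMap.range (indMap hp a σ) := by
    intro i
    induction i with
    | zero => exact fun w => ⟨bvec id 0 ⊗ₜ w, by rw [indMap_bvec (Nat.zero_le _)]; rfl⟩
    | succ i ih =>
      intro w
      have h1 := hF _ (ih w)
      rw [tensorRep_F, LinearMap.add_apply, TensorProduct.map_tmul, TensorProduct.map_tmul,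
        vermaRep_F_bvec, vermaRep_L_bvec, TensorProduct.smul_tmul, Module.End.one_apply] at h1
      exact tensor_mem_of_add_mem _ h1 (ih _)
  intro x
  induction x using TensorProduct.induction_on with
  | zero => exact zero_mem _
  | add x y hx hy => exact add_mem hx hy
  | tmul v w =>
    induction v using Finsupp.induction_linear with
    | zero => rw [TensorProduct.zero_tmul]; exact zero_mem _
    | add x y hx hy => rw [TensorProduct.add_tmul]; exact add_mem hx hy
    | single i c =>
      have := key i (c • w)
      rwa [bvec_of_lt _ i.2, ← TensorProduct.smul_tmul, Finsupp.smul_single, smul_eq_mul,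
        mul_one] at this

variable (hp a σ) in
/-- `indMap` as a linear equivalence. -/
def indEquiv : (Fin p →₀ ℂ) ⊗[ℂ] (Fin n →₀ ℂ) ≃ₗ[ℂ] (Fin p →₀ ℂ) ⊗[ℂ] (Fin n →₀ ℂ) :=
  LinearEquiv.ofBijective (indMap hp a σ)
    (OrzechProperty.bijective_of_surjective_endomorphism _ indMap_surjective)

lemma indEquiv_conj {S T : Module.End ℂ ((Fin p →₀ ℂ) ⊗[ℂ] (Fin n →₀ ℂ))}
    (h : ∀ i < p, ∀ w, S (indMap hp a σ (bvec id i ⊗ₜ w)) = indMap hp a σ (T (bvec id i ⊗ₜ w))) :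
    S = (indEquiv hp a σ).conjAlgEquiv ℂ T := by
  have h2 : S ∘ₗ indMap hp a σ = indMap hp a σ ∘ₗ T := tensor_ext h
  refine LinearMap.ext fun x => ?_
  have h3 := LinearMap.congr_fun h2 ((indEquiv hp a σ).symm x)
  have h4 : indMap hp a σ ((indEquiv hp a σ).symm x) = x := (indEquiv hp a σ).apply_symm_apply x
  rw [LinearMap.comp_apply, h4] at h3
  exact h3

lemma trace_indEquiv_conj (T : Module.End ℂ ((Fin p →₀ ℂ) ⊗[ℂ] (Fin n →₀ ℂ))) :
    LinearMap.trace ℂ _ ((indEquiv hp a σ).conjAlgEquiv ℂ T) = LinearMap.trace ℂ _ T :=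
  trace_tensor_conj _ _

lemma skew_pow_apply {V : Type*} [AddCommMonoid V] [Module ℂ V]
    (ρ : UqT p →ₐ[ℂ] Module.End ℂ V) {x y : UqT p} {c d : ℂ}
    (h : x * y = c • (y * x)) {v : V} (hv : ρ x v = d • v) (i : ℕ) :
    ρ x ((ρ y ^ i) v) = (d * c ^ i) • (ρ y ^ i) v := by
  rw [← Module.End.mul_apply, ← map_pow, ← map_mul, skew_comm h, map_smul, map_mul,
    LinearMap.smul_apply, Module.End.mul_apply, hv, map_smul, smul_smul, mul_comm]

lemma vermaWt_eq (i : ℕ) :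
    vermaWt p a i = Complex.exp (a - logq p) * ((q p ^ 2)⁻¹) ^ i := by
  induction i with
  | zero => simp [vermaWt]
  | succ i ih => rw [vermaWt_succ, ih]; ring

section weights

variable {β : Fin n → ℂ}
  (hK : ∀ k, σ (UqT.K p) (Finsupp.single k 1) = Complex.exp (β k) • Finsupp.single k 1)
  (hL : ∀ k, σ (UqT.L p) (Finsupp.single k 1) = (Complex.exp (β k))⁻¹ • Finsupp.single k 1)
  (hE : ∀ k k' : Fin n, k ≤ k' → σ (UqT.E p) (Finsupp.single k 1) k' = 0)

-- K acts on Δ(F)^i (v_0 ⊗ w_k) by the weight of v_0 ⊗ w_k times q^{-2i}, which is the weight of v_i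
-- ⊗ w_k.
include hK in
lemma tensorRep_K_conj : tensorRep (vermaRep hp a) σ (UqT.K p)
    = (indEquiv hp a σ).conjAlgEquiv ℂ
      (TensorProduct.map (vermaRep hp a (UqT.K p)) (σ (UqT.K p))) := by
  refine indEquiv_conj fun i hi w => ?_
  rw [TensorProduct.map_tmul, vermaRep_K_bvec, TensorProduct.smul_tmul, indMap_bvec hi.le,
    indMap_bvec hi.le]
  induction w using Finsupp.induction_linear with
  | zero => simp
  | add x y hx hy => simp only [map_add, smul_add, TensorProduct.tmul_add, hx, hy]
  | single k c =>
    rw [← mul_one c, ← smul_eq_mul, ← Finsupp.smul_single]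
    simp only [map_smul, TensorProduct.tmul_smul, hK]
    have e : vermaWt p a i = vermaWt p a 0 * ((q p ^ 2)⁻¹) ^ i := by
      rw [vermaWt_eq, vermaWt_eq 0]; simp [mul_comm]
    rw [skew_pow_apply _ (UqT.relations p).KF (d := vermaWt p a 0 * Complex.exp (β k)), e]
    · module
    · rw [tensorRep_K, TensorProduct.map_tmul, vermaRep_K_bvec, hK, TensorProduct.smul_tmul_smul]

include hL in
lemma tensorRep_L_conj : tensorRep (vermaRep hp a) σ (UqT.L p)
    = (indEquiv hp a σ).conjAlgEquiv ℂ
      (TensorProduct.map (vermaRep hp a (UqT.L p)) (σ (UqT.L p))) := by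
  refine indEquiv_conj fun i hi w => ?_
  rw [TensorProduct.map_tmul, vermaRep_L_bvec, TensorProduct.smul_tmul, indMap_bvec hi.le,
    indMap_bvec hi.le]
  induction w using Finsupp.induction_linear with
  | zero => simp
  | add x y hx hy => simp only [map_add, smul_add, TensorProduct.tmul_add, hx, hy]
  | single k c =>
    rw [← mul_one c, ← smul_eq_mul, ← Finsupp.smul_single]
    simp only [map_smul, TensorProduct.tmul_smul, hL]
    have e : (vermaWt p a i)⁻¹ = (vermaWt p a 0)⁻¹ * (q p ^ 2) ^ i := by
      rw [vermaWt_eq, vermaWt_eq 0]; simp [mul_comm]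
    rw [skew_pow_apply _ (UqT.relations p).LF (d := (vermaWt p a 0)⁻¹ * (Complex.exp (β k))⁻¹), e]
    · module
    · rw [tensorRep_L, TensorProduct.map_tmul, vermaRep_L_bvec, hL, TensorProduct.smul_tmul_smul]

/-- The diagonal operator with the values of the Casimir element on the subquotients. -/
def casDiag (p : ℕ) (a : ℂ) (β : Fin n → ℂ) : Module.End ℂ (Fin n →₀ ℂ) :=
  op fun k => casVal p (a + β k) • Finsupp.single k 1

-- C is central, so it passes through Δ(F)^i to v_0 ⊗ w_k, a vector of weight e^{a+β_k-η}. There it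
-- is `casVal p (a + β k)` plus Δ(F)Δ(E), and Δ(E)(v_0 ⊗ w_k) = v_0 ⊗ E w_k because E v_0 = 0. The
-- correction F ⊗ E moves to smaller indices k when E does.
include hK hL in
lemma tensorRep_C_conj : tensorRep (vermaRep hp a) σ (UqT.C p)
    = (indEquiv hp a σ).conjAlgEquiv ℂ (TensorProduct.map 1 (casDiag p a β)
      + TensorProduct.map (vermaRep hp a (UqT.F p)) (σ (UqT.E p))) := by
  refine indEquiv_conj fun i hi w => ?_
  rw [LinearMap.add_apply, TensorProduct.map_tmul, TensorProduct.map_tmul, vermaRep_F_bvec,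
    Module.End.one_apply, map_add, indMap_bvec hi.le, indMap_bvec hi.le, indMap_bvec hi,
    ← Module.End.mul_apply, ← map_pow, ← map_mul, (UqT.C_comm hp _).eq, map_mul,
    Module.End.mul_apply, map_pow, pow_succ (tensorRep _ _ _), Module.End.mul_apply, ← map_add]
  congr 1
  induction w using Finsupp.induction_linear with
  | zero => simp
  | add x y hx hy =>
    simp only [map_add, TensorProduct.tmul_add, hx, hy]
    abel
  | single k c =>
    rw [← mul_one c, ← smul_eq_mul, ← Finsupp.smul_single]
    simp only [map_smul, TensorProduct.tmul_smul, ← smul_add]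
    congr 1
    rw [apply_casimir_tensor _ (b := a + β k), add_comm, casDiag, op_single, TensorProduct.tmul_smul]
    · congr 2
      rw [tensorRep_E, LinearMap.add_apply, TensorProduct.map_tmul, TensorProduct.map_tmul,
        bvec_of_lt _ (show 0 < p by omega), vermaRep_E]
      simp
    · rw [tensorRep_K, TensorProduct.map_tmul, vermaRep_K_bvec, hK, TensorProduct.smul_tmul_smul,
        vermaWt, ← Complex.exp_add]
      congr 2; push_cast; ring
    · rw [tensorRep_L, TensorProduct.map_tmul, vermaRep_L_bvec, hL, TensorProduct.smul_tmul_smul,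
        vermaWt, ← mul_inv, ← Complex.exp_add]
      congr 3; push_cast; ring

lemma vermaWt_add (b : ℂ) (i : ℕ) : vermaWt p (a + b) i = Complex.exp b * vermaWt p a i := by
  rw [vermaWt, vermaWt, ← Complex.exp_add]; congr 1; ring

include hK hL hE in
/-- The tensor product of the module of highest weight `e^{a-η}` with a module whose weights are
the `e^{β k}` has the trace of the direct sum of the modules of highest weights `e^{a-η+β k}`. -/
theorem formMul_phi : formMul (phi hp a) (trForm σ) = ∑ k, phi hp (a + β k) := by
  have h1 : formMul (phi hp a) (trForm σ) = trForm (tensorRep (vermaRep hp a) σ) :=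
    (trForm_tensorRep (vermaRep hp a) σ).symm
  rw [h1]
  refine UqT.form_ext hp (trForm_symm _) (fun x y => ?_) fun j m r => ?_
  · simp only [LinearMap.sum_apply]
    exact Finset.sum_congr rfl fun k _ => phi_symm hp x y
  -- After conjugation by `indEquiv`, each of K, K⁻¹ and C is block triangular, with k-th diagonal
  -- block its action on the module of parameter a + β_k. Traces of C^j K^m K^{-r} see only the
  -- diagonal blocks, and by `UqT.form_ext` these traces suffice.
  have tK : IsBlockTri (TensorProduct.map (vermaRep hp a (UqT.K p)) (σ (UqT.K p)))
      (fun k => vermaRep hp (a + β k) (UqT.K p)) := by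
    convert IsBlockTri.map (vermaRep hp a (UqT.K p)) (σ (UqT.K p)) (fun k => Complex.exp (β k)) ?_
      using 2 with k
    · refine end_ext fun i => ?_
      rw [LinearMap.smul_apply, vermaRep_K, vermaRep_K, vermaWt_add, smul_smul]
    · intro k k' _
      rw [hK, Finsupp.smul_apply, Finsupp.single_apply]
      split_ifs <;> simp
  have tL : IsBlockTri (TensorProduct.map (vermaRep hp a (UqT.L p)) (σ (UqT.L p)))
      (fun k => vermaRep hp (a + β k) (UqT.L p)) := by
    convert IsBlockTri.map (vermaRep hp a (UqT.L p)) (σ (UqT.L p))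
      (fun k => (Complex.exp (β k))⁻¹) ?_ using 2 with k
    · refine end_ext fun i => ?_
      rw [LinearMap.smul_apply, vermaRep_L, vermaRep_L, vermaWt_add, smul_smul, mul_inv]
    · intro k k' _
      rw [hL, Finsupp.smul_apply, Finsupp.single_apply]
      split_ifs <;> simp
  have tC : IsBlockTri (TensorProduct.map 1 (casDiag p a β)
      + TensorProduct.map (vermaRep hp a (UqT.F p)) (σ (UqT.E p)))
      (fun k => vermaRep hp (a + β k) (UqT.C p)) := by
    convert (IsBlockTri.map 1 (casDiag p a β) (fun k => casVal p (a + β k)) ?_).add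
      (IsBlockTri.map (vermaRep hp a (UqT.F p)) (σ (UqT.E p)) 0 ?_) using 1
    · ext1 k
      simp [vermaRep_C]
    · intro k k' _
      rw [casDiag, op_single, Finsupp.smul_apply, Finsupp.single_apply]
      split_ifs <;> simp
    · intro k k' h
      rw [hE k k' h]; simp
  rw [trForm_apply, UqT.map_cartan, tensorRep_K_conj hK, tensorRep_L_conj hL,
    tensorRep_C_conj hK hL, ← map_pow, ← map_pow, ← map_pow, ← map_mul, ← map_mul,
    trace_indEquiv_conj, (((tC.pow j).mul (tK.pow m)).mul (tL.pow r)).trace, LinearMap.sum_apply]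
  refine Finset.sum_congr rfl fun k _ => ?_
  rw [phi_apply, UqT.map_cartan]
  rfl

end weights

end tensorVerma
end

section

variable {p : ℕ} [NeZero p]

/-! ### The traces of the highest weight modules at integral weights -/

variable (hp : 2 ≤ p)

lemma vermaWt_int (n : ℤ) (i : ℕ) : vermaWt p (n * logq p) i = q p ^ (n - 1 - 2 * (i : ℤ)) := by
  rw [vermaWt, ← exp_int_mul_logq]; congr 1; push_cast; ring

lemma q_zpow_pow_two_p (n : ℤ) : (q p ^ n) ^ (2 * p) = 1 := by
  rw [← zpow_natCast, ← zpow_mul, mul_comm, zpow_mul, zpow_natCast, q_pow_two_p p (NeZero.ne p),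
    one_zpow]

lemma pow_mul_inv_pow {x : ℂ} (hx : x ^ (2 * p) = 1) (m r : ℕ) :
    x ^ m * x⁻¹ ^ r = x ^ (m + (2 * p - 1) * r) := by
  have hp0 := NeZero.ne p
  have : x⁻¹ = x ^ (2 * p - 1) := by
    refine inv_eq_of_mul_eq_one_left ?_
    rw [← pow_succ, show 2 * p - 1 + 1 = 2 * p by omega, hx]
  rw [this, ← pow_mul, ← pow_add]

lemma sum_vermaWt_int (n : ℤ) (m r : ℕ) :
    ∑ i ∈ Finset.range p, vermaWt p (n * logq p) i ^ m * (vermaWt p (n * logq p) i)⁻¹ ^ r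
      = clsSum p n (m + (2 * p - 1) * r) := by
  refine Finset.sum_congr rfl fun i _ => ?_
  rw [vermaWt_int, pow_mul_inv_pow (q_zpow_pow_two_p _)]

lemma phi_int_cartan (n : ℤ) (j m r : ℕ) : phi hp (n * logq p) (UqT.cartan p j m r)
    = gam p n ^ j * clsSum p n (m + (2 * p - 1) * r) := by
  rw [phi_cartan, casVal_int, sum_vermaWt_int]

/-- At a = sη both sides have Casimir eigenvalue γ_s and the same full parity class of weights. At
the ends s = 0 and s = p one of the characters is that of the zero module. -/
lemma phi_nat (s : ℕ) (hs : s ≤ p) :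
    phi hp (s * logq p) = pull (chi p 1 s + chi p (-1) (p - s)) := by
  refine UqT.form_ext hp (phi_symm hp) (pull_symm _) fun j m r => ?_
  rw [pull_apply, Uq.toUq_cartan, chi_add_chi_cartan hp hs, ← phi_int_cartan hp]
  simp

/-- Opposite parameters have the same Casimir value, and at integral multiples of η also the same
weights, since s and -s have the same parity. -/
lemma phi_neg_nat (s : ℕ) : phi hp (-(s * logq p)) = phi hp (s * logq p) := by
  refine UqT.form_ext hp (phi_symm hp) (phi_symm hp) fun j m r => ?_
  have h1 := phi_int_cartan hp s j m r
  have h2 := phi_int_cartan hp (-s) j m r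
  rw [gam_neg, clsSum_neg] at h2
  push_cast at h1 h2
  rw [← neg_mul, h1, h2]

/-! ### The forms `G_s` as derivatives -/

/-- The matrix entries of the generators are constants or combinations of exponentials in a, and
sums and products preserve differentiability. -/
lemma differentiable_vermaRep (z : UqT p) (i j : Fin p) :
    Differentiable ℂ fun a => vermaRep hp a z (Finsupp.single i 1) j := by
  induction z using UqT.induction_gen generalizing i j with
  | hc r => simp [AlgHom.commutes, Module.algebraMap_end_apply]
  | hE =>
    simp only [vermaRep_E, Finsupp.smul_apply, smul_eq_mul, casVal]
    fun_prop
  | hF => simp only [vermaRep_F]; fun_prop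
  | hK =>
    simp only [vermaRep_K, Finsupp.smul_apply, smul_eq_mul, vermaWt]
    fun_prop
  | hL =>
    simp only [vermaRep_L, Finsupp.smul_apply, smul_eq_mul, vermaWt, ← Complex.exp_neg]
    fun_prop
  | hadd x y hx hy =>
    simp only [map_add, LinearMap.add_apply, Finsupp.add_apply]
    exact (hx i j).add (hy i j)
  | hmul x y hx hy =>
    have e : ∀ a, vermaRep hp a (x * y) (Finsupp.single i 1) j
        = ∑ w, vermaRep hp a y (Finsupp.single i 1) w * vermaRep hp a x (Finsupp.single w 1) j := by
      intro a
      rw [map_mul, Module.End.mul_apply]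
      conv_lhs => rw [← Finsupp.univ_sum_single (vermaRep hp a y (Finsupp.single i 1))]
      rw [map_sum, Finsupp.finsetSum_apply]
      refine Finset.sum_congr rfl fun w _ => ?_
      rw [← mul_one (vermaRep hp a y (Finsupp.single i 1) w), ← smul_eq_mul,
        ← Finsupp.smul_single, map_smul, Finsupp.smul_apply, smul_eq_mul, smul_eq_mul, mul_one]
    simp only [e]
    exact Differentiable.fun_sum fun w _ => (hy i w).mul (hx w j)

lemma differentiable_phi (z : UqT p) : Differentiable ℂ fun a => phi hp a z := by
  simp only [phi_apply, trace_eq_sum]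
  exact Differentiable.fun_sum fun i _ => differentiable_vermaRep hp z i i

/-- The sum of the traces of the modules of highest weights `e^{a-η}` and `e^{-a-η}`, on which the
Casimir element has the same eigenvalue. -/
def psi (a : ℂ) : UqT p →ₗ[ℂ] ℂ := phi hp a + phi hp (-a)

lemma psi_apply (a : ℂ) (z : UqT p) : psi hp a z = phi hp a z + phi hp (-a) z := rfl

lemma differentiable_psi (z : UqT p) : Differentiable ℂ fun a => psi hp a z := by
  simp only [psi_apply]
  exact (differentiable_phi hp z).add ((differentiable_phi hp z).comp differentiable_neg)

/-- The derivative of `psi`. -/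
def dpsi (a : ℂ) : UqT p →ₗ[ℂ] ℂ where
  toFun z := deriv (fun b => psi hp b z) a
  map_add' x y := by
    simp only [map_add]
    exact deriv_fun_add (differentiable_psi hp x a) (differentiable_psi hp y a)
  map_smul' c x := by
    simp only [map_smul, smul_eq_mul, RingHom.id_apply]
    exact deriv_const_mul c (differentiable_psi hp x a)

lemma hasDerivAt_psi (a : ℂ) (z : UqT p) : HasDerivAt (fun b => psi hp b z) (dpsi hp a z) a :=
  (differentiable_psi hp z a).hasDerivAt

lemma dpsi_symm (a : ℂ) (x y : UqT p) : dpsi hp a (x * y) = dpsi hp a (y * x) := by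
  have : (fun b => psi hp b (x * y)) = fun b => psi hp b (y * x) := by
    ext b
    rw [psi_apply, psi_apply, phi_symm, phi_symm hp x]
  change deriv _ _ = deriv _ _
  rw [this]

lemma hasDerivAt_casVal (a : ℂ) : HasDerivAt (casVal p)
    ((Complex.exp a - Complex.exp (-a)) / (q p - (q p)⁻¹) ^ 2) a := by
  have h := ((Complex.hasDerivAt_exp a).add (hasDerivAt_neg a).cexp).div_const
    ((q p - (q p)⁻¹) ^ 2)
  rw [mul_neg_one, ← sub_eq_add_neg] at h
  exact h

/-- On a Cartan monomial `psi b` is `casVal p b ^ j` times S(b) + S(-b), where S sums powers of the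
weights. At b = nη one has S(b) = S(-b), so the derivatives of the two weight sums cancel and only
the Casimir factor is differentiated. This is why `phi` is symmetrised before taking derivatives. -/
lemma dpsi_int_cartan (n : ℤ) (j m r : ℕ) : dpsi hp (n * logq p) (UqT.cartan p j m r)
    = 2 * (qInt p n / (q p - (q p)⁻¹)) * (j * gam p n ^ (j - 1) *
      clsSum p n (m + (2 * p - 1) * r)) := by
  set S : ℂ → ℂ := fun b => ∑ i ∈ Finset.range p, vermaWt p b i ^ m * (vermaWt p b i)⁻¹ ^ r with hS
  have hS0 : ∀ b, S b = Complex.exp (((m : ℂ) - r) * b) * S 0 := fun b => by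
    simp only [hS]
    rw [Finset.mul_sum]
    refine Finset.sum_congr rfl fun i _ => ?_
    have e1 : vermaWt p b i = Complex.exp b * vermaWt p 0 i := by
      rw [← vermaWt_add, zero_add]
    rw [e1, mul_pow, mul_inv, mul_pow, ← Complex.exp_neg, ← Complex.exp_nat_mul,
      ← Complex.exp_nat_mul, show ((m : ℂ) - r) * b = m * b + r * -b by ring, Complex.exp_add]
    ring
  have hF : ∀ b, psi hp b (UqT.cartan p j m r) = casVal p b ^ j
      * ((Complex.exp (((m : ℂ) - r) * b) + Complex.exp (((m : ℂ) - r) * -b)) * S 0) := fun b => by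
    rw [psi_apply, phi_cartan, phi_cartan, casVal_neg, ← mul_add, add_mul, ← hS0, ← hS0]
  have hd := ((hasDerivAt_casVal (p := p) (n * logq p)).pow j).mul
    ((((hasDerivAt_id (n * logq p)).const_mul ((m : ℂ) - r)).cexp.add
      ((hasDerivAt_neg (n * logq p)).const_mul ((m : ℂ) - r)).cexp).mul_const (S 0))
  have h1 : Complex.exp (((m : ℂ) - r) * (n * logq p)) * S 0
      = clsSum p n (m + (2 * p - 1) * r) := by rw [← hS0, hS]; exact sum_vermaWt_int n m r
  have h2 : Complex.exp (((m : ℂ) - r) * -(n * logq p)) * S 0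
      = clsSum p n (m + (2 * p - 1) * r) := by
    rw [← hS0, hS, ← clsSum_neg, ← sum_vermaWt_int]
    push_cast
    simp only [neg_mul]
  have h3 : (Complex.exp (n * logq p) - Complex.exp (-(n * logq p))) / (q p - (q p)⁻¹) ^ 2
      = qInt p n / (q p - (q p)⁻¹) := by
    rw [← neg_mul, ← Int.cast_neg, exp_int_mul_logq, exp_int_mul_logq, qInt, div_div, pow_two]
  rw [(hasDerivAt_psi hp _ _).unique (hd.congr_of_eventuallyEq (.of_forall hF)), h3]
  simp only [id, Pi.pow_apply, Pi.add_apply, casVal_int]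
  rw [add_mul _ _ (S 0), h1, h2]
  -- The derivative of the weight factor vanishes, as its two exponential terms agree at this point
  -- and have opposite slopes.
  have h4 : (Complex.exp (((m : ℂ) - r) * (n * logq p)) * (((m : ℂ) - r) * 1)
      + Complex.exp (((m : ℂ) - r) * -(n * logq p)) * (((m : ℂ) - r) * -1)) * S 0 = 0 := by
    rw [add_mul]
    linear_combination ((m : ℂ) - r) * h1 - ((m : ℂ) - r) * h2
  rw [h4]
  ring

/-- Including s = 0 and s = p, where [s] = 0 and the convention G_0 = G_p = 0 applies, makes the
recursion at the ends a special case of the general one. -/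
lemma dpsi_nat (s : ℕ) (hs : s ≤ p) :
    dpsi hp (s * logq p) = (2 * (qInt p s / (q p - (q p)⁻¹))) • pull (G p s) := by
  refine UqT.form_ext hp (dpsi_symm hp _) (fun x y => ?_) fun j m r => ?_
  · rw [LinearMap.smul_apply, LinearMap.smul_apply, pull_symm]
  have h1 := dpsi_int_cartan hp s j m r
  push_cast at h1
  rw [h1, LinearMap.smul_apply, pull_apply, Uq.toUq_cartan, smul_eq_mul]
  by_cases h : 0 < s ∧ s < p
  · rw [G_cartan hp h.1 h.2]
  · have : qInt p s = 0 := by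
      rw [qInt_eq_zero_iff hp]
      rcases Nat.eq_zero_or_pos s with h0 | h0
      · rw [h0]; simp
      · rw [show s = p by omega]
    rw [this]; simp

/-! ### Products with the `psi` -/

/-- With one factor fixed, evaluating the product at z amounts to evaluating the other factor at a
fixed element. Derivatives in a parameter therefore pass through products. -/
lemma formMul_apply_left (z : UqT p) (θ' : UqT p →ₗ[ℂ] ℂ) :
    ∃ w : UqT p, ∀ θ : UqT p →ₗ[ℂ] ℂ, formMul θ θ' z = θ w := by
  simp only [formMul, LinearMap.comp_apply, AlgHom.toLinearMap_apply]
  generalize UqT.comulHom p z = t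
  induction t using TensorProduct.induction_on with
  | zero => exact ⟨0, fun θ => by simp⟩
  | tmul x y => exact ⟨θ' y • x, fun θ => by simp [mul_comm]⟩
  | add x y hx hy =>
    obtain ⟨a, ha⟩ := hx
    obtain ⟨b, hb⟩ := hy
    exact ⟨a + b, fun θ => by rw [map_add, map_add, ha, hb, map_add]⟩

lemma formMul_apply_right (z : UqT p) (θ : UqT p →ₗ[ℂ] ℂ) :
    ∃ w : UqT p, ∀ θ' : UqT p →ₗ[ℂ] ℂ, formMul θ θ' z = θ' w := by
  simp only [formMul, LinearMap.comp_apply, AlgHom.toLinearMap_apply]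
  generalize UqT.comulHom p z = t
  induction t using TensorProduct.induction_on with
  | zero => exact ⟨0, fun θ => by simp⟩
  | tmul x y => exact ⟨θ x • y, fun θ => by simp⟩
  | add x y hx hy =>
    obtain ⟨a, ha⟩ := hx
    obtain ⟨b, hb⟩ := hy
    exact ⟨a + b, fun θ => by rw [map_add, map_add, ha, hb, map_add]⟩

lemma formMul_smul_left (c : ℂ) (θ θ' : UqT p →ₗ[ℂ] ℂ) :
    formMul (c • θ) θ' = c • formMul θ θ' := by
  ext z
  obtain ⟨w, hw⟩ := formMul_apply_left z θ'
  rw [LinearMap.smul_apply, hw, hw, LinearMap.smul_apply]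

lemma formMul_smul_right (c : ℂ) (θ θ' : UqT p →ₗ[ℂ] ℂ) :
    formMul θ (c • θ') = c • formMul θ θ' := by
  ext z
  obtain ⟨w, hw⟩ := formMul_apply_right z θ
  rw [LinearMap.smul_apply, hw, hw, LinearMap.smul_apply]

lemma hasDerivAt_formMul_left (a : ℂ) (θ : UqT p →ₗ[ℂ] ℂ) (z : UqT p) :
    HasDerivAt (fun b => formMul (psi hp b) θ z) (formMul (dpsi hp a) θ z) a := by
  obtain ⟨w, hw⟩ := formMul_apply_left z θ
  simp only [hw]
  exact hasDerivAt_psi hp a w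

lemma hasDerivAt_formMul_right (a : ℂ) (θ : UqT p →ₗ[ℂ] ℂ) (z : UqT p) :
    HasDerivAt (fun b => formMul θ (psi hp b) z) (formMul θ (dpsi hp a) z) a := by
  obtain ⟨w, hw⟩ := formMul_apply_right z θ
  simp only [hw]
  exact hasDerivAt_psi hp a w

lemma pull_chi {α : ℤˣ} {s : ℕ} (h : s ≤ p) :
    pull (chi p α s) = trForm ((simpleRep p α s h).comp (UqT.toUq p)) := by
  ext z
  rw [pull_apply, chi_apply h]; rfl

/-- The weights of 𝒳^+(2) are q and q⁻¹, that is β = ±η in `formMul_phi`. -/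
lemma formMul_phi_chi_two (a : ℂ) :
    formMul (phi hp a) (pull (chi p 1 2)) = phi hp (a + logq p) + phi hp (a - logq p) := by
  have hw : ∀ k : Fin 2, wt p 1 ((2 : ℕ) - 1 - 2 * (k : ℤ))
      = Complex.exp ((1 - 2 * (k : ℕ)) * logq p) := fun k => by
    rw [wt_one, ← exp_int_mul_logq]; congr 1; push_cast; ring
  rw [pull_chi hp, formMul_phi (β := fun k => (1 - 2 * (k : ℕ)) * logq p), Fin.sum_univ_two]
  · congr 2
    · simp
    · simp; ring
  · intro k
    rw [AlgHom.comp_apply, UqT.toUq_K, simpleRep_K, hw]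
  · intro k
    rw [AlgHom.comp_apply, UqT.toUq_L, apply_Kinv _ (Complex.exp_ne_zero _)]
    rw [simpleRep_K, hw]
  · intro k k' h
    rw [AlgHom.comp_apply, UqT.toUq_E, simpleRep_E]
    by_cases h0 : (k : ℕ) = 0
    · rw [h0]; simp [qInt_zero]
    · rw [bvec_of_lt _ (by omega), Finsupp.smul_apply, Finsupp.single_apply, if_neg, smul_zero]
      intro h1
      have := congrArg Fin.val h1
      simp only [id] at this
      have : (k : ℕ) ≤ k' := h
      omega

/-- Here the second factor is a deformed module too; its weights have exponents b - η - 2kη. -/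
lemma formMul_phi_phi (a b : ℂ) : formMul (phi hp a) (phi hp b)
    = ∑ k : Fin p, phi hp (a + b - logq p - 2 * (k : ℕ) * logq p) := by
  have h := formMul_phi (hp := hp) (a := a) (σ := vermaRep hp b)
    (β := fun k => b - logq p - 2 * (k : ℕ) * logq p) (fun k => vermaRep_K hp k)
    (fun k => vermaRep_L hp k) ?_
  · refine h.trans (Finset.sum_congr rfl fun k _ => ?_)
    congr 1; ring
  · intro k k' h
    rw [vermaRep_E]
    by_cases h0 : (k : ℕ) = 0
    · rw [h0]; simp
    · rw [bvec_of_lt _ (by omega), Finsupp.smul_apply, Finsupp.single_apply, if_neg, smul_zero]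
      intro h1
      have := congrArg Fin.val h1
      simp only [id] at this
      have : (k : ℕ) ≤ k' := h
      omega

lemma formMul_psi_chi_two (a : ℂ) :
    formMul (psi hp a) (pull (chi p 1 2)) = psi hp (a + logq p) + psi hp (a - logq p) := by
  rw [psi, formMul_add_left, formMul_phi_chi_two, formMul_phi_chi_two, psi, psi,
    show -a + logq p = -(a - logq p) by ring, show -a - logq p = -(a + logq p) by ring]
  abel

lemma formMul_dpsi_chi_two (a : ℂ) :
    formMul (dpsi hp a) (pull (chi p 1 2)) = dpsi hp (a + logq p) + dpsi hp (a - logq p) := by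
  ext z
  have h1 := hasDerivAt_formMul_left hp a (pull (chi p 1 2)) z
  simp only [formMul_psi_chi_two, LinearMap.add_apply] at h1
  exact h1.unique (((hasDerivAt_psi hp _ z).comp_add_const a (logq p)).add
    ((hasDerivAt_psi hp _ z).comp_sub_const a (logq p)))

/-- The product of `psi a` and `psi b` is a sum of traces over a set of weights that is stable
under multiplication by `q²`. -/
def cyc (c : ℂ) : UqT p →ₗ[ℂ] ℂ := ∑ k ∈ Finset.range p, phi hp (c - logq p - 2 * k * logq p)

/-- The shift by 2η permutes the summands cyclically, since `phi` has period 2pη. -/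
lemma cyc_add_two (c : ℂ) : cyc hp (c + 2 * logq p) = cyc hp c := by
  obtain ⟨m, hm⟩ := Nat.exists_eq_succ_of_ne_zero (NeZero.ne p)
  have e : Finset.range p = Finset.range (m + 1) := by rw [hm]
  rw [cyc, cyc, e, Finset.sum_range_succ', Finset.sum_range_succ]
  refine congrArg₂ (· + ·) (Finset.sum_congr rfl fun i _ => ?_) ?_
  · congr 1; push_cast; ring
  · rw [← phi_add_two_p hp (c - _ - _)]
    congr 1
    have : (p : ℂ) = m + 1 := by rw [hm]; push_cast; ring
    rw [this]; push_cast; ring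

lemma cyc_add_two_mul (c : ℂ) (t : ℕ) : cyc hp (c + 2 * t * logq p) = cyc hp c := by
  induction t with
  | zero => simp
  | succ t ih =>
    rw [← ih, ← cyc_add_two hp (c + 2 * t * logq p)]
    congr 1; push_cast; ring

lemma formMul_psi_psi (a b : ℂ) : formMul (psi hp a) (psi hp b)
    = cyc hp (a + b) + cyc hp (a - b) + (cyc hp (-a + b) + cyc hp (-a - b)) := by
  have h : ∀ a b, formMul (phi hp a) (phi hp b) = cyc hp (a + b) := fun a b => by
    rw [formMul_phi_phi, cyc, Finset.sum_range]
  rw [psi, psi, formMul_add_left, formMul_add_right, formMul_add_right, h, h, h, h]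
  rfl

lemma eq_zero_of_hasDerivAt_even {f : ℂ → ℂ} {d c : ℂ} (h : HasDerivAt f d c)
    (he : ∀ x, f (c + x) = f (c - x)) : d = 0 := by
  have h1 : HasDerivAt (fun x => f (c + x)) d 0 := HasDerivAt.comp_const_add c 0 (by simpa using h)
  have h2 : HasDerivAt (fun x => f (c - x)) (-d) 0 :=
    HasDerivAt.comp_const_sub c 0 (by simpa using h)
  rw [show (fun x => f (c + x)) = fun x => f (c - x) from funext he] at h1
  have := h1.unique h2
  linear_combination this / 2

/-- The function b ↦ `psi a` · `psi b` is even about tη: replacing tη + x by tη - x interchanges the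
terms with a + b and a - b up to a shift by 2tη, which `cyc` does not see. Its derivative at tη is
therefore 0. -/
lemma formMul_psi_dpsi (a : ℂ) (t : ℕ) : formMul (psi hp a) (dpsi hp (t * logq p)) = 0 := by
  ext z
  refine eq_zero_of_hasDerivAt_even (hasDerivAt_formMul_right hp (t * logq p) (psi hp a) z) ?_
  intro x
  have e : ∀ c, cyc hp (c + t * logq p) = cyc hp (c - t * logq p) := fun c => by
    rw [← cyc_add_two_mul hp (c - _) t]; congr 1; ring
  rw [formMul_psi_psi, formMul_psi_psi]
  have e1 : cyc hp (a + (t * logq p + x)) = cyc hp (a - (t * logq p - x)) := by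
    rw [show a + (t * logq p + x) = a + x + t * logq p by ring, e]; congr 1; ring
  have e2 : cyc hp (a - (t * logq p + x)) = cyc hp (a + (t * logq p - x)) := by
    rw [show a - (t * logq p + x) = a - x - t * logq p by ring, ← e]; congr 1; ring
  have e3 : cyc hp (-a + (t * logq p + x)) = cyc hp (-a - (t * logq p - x)) := by
    rw [show -a + (t * logq p + x) = -a + x + t * logq p by ring, e]; congr 1; ring
  have e4 : cyc hp (-a - (t * logq p + x)) = cyc hp (-a + (t * logq p - x)) := by
    rw [show -a - (t * logq p + x) = -a - x - t * logq p by ring, ← e]; congr 1; ring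
  rw [e1, e2, e3, e4, add_comm (cyc hp (a - _)), add_comm (cyc hp (-a - _))]

/-- The previous vanishing holds for every a, so it may be differentiated in a. -/
lemma formMul_dpsi_dpsi (a : ℂ) (t : ℕ) : formMul (dpsi hp a) (dpsi hp (t * logq p)) = 0 := by
  ext z
  have h := hasDerivAt_formMul_left hp a (dpsi hp (t * logq p)) z
  simp only [formMul_psi_dpsi] at h
  exact h.unique (hasDerivAt_const a _)

include hp in
lemma two_mul_qInt_div_ne_zero {s : ℕ} (h1 : 0 < s) (h2 : s < p) :
    2 * (qInt p s / (q p - (q p)⁻¹)) ≠ 0 := by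
  refine mul_ne_zero two_ne_zero (div_ne_zero ?_ (q_sub_inv_ne_zero hp))
  rw [Ne, qInt_eq_zero_iff hp]
  intro h
  have := Int.le_of_dvd (by omega) h
  omega

include hp in
lemma G_mul_G_eq_zero {s t : ℕ} (h1 : 0 < s) (h2 : s < p) (h3 : 0 < t) (h4 : t < p) :
    G p s * G p t = 0 := by
  apply pull_injective
  have h := formMul_dpsi_dpsi hp (s * logq p) t
  rw [dpsi_nat hp _ h2.le, dpsi_nat hp _ h4.le, formMul_smul_left, formMul_smul_right,
    smul_eq_zero_iff_right (two_mul_qInt_div_ne_zero hp h1 h2),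
    smul_eq_zero_iff_right (two_mul_qInt_div_ne_zero hp h3 h4)] at h
  rw [pull_mul, h]; rfl

-- This is the derivative of `psi a` · χ^+_2 = `psi (a + η)` + `psi (a - η)` at a = (s+1)η, with the
-- common factor 2/(q - q⁻¹) cancelled.
include hp in
lemma qInt_smul_G_mul_chi_two {s : ℕ} (h2 : s + 1 < p) :
    qInt p (s + 1) • (G p (s + 1) * chi p 1 2)
      = qInt p (s + 2) • G p (s + 2) + qInt p s • G p s := by
  apply pull_injective
  have h := formMul_dpsi_chi_two hp ((s + 1 : ℕ) * logq p)
  rw [show (s + 1 : ℕ) * logq p + logq p = (s + 2 : ℕ) * logq p by push_cast; ring,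
    show (s + 1 : ℕ) * logq p - logq p = s * logq p by push_cast; ring,
    dpsi_nat hp _ h2.le, dpsi_nat hp s (by omega), dpsi_nat hp (s + 2) (by omega),
    formMul_smul_left, ← pull_mul] at h
  have h0 : 2 / (q p - (q p)⁻¹) ≠ 0 := div_ne_zero two_ne_zero (q_sub_inv_ne_zero hp)
  have e : ∀ x : ℂ, 2 * (x / (q p - (q p)⁻¹)) = (2 / (q p - (q p)⁻¹)) * x := fun x => by ring
  simp only [e, mul_smul, ← smul_add] at h
  have h3 := smul_right_injective _ h0 h
  push_cast at h3
  exact h3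

end

/-! ### The unit and the product with `χ⁻₁` -/

namespace Uq

variable (p : ℕ) [NeZero p]

lemma neg_one_pow_two_p_sub_one : (-1 : ℂ) ^ (2 * p - 1) = -1 := by
  have := NeZero.ne p
  exact Odd.neg_one_pow ⟨p - 1, by omega⟩

lemma neg_K_pow : (-K p) ^ (2 * p - 1) = -Kinv p := by
  have := NeZero.ne p
  rw [Odd.neg_pow ⟨p - 1, by omega⟩, Kinv]

lemma signHom_relations : UqRelations p (0 : ℂ) 0 (-1) := by
  have hp : p ≠ 0 := NeZero.ne p
  refine ⟨?_, ?_, ?_, ?_, ?_, ?_⟩ <;> simp [hp, neg_one_pow_two_p_sub_one]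

/-- The one-dimensional representation with `K ↦ -1`. -/
def signHom : Uq p →ₐ[ℂ] ℂ := lift 0 0 (-1) (signHom_relations p)

lemma twist_relations : UqRelations p (E p) (-F p) (-K p) := by
  have hp : p ≠ 0 := NeZero.ne p
  have R := relations p
  have hEF : E p * F p = F p * E p + (q p - (q p)⁻¹)⁻¹ • (K p - Kinv p) := R.EF
  refine ⟨R.E_pow, ?_, ?_, ?_, ?_, ?_⟩
  · rw [neg_pow, R.F_pow, mul_zero]
  · rw [Even.neg_pow (even_two_mul p), R.K_pow]
  · rw [neg_mul, R.KE, mul_neg, smul_neg]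
  · rw [neg_mul_neg, neg_mul_neg, R.KF]
  · rw [neg_K_pow, mul_neg, hEF, neg_mul, neg_add, ← smul_neg]
    congr 2; abel

/-- The automorphism `E ↦ E`, `F ↦ -F`, `K ↦ -K`. -/
def twist : Uq p →ₐ[ℂ] Uq p := lift (E p) (-F p) (-K p) (twist_relations p)

lemma twist_C : twist p (C p) = -C p := by
  rw [C, map_casimir, Kinv, map_pow, twist, lift_E, lift_F, lift_K, neg_K_pow, casimir, casimir,
    Kinv, neg_mul, smul_neg, smul_neg, ← neg_add, smul_neg, neg_add]

lemma signHom_C : signHom p (C p) = -gam p 1 := by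
  rw [C, map_casimir, Kinv, map_pow, signHom, lift_E, lift_F, lift_K, casimir,
    neg_one_pow_two_p_sub_one, gam]
  simp only [smul_eq_mul, zpow_neg, zpow_one]
  ring

/-- Multiplying by the one-dimensional character K ↦ -1 on the left thus becomes precomposition with
an automorphism. -/
lemma signHom_comul : ((Algebra.TensorProduct.lid ℂ (Uq p)).toAlgHom.comp
    (Algebra.TensorProduct.map (signHom p) (AlgHom.id ℂ (Uq p)))).comp (comulHom p)
      = twist p := by
  refine algHom_ext ?_ ?_ ?_ <;>
    simp [signHom, twist, Kinv, neg_one_pow_two_p_sub_one]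

lemma flip_relations : UqRelations p (F p) (E p) (Kinv p) := by
  have hp : p ≠ 0 := NeZero.ne p
  have R := relations p
  have hEF : E p * F p = F p * E p + (q p - (q p)⁻¹)⁻¹ • (K p - Kinv p) := R.EF
  have hK : Kinv p ^ (2 * p - 1) = K p := by
    calc Kinv p ^ (2 * p - 1) = (K p * Kinv p) * Kinv p ^ (2 * p - 1) := by
          rw [K_mul_Kinv p hp, one_mul]
      _ = K p * Kinv p ^ (2 * p) := by
          rw [mul_assoc, ← pow_succ', show 2 * p - 1 + 1 = 2 * p by omega]
      _ = K p := by rw [Kinv, ← pow_mul, mul_comm _ (2 * p), pow_mul, R.K_pow, one_pow, mul_one]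
  refine ⟨R.F_pow, R.E_pow, ?_, Kinv_F p hp, Kinv_E p hp, ?_⟩
  · rw [Kinv, ← pow_mul, mul_comm _ (2 * p), pow_mul, R.K_pow, one_pow]
  · rw [hK, hEF, add_assoc, ← smul_add]
    simp

/-- The automorphism `E ↦ F`, `F ↦ E`, `K ↦ K⁻¹`. -/
def flip : Uq p →ₐ[ℂ] Uq p := lift (F p) (E p) (Kinv p) (flip_relations p)

lemma flip_Kinv : flip p (Kinv p) = K p := by
  have hp : p ≠ 0 := NeZero.ne p
  have h : flip p (Kinv p) * Kinv p = 1 := by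
    have hF : flip p (K p) = Kinv p := lift_K _
    nth_rewrite 2 [← hF]
    rw [← map_mul, Kinv_mul_K p hp, map_one]
  calc flip p (Kinv p) = flip p (Kinv p) * Kinv p * K p := by
        rw [mul_assoc, Kinv_mul_K p hp, mul_one]
    _ = K p := by rw [h, one_mul]

/-- The image is EF + (qK⁻¹ + q⁻¹K)/(q - q⁻¹)², which is the other expression of C. -/
lemma flip_C (hp : 2 ≤ p) : flip p (C p) = C p := by
  have h0 : q p - (q p)⁻¹ ≠ 0 := q_sub_inv_ne_zero hp
  have hEF : E p * F p = F p * E p + (q p - (q p)⁻¹)⁻¹ • (K p - Kinv p) := (relations p).EF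
  have e1 : (q p - (q p)⁻¹)⁻¹ = ((q p - (q p)⁻¹) ^ 2)⁻¹ * (q p - (q p)⁻¹) := by
    field_simp
  rw [C, map_casimir, flip_Kinv, flip, lift_E, lift_F, lift_K, casimir, casimir, hEF, e1]
  module

/-- `flip` is an algebra automorphism that reverses the coproduct; commutativity of SLF(Ū_q) rests
on it. -/
lemma comul_flip : (comulHom p).comp (flip p)
    = ((Algebra.TensorProduct.map (flip p) (flip p)).comp
      (Algebra.TensorProduct.comm ℂ (Uq p) (Uq p)).toAlgHom).comp (comulHom p) := by
  have hK := flip_Kinv p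
  refine algHom_ext ?_ ?_ ?_
  · simp only [AlgHom.comp_apply, comulHom_E, map_add]
    simp [flip]
  · simp only [AlgHom.comp_apply, comulHom_F, map_add]
    simp [hK]
    simp [flip]
  · simp only [AlgHom.comp_apply, comulHom_K]
    simp [flip]

end Uq

section

variable {p : ℕ} [NeZero p] (hp : 2 ≤ p)
include hp

lemma chi_neg_one_one_apply (x : Uq p) : (chi p (-1) 1).1.ofConv x = Uq.signHom p x := by
  have h : (chi p (-1) 1).1.ofConv = (Uq.signHom p).toLinearMap := by
    refine Uq.form_ext hp (SLF.symm _) (fun x y => ?_) fun j n => ?_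
    · simp [mul_comm]
    · rw [chi_cartan _ (by omega) hp, AlgHom.toLinearMap_apply, map_mul, map_pow, map_pow,
        Uq.signHom_C, Uq.signHom, Uq.lift_K]
      simp [wt, sgn]
  rw [h]; rfl

lemma chi_one_one : chi p 1 1 = 1 := by
  have h : (chi p 1 1).1.ofConv = (Uq.counitHom p).toLinearMap := by
    refine Uq.form_ext hp (SLF.symm _) (fun x y => ?_) fun j n => ?_
    · simp [mul_comm]
    · rw [chi_cartan _ (by omega) hp, AlgHom.toLinearMap_apply, map_mul, map_pow, map_pow,
        Uq.C, map_casimir, Uq.counitHom_E, Uq.counitHom_F, Uq.counitHom_K, Uq.counitHom_Kinv,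
        casimir, gam]
      simp [wt, sgn, div_eq_mul_inv, mul_comm]
  refine Subtype.ext (WithConv.ofConv_injective ?_)
  rw [h]
  ext x
  change _ = algebraMap ℂ ℂ (Coalgebra.counit x)
  rfl

/-- Multiplication by `χ⁻₁` is composition with the automorphism `twist`. -/
lemma chi_neg_one_one_mul_apply (φ : SLF p) (x : Uq p) :
    (chi p (-1) 1 * φ).1.ofConv x = φ.1.ofConv (Uq.twist p x) := by
  rw [← Uq.signHom_comul, SLF.mul_apply, AlgHom.comp_apply]
  generalize Uq.comulHom p x = t
  induction t using TensorProduct.induction_on with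
  | zero => simp
  | tmul a b => simp [chi_neg_one_one_apply hp]
  | add a b ha hb => rw [map_add, map_add, ha, hb, map_add, map_add]

lemma chi_neg_one_one_mul_cartan (φ : SLF p) (j n : ℕ) :
    (chi p (-1) 1 * φ).1.ofConv (Uq.C p ^ j * Uq.K p ^ n)
      = (-1) ^ j * (-1) ^ n * φ.1.ofConv (Uq.C p ^ j * Uq.K p ^ n) := by
  have e : Uq.twist p (Uq.C p ^ j * Uq.K p ^ n)
      = ((-1 : ℂ) ^ j * (-1 : ℂ) ^ n) • (Uq.C p ^ j * Uq.K p ^ n) := by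
    have h1 : Uq.twist p (Uq.C p) = (-1 : ℂ) • Uq.C p := by rw [Uq.twist_C, neg_one_smul]
    have h2 : Uq.twist p (Uq.K p) = (-1 : ℂ) • Uq.K p := by
      rw [Uq.twist, Uq.lift_K, neg_one_smul]
    rw [map_mul, map_pow, map_pow, h1, h2, smul_pow, smul_pow, smul_mul_smul_comm]
  rw [chi_neg_one_one_mul_apply hp, e, map_smul, smul_eq_mul]

lemma chi_neg_one_one_mul_chi (α : ℤˣ) {s : ℕ} (h : s ≤ p) :
    chi p (-1) 1 * chi p α s = chi p (-α) s := by
  refine SLF.ext_cartan hp fun j n => ?_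
  rw [chi_neg_one_one_mul_cartan hp, chi_cartan _ h hp, chi_cartan _ h hp, sgn_neg, neg_mul,
    neg_pow (sgn α * _)]
  have e : ∀ m, wt p (-α) m ^ n = (-1) ^ n * wt p α m ^ n := fun m => by
    rw [wt, wt, sgn_neg, neg_mul, neg_pow]
  simp only [e, ← Finset.mul_sum]
  ring

/-- The minus sign, absent for characters, comes from the derivative: C ↦ -C contributes (-1)^j,
while γ_{p-s}^{j-1} = (-γ_s)^{j-1} absorbs only j - 1 signs. The sign (-1)^n accounts for the change
of parity class by p. -/
lemma chi_neg_one_one_mul_G {s : ℕ} (h1 : 0 < s) (h2 : s < p) :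
    chi p (-1) 1 * G p s = -G p (p - s) := by
  refine SLF.ext_cartan hp fun j n => ?_
  rw [chi_neg_one_one_mul_cartan hp, SLF.neg_apply, G_cartan hp h1 h2,
    G_cartan hp (by omega) (by omega), Nat.cast_sub h2.le, gam_p_sub (NeZero.ne p),
    neg_pow (gam p s)]
  have e : clsSum p ((p : ℤ) - s) n = (-1) ^ n * clsSum p s n := by
    rw [← clsSum_neg, neg_sub, clsSum, clsSum, Finset.mul_sum]
    refine Finset.sum_congr rfl fun i _ => ?_
    rw [show (s : ℤ) - p - 1 - 2 * i = (s - 1 - 2 * i) + (-(p : ℤ)) by ring,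
      zpow_add₀ (q_ne_zero p), zpow_neg, zpow_natCast, q_pow_p p (NeZero.ne p), inv_neg, inv_one,
      mul_neg_one, neg_pow]
  rw [e]
  rcases j with _ | j
  · simp
  · simp only [Nat.add_sub_cancel, pow_succ]; ring

/-! ### Invariance under `flip` -/

lemma flip_cartan (j n : ℕ) : Uq.flip p (Uq.C p ^ j * Uq.K p ^ n)
    = Uq.C p ^ j * Uq.K p ^ ((2 * p - 1) * n) := by
  rw [map_mul, map_pow, map_pow, Uq.flip_C p hp, Uq.flip, Uq.lift_K, Uq.Kinv, ← pow_mul]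

lemma apply_flip_of_cartan {φ : SLF p}
    (h : ∀ j n, φ.1.ofConv (Uq.C p ^ j * Uq.K p ^ ((2 * p - 1) * n))
      = φ.1.ofConv (Uq.C p ^ j * Uq.K p ^ n)) (x : Uq p) :
    φ.1.ofConv (Uq.flip p x) = φ.1.ofConv x := by
  have : φ.1.ofConv ∘ₗ (Uq.flip p).toLinearMap = φ.1.ofConv := by
    refine Uq.form_ext hp (fun x y => ?_) (SLF.symm φ) fun j n => ?_
    · simp [SLF.symm φ (Uq.flip p x)]
    · rw [LinearMap.comp_apply, AlgHom.toLinearMap_apply, flip_cartan hp, h]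
  exact LinearMap.congr_fun this x

/-- `flip` fixes C and inverts K, and the weights of a simple module are stable under inversion. -/
lemma chi_apply_flip (α : ℤˣ) {s : ℕ} (h : s ≤ p) (x : Uq p) :
    (chi p α s).1.ofConv (Uq.flip p x) = (chi p α s).1.ofConv x := by
  refine apply_flip_of_cartan hp (fun j n => ?_) x
  rw [chi_cartan _ h hp, chi_cartan _ h hp, ← Finset.sum_range_reflect]
  congr 1
  refine Finset.sum_congr rfl fun i hi => ?_
  have hi := Finset.mem_range.mp hi
  have e := pow_mul_inv_pow (wt_pow p (NeZero.ne p) α ((s : ℤ) - 1 - 2 * (s - 1 - i : ℕ))) 0 n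
  rw [pow_zero, one_mul, zero_add] at e
  rw [← e, wt_inv]
  congr 2
  omega

lemma G_apply_flip {s : ℕ} (h1 : 0 < s) (h2 : s < p) (x : Uq p) :
    (G p s).1.ofConv (Uq.flip p x) = (G p s).1.ofConv x := by
  refine apply_flip_of_cartan hp (fun j n => ?_) x
  rw [G_cartan hp h1 h2, G_cartan hp h1 h2]
  congr 1
  rw [← clsSum_neg, ← clsSum_add_two_mul (-s) p, clsSum, clsSum, ← Finset.sum_range_reflect]
  refine Finset.sum_congr rfl fun i hi => ?_
  have hi := Finset.mem_range.mp hi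
  have e := pow_mul_inv_pow (q_zpow_pow_two_p (p := p) (-(s : ℤ) + 2 * p - 1
    - 2 * (p - 1 - i : ℕ))) 0 n
  rw [pow_zero, one_mul, zero_add, ← zpow_neg] at e
  rw [← e]
  congr 2
  omega

omit hp in
lemma mul_apply_flip (φ ψ : SLF p) (hφ : ∀ x, φ.1.ofConv (Uq.flip p x) = φ.1.ofConv x)
    (hψ : ∀ x, ψ.1.ofConv (Uq.flip p x) = ψ.1.ofConv x) (x : Uq p) :
    (φ * ψ).1.ofConv (Uq.flip p x) = (ψ * φ).1.ofConv x := by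
  rw [SLF.mul_apply, SLF.mul_apply, ← AlgHom.comp_apply, Uq.comul_flip, AlgHom.comp_apply]
  generalize Uq.comulHom p x = t
  induction t using TensorProduct.induction_on with
  | zero => simp
  | tmul a b => simp [hφ, hψ, mul_comm]
  | add a b ha hb => rw [map_add, map_add, map_add, ha, hb, map_add, map_add]

end

/-! ### Weight projections -/

lemma geom_sum_of_pow_eq_one {x : ℂ} {n : ℕ} (h : x ^ n = 1) :
    ∑ c ∈ Finset.range n, x ^ c = if x = 1 then (n : ℂ) else 0 := by
  split_ifs with h1
  · simp [h1]
  · have := mul_geom_sum x n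
    rw [h, sub_self] at this
    exact (mul_eq_zero.mp this).resolve_left (sub_ne_zero.mpr h1)

section wtProj

variable {p : ℕ} {A B : Type*} [Ring A] [Algebra ℂ A] [Ring B] [Algebra ℂ B]

/-- The projection `(2p)⁻¹ ∑ q^{-mc} x^c` on the eigenspace of `x` for `q^m`, if `x^{2p} = 1`. -/
def wtProj (p : ℕ) (m : ℤ) (x : A) : A :=
  (2 * p : ℂ)⁻¹ • ∑ c ∈ Finset.range (2 * p), (q p ^ (-m) • x) ^ c

lemma map_wtProj (f : A →ₐ[ℂ] B) (m : ℤ) (x : A) : f (wtProj p m x) = wtProj p m (f x) := by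
  simp only [wtProj, map_smul, map_sum, map_pow]

lemma wtProj_apply {V : Type*} [AddCommGroup V] [Module ℂ V] {f : Module.End ℂ V} {v : V} {c : ℂ}
    (h : f v = c • v) (m : ℤ) : wtProj p m f v = wtProj p m c • v := by
  simp only [wtProj, LinearMap.smul_apply, LinearMap.sum_apply, smul_pow, pow_apply_of_eigen h,
    smul_smul, smul_eq_mul, Finset.mul_sum, Finset.sum_smul, Finset.smul_sum, mul_pow, mul_assoc]

variable [NeZero p]

lemma two_p_ne_zero : (2 * p : ℂ) ≠ 0 :=
  mul_ne_zero two_ne_zero (Nat.cast_ne_zero.mpr (NeZero.ne p))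

lemma mul_wtProj {x : A} (hx : x ^ (2 * p) = 1) (m : ℤ) :
    x * wtProj p m x = q p ^ m • wtProj p m x := by
  have hq : q p ^ m ≠ 0 := zpow_ne_zero _ (q_ne_zero p)
  have h1 : (q p ^ (-m) • x) ^ (2 * p) = 1 := by
    rw [smul_pow, hx, q_zpow_pow_two_p, one_smul]
  have h2 := mul_geom_sum (q p ^ (-m) • x) (2 * p)
  rw [h1, sub_self, sub_mul, one_mul, sub_eq_zero, smul_mul_assoc] at h2
  rw [wtProj, mul_smul_comm, smul_comm]
  congr 1
  nth_rewrite 2 [← h2]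
  rw [smul_smul, zpow_neg, mul_inv_cancel₀ hq, one_smul]

lemma wtProj_complex {c : ℂ} (hc : c ^ (2 * p) = 1) (m : ℤ) :
    wtProj p m c = if c = q p ^ m then 1 else 0 := by
  have hq : q p ^ m ≠ 0 := zpow_ne_zero _ (q_ne_zero p)
  rw [wtProj, geom_sum_of_pow_eq_one]
  · have : q p ^ (-m) • c = 1 ↔ c = q p ^ m := by
      rw [smul_eq_mul, zpow_neg, inv_mul_eq_one₀ hq, eq_comm]
    simp only [this]
    split_ifs
    · have := two_p_ne_zero (p := p)
      push_cast
      rw [smul_eq_mul, inv_mul_cancel₀ this]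
    · simp
  · rw [smul_eq_mul, mul_pow, hc, q_zpow_pow_two_p, one_mul]

/-- Orthogonality of characters of ℤ/2p: after exchanging the sums only the power x^0 survives. -/
lemma sum_wtProj (x : A) : ∑ m ∈ Finset.range (2 * p), wtProj p m x = 1 := by
  have h0 := q_ne_zero p
  have hp := NeZero.ne p
  simp only [wtProj, ← Finset.smul_sum]
  rw [Finset.sum_comm, Finset.sum_eq_single_of_mem 0 (Finset.mem_range.mpr (by omega))]
  · simp only [pow_zero, Finset.sum_const, Finset.card_range]
    rw [← Nat.cast_smul_eq_nsmul ℂ, smul_smul]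
    push_cast
    rw [inv_mul_cancel₀ two_p_ne_zero, one_smul]
  · intro c hc hc0
    have hc := Finset.mem_range.mp hc
    have e : ∀ m : ℕ, (q p ^ (-(m : ℤ)) • x) ^ c = ((q p ^ (-(c : ℤ))) ^ m) • x ^ c := fun m => by
      rw [smul_pow]
      congr 1
      rw [← zpow_natCast, ← zpow_natCast, ← zpow_mul, ← zpow_mul]
      congr 1; ring
    simp only [e, ← Finset.sum_smul]
    rw [geom_sum_of_pow_eq_one (q_zpow_pow_two_p _), if_neg, zero_smul]
    rw [q_zpow_eq_one_iff hp, dvd_neg]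
    intro h
    have := Int.le_of_dvd (by omega) h
    omega

end wtProj

namespace Uq

variable (p : ℕ) [NeZero p]

/-- The idempotent of `Ū_q` that projects on the weight `q^m`. -/
def idem (m : ℤ) : Uq p := wtProj p m (K p)

lemma K_mul_idem (m : ℤ) : K p * idem p m = q p ^ m • idem p m :=
  mul_wtProj (relations p).K_pow m

lemma K_pow_mul_idem (m : ℤ) (n : ℕ) : K p ^ n * idem p m = (q p ^ m) ^ n • idem p m := by
  induction n with
  | zero => simp
  | succ n ih => rw [pow_succ, mul_assoc, K_mul_idem, mul_smul_comm, ih, smul_smul, pow_succ']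

lemma Kinv_mul_idem (m : ℤ) : Kinv p * idem p m = q p ^ (-m) • idem p m := by
  have hp := NeZero.ne p
  have h := K_mul_Kinv p hp
  have hq : q p ^ m ≠ 0 := zpow_ne_zero _ (q_ne_zero p)
  calc Kinv p * idem p m = (q p ^ m)⁻¹ • (Kinv p * (q p ^ m • idem p m)) := by
        rw [mul_smul_comm, smul_smul, inv_mul_cancel₀ hq, one_smul]
    _ = _ := by rw [← K_mul_idem, ← mul_assoc, Kinv_mul_K p hp, one_mul, zpow_neg]

lemma sum_idem : ∑ m ∈ Finset.range (2 * p), idem p m = 1 := sum_wtProj _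

lemma E_mul_idem (m : ℤ) : E p * idem p m = idem p (m + 2) * E p := by
  have h : SemiconjBy (E p) (q p ^ (-m) • K p) (q p ^ (-(m + 2)) • K p) := by
    rw [SemiconjBy, mul_smul_comm, EK, smul_smul, smul_mul_assoc, neg_add,
      zpow_add₀ (q_ne_zero p), zpow_neg _ 2]
    rfl
  rw [idem, idem, wtProj, wtProj, mul_smul_comm, smul_mul_assoc, Finset.mul_sum, Finset.sum_mul]
  congr 1
  exact Finset.sum_congr rfl fun c _ => (h.pow_right c).eq

lemma FE_mul_idem (m : ℤ) :
    F p * E p * idem p m = C p * idem p m - gam p (m + 1) • idem p m := by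
  have h : C p * idem p m = F p * E p * idem p m + gam p (m + 1) • idem p m := by
    rw [C, casimir, add_mul, smul_mul_assoc, add_mul, smul_mul_assoc, smul_mul_assoc, K_mul_idem,
      Kinv_mul_idem, gam, neg_add, zpow_add₀ (q_ne_zero p), zpow_add₀ (q_ne_zero p), zpow_one,
      zpow_neg_one]
    module
  rw [h, add_sub_cancel_right]

lemma EF_mul_idem (hp : 2 ≤ p) (m : ℤ) :
    E p * F p * idem p m = C p * idem p m - gam p (m - 1) • idem p m := by
  have hEF : E p * F p = F p * E p + (q p - (q p)⁻¹)⁻¹ • (K p - Kinv p) := (relations p).EF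
  have h0 : q p - (q p)⁻¹ ≠ 0 := q_sub_inv_ne_zero hp
  have e1 : (q p - (q p)⁻¹)⁻¹ = (q p - (q p)⁻¹) / (q p - (q p)⁻¹) ^ 2 := by
    field_simp
  rw [hEF, add_mul, FE_mul_idem, smul_mul_assoc, sub_mul, K_mul_idem, Kinv_mul_idem, e1, gam, gam,
    neg_sub, neg_add, sub_eq_add_neg m, sub_eq_add_neg 1 m, add_comm 1 (-m),
    zpow_add₀ (q_ne_zero p), zpow_add₀ (q_ne_zero p), zpow_add₀ (q_ne_zero p),
    zpow_add₀ (q_ne_zero p), zpow_one, zpow_neg_one]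
  module

end Uq

section

variable {p : ℕ} [NeZero p]

/-- The values of a symmetric form at two neighbouring weights. -/
lemma SLF.idem_sub (hp : 2 ≤ p) (φ : SLF p) (m : ℤ) (j : ℕ) :
    φ.1.ofConv (Uq.C p ^ j * Uq.idem p (m + 2)) - φ.1.ofConv (Uq.C p ^ j * Uq.idem p m)
      = gam p (m + 1) ^ j * (φ.1.ofConv (Uq.idem p (m + 2)) - φ.1.ofConv (Uq.idem p m)) := by
  induction j with
  | zero => simp
  | succ j ih =>
    have hC : ∀ x, Commute (Uq.C p ^ j) x := fun x => (Uq.C_comm hp x).pow_left j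
    -- Cyclicity moves E around, and E e_m = e_{m+2} E. On both sides the product of E and F acts as
    -- C minus the same scalar γ_{m+1}, which gives the recursion in j.
    have h : φ.1.ofConv (Uq.C p ^ j * (Uq.F p * Uq.E p * Uq.idem p m))
        = φ.1.ofConv (Uq.C p ^ j * (Uq.E p * Uq.F p * Uq.idem p (m + 2))) := by
      rw [mul_assoc, Uq.E_mul_idem, ← mul_assoc (Uq.F p), ← mul_assoc, SLF.symm, ← mul_assoc,
        ← (hC (Uq.E p)).eq, mul_assoc, ← mul_assoc (Uq.E p)]
    rw [Uq.FE_mul_idem, Uq.EF_mul_idem p hp, show m + 2 - 1 = m + 1 by ring, mul_sub, mul_sub,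
      map_sub, map_sub, mul_smul_comm, mul_smul_comm, map_smul, map_smul, ← mul_assoc, ← mul_assoc,
      ← pow_succ, smul_eq_mul, smul_eq_mul] at h
    rw [pow_succ (gam _ _)]
    linear_combination gam p (m + 1) * ih - h

lemma SLF.apply_C_pow_mul_K_pow (φ : SLF p) (j n : ℕ) :
    φ.1.ofConv (Uq.C p ^ j * Uq.K p ^ n)
      = ∑ m ∈ Finset.range (2 * p), (q p ^ m) ^ n * φ.1.ofConv (Uq.C p ^ j * Uq.idem p m) := by
  rw [← mul_one (Uq.K p ^ n), ← Uq.sum_idem, Finset.mul_sum, Finset.mul_sum, map_sum]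
  refine Finset.sum_congr rfl fun m _ => ?_
  rw [Uq.K_pow_mul_idem, mul_smul_comm, map_smul, smul_eq_mul, zpow_natCast]

lemma SLF.apply_mul_idem (φ : SLF p) (x : Uq p) (m : ℤ) :
    φ.1.ofConv (x * Uq.idem p m) = (2 * p : ℂ)⁻¹ * ∑ c ∈ Finset.range (2 * p),
      (q p ^ (-m)) ^ c * φ.1.ofConv (x * Uq.K p ^ c) := by
  simp only [Uq.idem, wtProj, mul_smul_comm, map_smul, smul_eq_mul, Finset.mul_sum, map_sum,
    smul_pow]

/-- A symmetric form whose values at the weight idempotents depend on the parity only, and that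
vanishes on the products of the powers of the Casimir element with one even and one odd weight
idempotent, is zero. -/
lemma SLF.eq_zero_of_idem (hp : 2 ≤ p) {φ : SLF p}
    (h : ∀ m, φ.1.ofConv (Uq.idem p (m + 2)) = φ.1.ofConv (Uq.idem p m))
    {a b : ℤ} (hab : Odd (a - b))
    (ha : ∀ j, φ.1.ofConv (Uq.C p ^ j * Uq.idem p a) = 0)
    (hb : ∀ j, φ.1.ofConv (Uq.C p ^ j * Uq.idem p b) = 0) : φ = 0 := by
  -- The absence of jumps for j = 0 propagates to all j by `SLF.idem_sub`, so one weight of each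
  -- parity decides.
  have hper : ∀ j, Function.Periodic (fun m => φ.1.ofConv (Uq.C p ^ j * Uq.idem p m)) 2 := by
    intro j m
    have := SLF.idem_sub hp φ m j
    rw [h, sub_self, mul_zero, sub_eq_zero] at this
    exact this
  have h1 : ∀ j m, φ.1.ofConv (Uq.C p ^ j * Uq.idem p m) = 0 := fun j m => by
    rcases Int.even_or_odd (m - a) with ⟨c, hc⟩ | h
    · have := (hper j).int_mul c a
      rw [Int.cast_id, show a + c * 2 = m by omega] at this
      exact this.trans (ha j)
    · obtain ⟨c, hc⟩ := h.add_odd hab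
      have := (hper j).int_mul c b
      rw [Int.cast_id, show b + c * 2 = m by omega] at this
      exact this.trans (hb j)
  refine SLF.ext_cartan hp fun j n => ?_
  rw [SLF.apply_C_pow_mul_K_pow, SLF.zero_apply]
  exact Finset.sum_eq_zero fun m _ => by rw [h1, mul_zero]

lemma SLF.apply_idem_of_K_pow {φ : SLF p} (hK : ∀ n, φ.1.ofConv (Uq.K p ^ n) = 0) (m : ℤ) :
    φ.1.ofConv (Uq.idem p m) = 0 := by
  rw [← one_mul (Uq.idem p m), SLF.apply_mul_idem]
  simp [hK]

/-! ### Products of characters -/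

lemma chi_idem (hp : 2 ≤ p) (α : ℤˣ) {s : ℕ} (h : s ≤ p) (j : ℕ) (m : ℤ) :
    (chi p α s).1.ofConv (Uq.C p ^ j * Uq.idem p m) = (sgn α * gam p s) ^ j
      * ∑ i ∈ Finset.range s, if wt p α (s - 1 - 2 * (i : ℤ)) = q p ^ m then (1 : ℂ) else 0 := by
  rw [SLF.apply_mul_idem]
  simp only [chi_cartan _ h hp, ← wtProj_complex (wt_pow p (NeZero.ne p) _ _)]
  simp only [wtProj, smul_eq_mul, Finset.mul_sum, mul_pow]
  rw [Finset.sum_comm]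
  refine Finset.sum_congr rfl fun i _ => Finset.sum_congr rfl fun c _ => ?_
  ring

lemma SLF.mul_apply_K_pow (φ ψ : SLF p) (n : ℕ) :
    (φ * ψ).1.ofConv (Uq.K p ^ n) = φ.1.ofConv (Uq.K p ^ n) * ψ.1.ofConv (Uq.K p ^ n) := by
  rw [SLF.mul_apply, map_pow, Uq.comulHom_K, Algebra.TensorProduct.tmul_pow,
    TensorProduct.map_tmul, LinearMap.mul'_apply]

lemma tensorRep_wtProj_apply {V W : Type} [AddCommGroup V] [Module ℂ V] [AddCommGroup W]
    [Module ℂ W] (ρ : UqT p →ₐ[ℂ] Module.End ℂ V) (σ : UqT p →ₐ[ℂ] Module.End ℂ W)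
    {x : V ⊗[ℂ] W} {c : ℂ} (h : tensorRep ρ σ (UqT.K p) x = c • x) (m : ℤ) :
    tensorRep ρ σ (wtProj p m (UqT.K p)) x = wtProj p m c • x := by
  rw [map_wtProj (tensorRep ρ σ), wtProj_apply h]

lemma trForm_mul_eq_zero_of_right {V : Type} [AddCommGroup V] [Module ℂ V]
    (ρ : UqT p →ₐ[ℂ] Module.End ℂ V) (x : UqT p) {y : UqT p} (h : ρ y = 0) :
    trForm ρ (x * y) = 0 := by
  rw [trForm_apply, map_mul ρ, h, mul_zero, map_zero]

/-- The idempotent e_m acts by 0 on a tensor product in which the weight q^m does not occur. -/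
lemma chi_mul_chi_idem_eq_zero (α β : ℤˣ) {s t : ℕ} (hs : s ≤ p) (ht : t ≤ p) (m : ℤ)
    (h : ∀ i < s, ∀ k < t,
      wt p α (s - 1 - 2 * (i : ℤ)) * wt p β (t - 1 - 2 * (k : ℤ)) ≠ q p ^ m) (j : ℕ) :
    (chi p α s * chi p β t).1.ofConv (Uq.C p ^ j * Uq.idem p m) = 0 := by
  have e : Uq.C p ^ j * Uq.idem p m = UqT.toUq p (UqT.C p ^ j * wtProj p m (UqT.K p)) := by
    rw [map_mul, map_pow, Uq.toUq_C, map_wtProj, UqT.toUq_K, Uq.idem]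
  rw [e, ← pull_apply, pull_mul, pull_chi hs, pull_chi ht, ← trForm_tensorRep]
  refine trForm_mul_eq_zero_of_right _ _ ?_
  refine TensorProduct.ext ?_
  refine Finsupp.lhom_ext' fun i => LinearMap.ext_ring <| Finsupp.lhom_ext' fun k =>
    LinearMap.ext_ring ?_
  have hv : tensorRep ((simpleRep p α s hs).comp (UqT.toUq p)) ((simpleRep p β t ht).comp
      (UqT.toUq p)) (UqT.K p) (Finsupp.single i 1 ⊗ₜ Finsupp.single k 1)
      = (wt p α (s - 1 - 2 * (i : ℤ)) * wt p β (t - 1 - 2 * (k : ℤ)))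
        • (Finsupp.single i (1 : ℂ) ⊗ₜ[ℂ] Finsupp.single k (1 : ℂ)) := by
    rw [tensorRep_K, TensorProduct.map_tmul, AlgHom.comp_apply, AlgHom.comp_apply, UqT.toUq_K,
      simpleRep_K, simpleRep_K, TensorProduct.smul_tmul_smul]
  refine (tensorRep_wtProj_apply _ _ hv m).trans ?_
  rw [wtProj_complex, if_neg (h i i.2 k k.2), zero_smul]
  · rfl
  · rw [mul_pow, wt_pow p (NeZero.ne p), wt_pow p (NeZero.ne p), one_mul]

lemma chi_apply_K_pow (hp : 2 ≤ p) {s : ℕ} (h : s ≤ p) (n : ℕ) :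
    (chi p 1 s).1.ofConv (Uq.K p ^ n) = ∑ i ∈ Finset.range s, (q p ^ n) ^ ((s : ℤ) - 1 - 2 * i) := by
  have := chi_cartan 1 h hp 0 n
  rw [pow_zero, pow_zero, one_mul, one_mul] at this
  rw [this]
  refine Finset.sum_congr rfl fun i _ => ?_
  rw [wt_one, ← zpow_natCast, ← zpow_natCast, ← zpow_mul, ← zpow_mul, mul_comm]

lemma char_mul_char_two {x : ℂ} (hx : x ≠ 0) (s : ℕ) :
    (∑ i ∈ Finset.range (s + 1), x ^ (((s + 1 : ℕ) : ℤ) - 1 - 2 * i))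
      * (∑ i ∈ Finset.range 2, x ^ (((2 : ℕ) : ℤ) - 1 - 2 * i))
    = ∑ i ∈ Finset.range s, x ^ ((s : ℤ) - 1 - 2 * i)
      + ∑ i ∈ Finset.range (s + 2), x ^ (((s + 2 : ℕ) : ℤ) - 1 - 2 * i) := by
  have e : ∑ i ∈ Finset.range 2, x ^ (((2 : ℕ) : ℤ) - 1 - 2 * i) = x + x⁻¹ := by
    rw [Finset.sum_range_succ, Finset.sum_range_one]
    norm_num
  have e1 : (∑ i ∈ Finset.range (s + 1), x ^ (((s + 1 : ℕ) : ℤ) - 1 - 2 * i)) * x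
      = ∑ i ∈ Finset.range (s + 1), x ^ (((s + 2 : ℕ) : ℤ) - 1 - 2 * i) := by
    rw [Finset.sum_mul]
    refine Finset.sum_congr rfl fun i _ => ?_
    rw [← zpow_add_one₀ hx]; congr 1; push_cast; ring
  have e2 : (∑ i ∈ Finset.range (s + 1), x ^ (((s + 1 : ℕ) : ℤ) - 1 - 2 * i)) * x⁻¹
      = ∑ i ∈ Finset.range s, x ^ ((s : ℤ) - 1 - 2 * i)
        + x ^ (((s + 2 : ℕ) : ℤ) - 1 - 2 * (s + 1 : ℕ)) := by
    rw [Finset.sum_mul, Finset.sum_range_succ]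
    refine congrArg₂ (· + ·) (Finset.sum_congr rfl fun i _ => ?_) ?_ <;>
    · rw [← zpow_sub_one₀ hx]; congr 1; push_cast; ring
  rw [e, mul_add, e1, e2, Finset.sum_range_succ _ (s + 1)]
  ring

lemma not_two_p_dvd {d : ℤ} (h1 : d < 0) (h2 : -(2 * p) < d) : ¬ (2 * p : ℤ) ∣ d := fun h => by
  have := Int.eq_zero_of_abs_lt_dvd h (by rw [abs_lt]; constructor <;> omega)
  omega

/-- Multiplication of a character by `χ⁺₂`, far from the boundary. -/
lemma chi_mul_chi_two_of_lt (hp : 2 ≤ p) {s : ℕ} (h1 : 0 < s) (h2 : s + 2 ≤ p) :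
    chi p 1 s * chi p 1 2 = chi p 1 (s - 1) + chi p 1 (s + 1) := by
  obtain ⟨s, rfl⟩ := Nat.exists_eq_succ_of_ne_zero h1.ne'
  have hp0 := NeZero.ne p
  rw [← sub_eq_zero]
  -- With s' = s + 1 the factor's index, all exponents involved lie between -s' and s', so s' + 1
  -- and s' + 2 are not weights modulo 2p; the latter needs 2s' + 2 < 2p, that is s' + 2 ≤ p. The
  -- values on the K^n agree by the character identity.
  refine SLF.eq_zero_of_idem hp (a := s + 1 + 2) (b := s + 1 + 1) ?_ ⟨0, by ring⟩
    (fun j => ?_) (fun j => ?_)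
  · intro m
    rw [SLF.apply_idem_of_K_pow, SLF.apply_idem_of_K_pow]
    all_goals
      intro n
      rw [SLF.sub_apply, SLF.add_apply, SLF.mul_apply_K_pow, chi_apply_K_pow hp (by omega),
        chi_apply_K_pow hp (by omega), chi_apply_K_pow hp (by omega),
        chi_apply_K_pow hp (by omega), sub_eq_zero]
      exact char_mul_char_two (pow_ne_zero _ (q_ne_zero p)) s
  all_goals
    rw [SLF.sub_apply, SLF.add_apply, chi_mul_chi_idem_eq_zero, chi_idem hp _ (by omega),
      chi_idem hp _ (by omega), Finset.sum_eq_zero, Finset.sum_eq_zero]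
    · simp
    · intro i hi
      have hi := Finset.mem_range.mp hi
      rw [if_neg]
      rw [wt_one, q_zpow_eq_iff hp0]
      exact not_two_p_dvd (by omega) (by omega)
    · intro i hi
      have hi := Finset.mem_range.mp hi
      rw [if_neg]
      rw [wt_one, q_zpow_eq_iff hp0]
      exact not_two_p_dvd (by omega) (by omega)
    · omega
    · omega
    · intro i hi k hk
      rw [wt_one, wt_one, ← zpow_add₀ (q_ne_zero p), Ne, q_zpow_eq_iff hp0]
      exact not_two_p_dvd (by omega) (by omega)

/-- Multiplication of a character by `χ⁺₂`. -/
lemma chi_mul_chi_two (hp : 2 ≤ p) (α : ℤˣ) {s : ℕ} (h1 : 0 < s) (h2 : s < p) :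
    chi p α s * chi p 1 2 = chi p α (s - 1) + chi p α (s + 1) := by
  have hneg : chi p 1 s * chi p 1 2 = chi p 1 (s - 1) + chi p 1 (s + 1) →
      chi p (-1) s * chi p 1 2 = chi p (-1) (s - 1) + chi p (-1) (s + 1) := fun h => by
    rw [← chi_neg_one_one_mul_chi hp 1 h2.le, mul_assoc, h, mul_add,
      chi_neg_one_one_mul_chi hp 1 (by omega), chi_neg_one_one_mul_chi hp 1 (by omega)]
  have hpos : chi p 1 s * chi p 1 2 = chi p 1 (s - 1) + chi p 1 (s + 1) := by
    by_cases hs : s + 2 ≤ p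
    · exact chi_mul_chi_two_of_lt hp h1 hs
    · obtain rfl : s = p - 1 := by omega
      -- For s = p - 1 the weight argument breaks down. At a = η the deformed identity reads (χ^+_1
      -- + χ^-_{p-1})χ^+_2 = χ^+_2 + χ^-_{p-2} + χ^-_p; cancelling χ^+_2 and multiplying by χ^-_1
      -- leaves the claim.
      have h0 := formMul_phi_chi_two hp ((1 : ℕ) * logq p)
      rw [show (1 : ℕ) * logq p + logq p = (2 : ℕ) * logq p by push_cast; ring,
        show (1 : ℕ) * logq p - logq p = (0 : ℕ) * logq p by push_cast; ring,
        phi_nat hp 1 (by omega), phi_nat hp 2 (by omega), phi_nat hp 0 (by omega), ← pull_mul,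
        ← pull_add] at h0
      have h := pull_injective h0
      rw [chi_zero, add_mul, chi_one_one hp, one_mul, zero_add, add_assoc] at h
      have h3 := congrArg (chi p (-1) 1 * ·) (add_left_cancel h)
      simp only [mul_add, ← mul_assoc] at h3
      rw [chi_neg_one_one_mul_chi hp _ (by omega), chi_neg_one_one_mul_chi hp _ (by omega),
        chi_neg_one_one_mul_chi hp _ (by omega), neg_neg] at h3
      rw [h3, show p - 1 - 1 = p - 2 by omega, show p - 1 + 1 = p by omega, Nat.sub_zero]
  rcases Int.units_eq_one_or α with rfl | rfl
  · exact hpos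
  · exact hneg hpos

/-- At a = pη the form `phi` is χ^+_p alone. Periodicity and evenness identify its values at (p+1)η
and (p-1)η, whence the factor 2. -/
lemma chi_p_mul_chi_two (hp : 2 ≤ p) (α : ℤˣ) :
    chi p α p * chi p 1 2 = (2 : ℂ) • chi p α (p - 1) + (2 : ℂ) • chi p (-α) 1 := by
  have hpos : chi p 1 p * chi p 1 2 = (2 : ℂ) • chi p 1 (p - 1) + (2 : ℂ) • chi p (-1) 1 := by
    apply pull_injective
    have h := formMul_phi_chi_two hp (p * logq p)
    have e : phi hp (p * logq p + logq p) = phi hp ((p - 1 : ℕ) * logq p) := by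
      rw [← phi_neg_nat, ← phi_add_two_p hp (-_)]
      congr 1
      rw [Nat.cast_sub (by omega)]; push_cast; ring
    rw [e, show p * logq p - logq p = (p - 1 : ℕ) * logq p by
      rw [Nat.cast_sub (by omega)]; push_cast; ring, phi_nat hp p le_rfl,
      phi_nat hp (p - 1) (by omega), Nat.sub_self, chi_zero, add_zero, ← pull_mul, ← pull_add,
      show p - (p - 1) = 1 by omega] at h
    rw [h, ← two_smul ℂ, smul_add]
  rcases Int.units_eq_one_or α with rfl | rfl
  · exact hpos
  · rw [← chi_neg_one_one_mul_chi hp 1 le_rfl, mul_assoc, hpos, mul_add, mul_smul_comm,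
      mul_smul_comm, chi_neg_one_one_mul_chi hp 1 (by omega),
      chi_neg_one_one_mul_chi hp _ (by omega)]

end

/-! ### Evaluation of symmetric forms on `f(C) e_m` -/

section

variable {p : ℕ} [NeZero p]

/-- The value of a symmetric form at `f(C) e_m`. -/
def SLF.evalPoly (m : ℤ) (f : Polynomial ℂ) : SLF p →ₗ[ℂ] ℂ :=
  SLF.eval (Polynomial.aeval (Uq.C p) f * Uq.idem p m)

lemma SLF.evalPoly_apply (m : ℤ) (f : Polynomial ℂ) (φ : SLF p) : SLF.evalPoly m f φ
    = φ.1.ofConv (Polynomial.aeval (Uq.C p) f * Uq.idem p m) := rfl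

lemma SLF.evalPoly_add (m : ℤ) (f g : Polynomial ℂ) (φ : SLF p) :
    SLF.evalPoly m (f + g) φ = SLF.evalPoly m f φ + SLF.evalPoly m g φ := by
  rw [evalPoly_apply, map_add, add_mul, map_add]; rfl

lemma SLF.evalPoly_smul (m : ℤ) (c : ℂ) (f : Polynomial ℂ) (φ : SLF p) :
    SLF.evalPoly m (c • f) φ = c * SLF.evalPoly m f φ := by
  rw [evalPoly_apply, map_smul, smul_mul_assoc, map_smul]; rfl

lemma SLF.evalPoly_X_pow (m : ℤ) (j : ℕ) (φ : SLF p) :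
    SLF.evalPoly m (Polynomial.X ^ j) φ = φ.1.ofConv (Uq.C p ^ j * Uq.idem p m) := by
  rw [evalPoly_apply, map_pow, Polynomial.aeval_X]

/-- To compute a linear function of `f` it suffices to consider the powers of `X`. -/
lemma SLF.evalPoly_induction {P : Polynomial ℂ → Prop} (hX : ∀ j, P (Polynomial.X ^ j))
    (hadd : ∀ f g, P f → P g → P (f + g)) (hsmul : ∀ (c : ℂ) f, P f → P (c • f))
    (f : Polynomial ℂ) : P f := by
  induction f using Polynomial.induction_on' with
  | add f g hf hg => exact hadd f g hf hg
  | monomial n a => rw [← Polynomial.smul_X_eq_monomial]; exact hsmul _ _ (hX n)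

/-- The multiplicity of the weight `q^m` in `𝒳^α(s)`. -/
def mult (p : ℕ) (α : ℤˣ) (s : ℕ) (m : ℤ) : ℂ :=
  ∑ i ∈ Finset.range s, if wt p α (s - 1 - 2 * (i : ℤ)) = q p ^ m then (1 : ℂ) else 0

lemma evalPoly_chi (hp : 2 ≤ p) (α : ℤˣ) {s : ℕ} (h : s ≤ p) (m : ℤ) (f : Polynomial ℂ) :
    SLF.evalPoly m f (chi p α s) = f.eval (sgn α * gam p s) * mult p α s m := by
  induction f using SLF.evalPoly_induction with
  | hX j => rw [SLF.evalPoly_X_pow, chi_idem hp α h, Polynomial.eval_pow, Polynomial.eval_X, mult]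
  | hadd f g hf hg => rw [SLF.evalPoly_add, hf, hg, Polynomial.eval_add]; ring
  | hsmul c f hf => rw [SLF.evalPoly_smul, hf, Polynomial.eval_smul, smul_eq_mul]; ring

lemma G_idem (hp : 2 ≤ p) {s : ℕ} (h1 : 0 < s) (h2 : s < p) (j : ℕ) (m : ℤ) :
    (G p s).1.ofConv (Uq.C p ^ j * Uq.idem p m) = j * gam p s ^ (j - 1)
      * ∑ i ∈ Finset.range p, if (2 * p : ℤ) ∣ s - 1 - 2 * (i : ℤ) - m then (1 : ℂ) else 0 := by
  rw [SLF.apply_mul_idem]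
  simp only [G_cartan hp h1 h2, clsSum, ← q_zpow_eq_iff (NeZero.ne p),
    ← wtProj_complex (q_zpow_pow_two_p (p := p) _)]
  simp only [wtProj, smul_eq_mul, Finset.mul_sum, mul_pow]
  rw [Finset.sum_comm]
  refine Finset.sum_congr rfl fun i _ => Finset.sum_congr rfl fun c _ => ?_
  ring

lemma evalPoly_G (hp : 2 ≤ p) {s : ℕ} (h1 : 0 < s) (h2 : s < p) (m : ℤ) (f : Polynomial ℂ) :
    SLF.evalPoly m f (G p s) = f.derivative.eval (gam p s)
      * ∑ i ∈ Finset.range p, if (2 * p : ℤ) ∣ s - 1 - 2 * (i : ℤ) - m then (1 : ℂ) else 0 := by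
  induction f using SLF.evalPoly_induction with
  | hX j =>
    rw [SLF.evalPoly_X_pow, G_idem hp h1 h2, Polynomial.derivative_X_pow]
    simp
  | hadd f g hf hg =>
    rw [SLF.evalPoly_add, hf, hg, Polynomial.derivative_add, Polynomial.eval_add]; ring
  | hsmul c f hf =>
    rw [SLF.evalPoly_smul, hf, Polynomial.derivative_smul, Polynomial.eval_smul, smul_eq_mul]; ring

lemma evalPoly_sub (hp : 2 ≤ p) (φ : SLF p) (m : ℤ) (f : Polynomial ℂ) :
    SLF.evalPoly (m + 2) f φ - SLF.evalPoly m f φ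
      = f.eval (gam p (m + 1)) * (φ.1.ofConv (Uq.idem p (m + 2)) - φ.1.ofConv (Uq.idem p m)) := by
  induction f using SLF.evalPoly_induction with
  | hX j => rw [SLF.evalPoly_X_pow, SLF.evalPoly_X_pow, SLF.idem_sub hp, Polynomial.eval_pow,
      Polynomial.eval_X]
  | hadd f g hf hg =>
    rw [SLF.evalPoly_add, SLF.evalPoly_add, Polynomial.eval_add]; linear_combination hf + hg
  | hsmul c f hf =>
    rw [SLF.evalPoly_smul, SLF.evalPoly_smul, Polynomial.eval_smul, smul_eq_mul]
    linear_combination c * hf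

/-! ### The linear independence of the GTA basis -/

/-- The polynomials with given values at the eigenvalues of the Casimir element. -/
def sep (p s : ℕ) : Polynomial ℂ :=
  Lagrange.basis (Finset.range (p + 1)) (fun t : ℕ => gam p t) s

lemma eval_sep (hp : 2 ≤ p) {s t : ℕ} (hs : s ≤ p) (ht : t ≤ p) :
    (sep p s).eval (gam p t) = if t = s then 1 else 0 := by
  split_ifs with h
  · subst h
    refine Lagrange.eval_basis_self (v := fun t : ℕ => gam p t) ?_
      (Finset.mem_range.mpr (by omega))
    intro a ha b hb hab
    have ha := Finset.mem_range.mp (Finset.mem_coe.mp ha)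
    have hb := Finset.mem_range.mp (Finset.mem_coe.mp hb)
    exact_mod_cast gam_injOn hp (by omega) (by omega) (by omega) (by omega) hab
  · exact Lagrange.eval_basis_of_ne (v := fun t : ℕ => gam p t) (Ne.symm h)
      (Finset.mem_range.mpr (by omega))

/-- The block of `𝒳^α(s)`. -/
def blk (p : ℕ) (α : ℤˣ) (s : ℕ) : ℕ := if α = 1 then s else p - s

lemma blk_le (α : ℤˣ) {s : ℕ} (h : s ≤ p) : blk p α s ≤ p := by
  rw [blk]; split_ifs <;> omega

lemma sgn_mul_gam (α : ℤˣ) {s : ℕ} (h : s ≤ p) : sgn α * gam p s = gam p (blk p α s) := by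
  rcases Int.units_eq_one_or α with rfl | rfl
  · simp [blk, sgn]
  · rw [blk, if_neg (by decide), Nat.cast_sub h, gam_p_sub (NeZero.ne p), sgn]; simp

/-- The exponent of the highest weight of `𝒳^α(s)`. -/
def top (p : ℕ) (α : ℤˣ) (s : ℕ) : ℤ := if α = 1 then (s : ℤ) - 1 else s - 1 + p

lemma wt_eq_zpow (α : ℤˣ) (m : ℤ) : wt p α m = q p ^ (if α = 1 then m else m + p) := by
  rcases Int.units_eq_one_or α with rfl | rfl
  · simp [wt, sgn]
  · rw [wt_neg p (NeZero.ne p), wt_one, if_neg (by decide)]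

lemma mult_top (α : ℤˣ) {s : ℕ} (h0 : 0 < s) (h : s ≤ p) : mult p α s (top p α s) = 1 := by
  rw [mult, Finset.sum_eq_single_of_mem 0 (Finset.mem_range.mpr h0)]
  · rw [if_pos]
    rw [wt_eq_zpow, top]
    simp
  · intro i hi hi0
    have hi := Finset.mem_range.mp hi
    rw [if_neg]
    rw [wt_eq_zpow, top, q_zpow_eq_iff (NeZero.ne p)]
    split_ifs <;> exact not_two_p_dvd (by omega) (by omega)

/-- Within a block the only possible other simple module is 𝒳^{-α}(p-s), whose weights are
complementary to those of 𝒳^α(s) in the parity class. -/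
lemma mult_top_of_ne {α β : ℤˣ} {s t : ℕ} (h0 : 0 < s) (h : s ≤ p) (ht : t ≤ p)
    (hb : blk p α s = blk p β t) (hne : (α, s) ≠ (β, t)) : mult p β t (top p α s) = 0 := by
  have hd : ∀ d : ℤ, 0 < d → d < 2 * p → ¬ (2 * p : ℤ) ∣ d := fun d h1 h2 h3 =>
    not_two_p_dvd (p := p) (d := -d) (by omega) (by omega) (by rwa [dvd_neg])
  refine Finset.sum_eq_zero fun i hi => ?_
  have hi := Finset.mem_range.mp hi
  rw [if_neg]
  rw [wt_eq_zpow, top, q_zpow_eq_iff (NeZero.ne p)]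
  rcases Int.units_eq_one_or α with rfl | rfl <;> rcases Int.units_eq_one_or β with rfl | rfl
  all_goals simp only [blk, show ¬((-1 : ℤˣ) = 1) by decide, if_true, if_false] at hb ⊢
  · simp [hb] at hne
  · exact hd _ (by omega) (by omega)
  · exact not_two_p_dvd (by omega) (by omega)
  · have : s = t := by omega
    simp [this] at hne

/-- The elements of the GTA basis. -/
def gta (p : ℕ) [NeZero p] : (ℤˣ × Fin p) ⊕ Fin (p - 1) → SLF p :=
  Sum.elim (fun x => chi p x.1 (x.2 + 1)) fun i => G p (i + 1)

/-- A relation is evaluated at f(C) e_m: characters see the values of f at the γ_t, the G_s see its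
derivatives, and m separates the two simple modules of a block. -/
lemma linearIndependent_gta (hp : 2 ≤ p) : LinearIndependent ℂ (gta p) := by
  have hiff := (Fintype.linearIndependent_iff (R := ℂ) (M := SLF p) (v := gta p)).mpr
  refine hiff fun g hg => ?_
  rw [Fintype.sum_sum_type] at hg
  have key : ∀ m f, ∑ x : ℤˣ × Fin p, g (Sum.inl x) * ((f : Polynomial ℂ).eval
        (gam p (blk p x.1 (x.2 + 1))) * mult p x.1 (x.2 + 1) m)
      + ∑ i : Fin (p - 1), g (Sum.inr i) * (f.derivative.eval (gam p (i + 1 : ℕ))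
        * ∑ k ∈ Finset.range p,
          if (2 * p : ℤ) ∣ (i + 1 : ℕ) - 1 - 2 * (k : ℤ) - m then (1 : ℂ) else 0) = 0 := by
    intro m f
    have := congrArg (SLF.evalPoly m f) hg
    rw [map_add, map_sum, map_sum, map_zero] at this
    refine Eq.trans ?_ this
    refine congrArg₂ (· + ·) (Finset.sum_congr rfl fun x _ => ?_)
      (Finset.sum_congr rfl fun i _ => ?_)
    · rw [map_smul, gta, Sum.elim_inl, evalPoly_chi hp _ x.2.2, sgn_mul_gam _ x.2.2, smul_eq_mul]
    · rw [map_smul, gta, Sum.elim_inr, evalPoly_G hp (by omega) (by omega), smul_eq_mul]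
  have hG : ∀ i, g (Sum.inr i) = 0 := by
    intro i
    -- This f vanishes at every γ_t, so the characters drop out; its derivative is 1 at γ_{i+1} and
    -- 0 at the other γ_t. The exponent m = i is the highest weight of 𝒳^+(i+1), so it occurs
    -- exactly once.
    have h := key i ((Polynomial.X - Polynomial.C (gam p (i + 1 : ℕ))) * sep p (i + 1) ^ 2)
    rw [Finset.sum_eq_zero, zero_add, Finset.sum_eq_single_of_mem i (Finset.mem_univ _),
      Finset.sum_eq_single_of_mem 0 (Finset.mem_range.mpr (by omega))] at h
    · have := eval_sep hp (s := i + 1) (t := i + 1) (by omega) (by omega)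
      rw [if_pos rfl] at this
      push_cast at this
      simpa [this] using h
    · intro k hk hk0
      have hk := Finset.mem_range.mp hk
      rw [if_neg]
      exact not_two_p_dvd (by omega) (by omega)
    · intro t _ hti
      have hti' : (t : ℕ) + 1 ≠ i + 1 := fun h => hti (Fin.ext (by omega))
      have := eval_sep hp (s := i + 1) (t := t + 1) (by omega) (by omega)
      rw [if_neg hti'] at this
      push_cast at this
      simp [this, pow_two]
    · intro x _
      have := eval_sep hp (s := i + 1) (t := blk p x.1 (x.2 + 1)) (by omega) (blk_le _ x.2.2)
      rw [Polynomial.eval_mul, Polynomial.eval_pow, this]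
      split_ifs with h0
      · simp [h0]
      · simp
  rintro (⟨α, s⟩ | i)
  · have h := key (top p α (s + 1)) (sep p (blk p α (s + 1)))
    rw [Finset.sum_eq_single_of_mem (α, s) (Finset.mem_univ _)] at h
    · rw [eval_sep hp (blk_le _ s.2) (blk_le _ s.2), if_pos rfl, mult_top α (by omega) s.2,
        mul_one, mul_one] at h
      simpa [hG] using h
    · rintro ⟨β, t⟩ _ hne
      rw [eval_sep hp (blk_le _ s.2) (blk_le _ t.2)]
      split_ifs with hb
      · rw [mult_top_of_ne (by omega) s.2 t.2 hb.symm]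
        · simp
        · intro h
          apply hne
          simp only [Prod.mk.injEq] at h
          exact Prod.ext h.1.symm (Fin.ext (Nat.succ.inj h.2).symm)
      · simp
  · exact hG i

/-! ### The dimension of the space of symmetric linear forms -/

namespace Uq

lemma idem_add_two_p (m : ℤ) : idem p (m + 2 * p) = idem p m := by
  have : q p ^ (-(m + 2 * p)) = q p ^ (-m) :=
    (q_zpow_eq_iff (NeZero.ne p) _ _).mpr ⟨-1, by ring⟩
  rw [idem, wtProj, this]; rfl

lemma E_pow_mul_idem (m : ℤ) (k : ℕ) : E p ^ k * idem p m = idem p (m + 2 * k) * E p ^ k := by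
  induction k generalizing m with
  | zero => simp
  | succ k ih =>
    rw [pow_succ, mul_assoc, E_mul_idem, ← mul_assoc, ih, mul_assoc]
    congr 2; push_cast; ring

/-- The innermost FE in F^{k+1}E^{k+1}e_m acts at weight m + 2k, where it is C - γ_{m+2k+1}. For k =
p the right side vanishes, giving a monic relation of degree p for C at each weight. -/
lemma prod_C_sub_gam_mul_idem (hp : 2 ≤ p) (m : ℤ) (k : ℕ) :
    Polynomial.aeval (C p) (∏ i ∈ Finset.range k,
      (Polynomial.X - Polynomial.C (gam p (m + 2 * (i : ℤ) + 1)))) * idem p m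
      = F p ^ k * E p ^ k * idem p m := by
  induction k with
  | zero => simp
  | succ k ih =>
    have hC : Commute (C p - algebraMap ℂ (Uq p) (gam p (m + 2 * (k : ℤ) + 1))) (F p ^ k) :=
      (C_comm hp _).sub_left (Algebra.commute_algebraMap_left _ _)
    rw [Finset.prod_range_succ, mul_comm (∏ i ∈ _, _), map_mul, mul_assoc, ih, map_sub,
      Polynomial.aeval_X, Polynomial.aeval_C, ← mul_assoc, ← mul_assoc, hC.eq, pow_succ (F p),
      pow_succ' (E p), mul_assoc _ (E p ^ k), E_pow_mul_idem]
    simp only [mul_assoc]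
    rw [E_pow_mul_idem, ← mul_assoc (F p) (E p), ← mul_assoc (F p * E p), FE_mul_idem, sub_mul,
      ← mul_assoc (C p), sub_mul, Algebra.smul_def, mul_assoc (algebraMap _ _ _)]

end Uq

/-- The values of a symmetric form at the `C^j e_m` are determined by those with `j < p`. -/
lemma apply_C_pow_mul_idem_eq_zero (hp : 2 ≤ p) {φ : SLF p} {m : ℤ}
    (h : ∀ j < p, φ.1.ofConv (Uq.C p ^ j * Uq.idem p m) = 0) (j : ℕ) :
    φ.1.ofConv (Uq.C p ^ j * Uq.idem p m) = 0 := by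
  set P : Polynomial ℂ := ∏ i ∈ Finset.range p,
    (Polynomial.X - Polynomial.C (gam p (m + 2 * (i : ℤ) + 1))) with hP
  have hmon : P.Monic := Polynomial.monic_prod_of_monic _ _ fun i _ => Polynomial.monic_X_sub_C _
  have hdeg : P.natDegree = p := by
    rw [hP, Polynomial.natDegree_prod_of_monic _ _ fun i _ => Polynomial.monic_X_sub_C _]
    simp
  -- E^p = 0 makes P(C) e_m = 0, so every power of C may be reduced modulo P to degree less than p.
  have hP0 : ∀ f, SLF.evalPoly m (P * f) φ = 0 := fun f => by
    rw [SLF.evalPoly_apply, mul_comm, map_mul (Polynomial.aeval _), mul_assoc, Uq.prod_C_sub_gam_mul_idem hp,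
      (Uq.relations p).E_pow]
    simp
  have hlt : ∀ f : Polynomial ℂ, f.natDegree < p → SLF.evalPoly m f φ = 0 := fun f hf => by
    rw [SLF.evalPoly_apply, f.as_sum_range' p hf, map_sum, Finset.sum_mul, map_sum]
    refine Finset.sum_eq_zero fun i hi => ?_
    rw [← Polynomial.smul_X_eq_monomial, ← SLF.evalPoly_apply, SLF.evalPoly_smul,
      SLF.evalPoly_X_pow, h i (Finset.mem_range.mp hi), mul_zero]
  rw [← SLF.evalPoly_X_pow, ← Polynomial.modByMonic_add_div (Polynomial.X ^ j) P,
    SLF.evalPoly_add, hP0, add_zero, hlt]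
  have := Polynomial.natDegree_modByMonic_lt (Polynomial.X ^ j) hmon
    (fun h1 => by rw [h1] at hdeg; simp at hdeg; omega)
  omega

/-- The differences of the values of a symmetric form at neighbouring weight idempotents. -/
def SLF.jump (n : ℤ) : SLF p →ₗ[ℂ] ℂ := SLF.eval (Uq.idem p (n + 1)) - SLF.eval (Uq.idem p (n - 1))

lemma SLF.jump_apply (n : ℤ) (φ : SLF p) :
    SLF.jump n φ = φ.1.ofConv (Uq.idem p (n + 1)) - φ.1.ofConv (Uq.idem p (n - 1)) := rfl

/-- By `evalPoly_sub` each term is a difference of values of φ at f(C)e_{n+1} and f(C)e_{n-1};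
around the cycle of 2p weights these differences sum to zero. -/
lemma sum_eval_mul_jump (hp : 2 ≤ p) (φ : SLF p) (f : Polynomial ℂ) :
    ∑ n ∈ Finset.range (2 * p), f.eval (gam p n) * SLF.jump n φ = 0 := by
  have e : ∀ n : ℕ, f.eval (gam p n) * SLF.jump n φ
      = (SLF.evalPoly ((n + 1 : ℕ) : ℤ) f φ - SLF.evalPoly (n : ℤ) f φ)
        + (SLF.evalPoly (((n + 1 : ℕ) : ℤ) - 1) f φ - SLF.evalPoly ((n : ℤ) - 1) f φ) := fun n => by
    have := evalPoly_sub hp φ ((n : ℤ) - 1) f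
    rw [show (n : ℤ) - 1 + 2 = n + 1 by ring, sub_add_cancel] at this
    rw [SLF.jump_apply, ← this]
    push_cast
    rw [add_sub_cancel_right]
    ring
  simp only [e]
  rw [Finset.sum_add_distrib, Finset.sum_range_sub (fun n : ℕ => SLF.evalPoly (n : ℤ) f φ),
    Finset.sum_range_sub (fun n : ℕ => SLF.evalPoly ((n : ℤ) - 1) f φ)]
  have h : ∀ m, SLF.evalPoly (m + 2 * p) f φ = SLF.evalPoly m f φ := fun m => by
    rw [SLF.evalPoly_apply, Uq.idem_add_two_p]; rfl
  have h1 := h 0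
  have h2 := h (-1)
  rw [show (-1 : ℤ) + 2 * p = 2 * p - 1 by ring] at h2
  rw [zero_add] at h1
  push_cast
  rw [h1, h2]
  simp

/-- A symmetric form with `p - 1` vanishing jumps has no jump at all. -/
lemma jump_eq_zero (hp : 2 ≤ p) {φ : SLF p}
    (h : ∀ n : ℕ, 0 < n → n < p → SLF.jump (n : ℤ) φ = 0) (n : ℤ) : SLF.jump n φ = 0 := by
  have hnat : ∀ n < 2 * p, SLF.jump (n : ℤ) φ = 0 := by
    intro n hn
    by_cases hn0 : 0 < n ∧ n < p
    · exact h n hn0.1 hn0.2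
    -- Since γ_n = γ_{2p-n}, the remaining indices 0, p, …, 2p-1 carry pairwise distinct values, so
    -- interpolation in the linear relation isolates each of their jumps.
    set S := (Finset.range (2 * p)).filter fun i => i = 0 ∨ p ≤ i with hS
    have hnS : n ∈ S := by
      rw [hS, Finset.mem_filter, Finset.mem_range]; omega
    have hinj : Set.InjOn (fun i : ℕ => gam p i) S := by
      intro a ha b hb hab
      simp only [hS, Finset.coe_filter, Finset.mem_range, Set.mem_ofPred_eq] at ha hb
      rcases (gam_eq_iff hp a b).mp hab with h | ⟨c, hc⟩
      · have := Int.eq_zero_of_abs_lt_dvd h (by rw [abs_lt]; constructor <;> omega)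
        omega
      · have h1 : c = 0 ∨ c = 1 ∨ 2 ≤ c ∨ c ≤ -1 := by omega
        rcases h1 with rfl | rfl | h1 | h1
        · omega
        · omega
        · have : (2 * p : ℤ) * c ≥ 2 * p * 2 := by gcongr
          omega
        · have : (2 * p : ℤ) * c ≤ 2 * p * (-1) := by gcongr
          omega
    have h0 := sum_eval_mul_jump hp φ (Lagrange.basis S (fun i : ℕ => gam p i) n)
    rw [Finset.sum_eq_single_of_mem n (Finset.mem_range.mpr hn),
      Lagrange.eval_basis_self (v := fun i : ℕ => gam p i) hinj hnS, one_mul] at h0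
    · exact h0
    · intro i hi hin
      by_cases hiS : i ∈ S
      · rw [Lagrange.eval_basis_of_ne (v := fun i : ℕ => gam p i) (Ne.symm hin) hiS, zero_mul]
      · rw [hS, Finset.mem_filter] at hiS
        have hiS : ¬ (i = 0 ∨ p ≤ i) := fun h' => hiS ⟨hi, h'⟩
        rw [h i (by omega) (by omega), mul_zero]
  have hper : Function.Periodic (fun n => SLF.jump n φ) (2 * p : ℤ) := fun n => by
    change SLF.jump (n + 2 * p) φ = SLF.jump n φ
    rw [SLF.jump_apply, SLF.jump_apply, show n + 2 * p + 1 = n + 1 + 2 * p by ring,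
      show n + 2 * p - 1 = n - 1 + 2 * p by ring, Uq.idem_add_two_p, Uq.idem_add_two_p]
  have h2p : (0 : ℤ) < 2 * p := by omega
  obtain ⟨k, hk⟩ := Int.eq_ofNat_of_zero_le (Int.emod_nonneg n h2p.ne')
  have h3 := hnat k (by have := Int.emod_lt_of_pos n h2p; omega)
  have h4 := hper.int_mul (n / (2 * p)) k
  rw [Int.cast_id, ← hk, show n % (2 * p) + n / (2 * p) * (2 * p) = n by
    rw [mul_comm (n / _)]; exact Int.emod_add_mul_ediv _ _, hk] at h4
  exact h4.trans h3

/-- Finitely many values that determine a symmetric form. -/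
def SLF.coords (p : ℕ) [NeZero p] : SLF p →ₗ[ℂ] ((Fin p ⊕ Fin p) ⊕ Fin (p - 1) → ℂ) :=
  LinearMap.pi (Sum.elim (Sum.elim (fun j => SLF.eval (Uq.C p ^ (j : ℕ) * Uq.idem p 0))
    fun j => SLF.eval (Uq.C p ^ (j : ℕ) * Uq.idem p 1)) fun n => SLF.jump ((n + 1 : ℕ) : ℤ))

/-- The p - 1 jumps force all jumps to vanish, so the weights 0 and 1 decide, and there the powers
C^j with j < p suffice. The 2p + (p - 1) coordinates match the size of the GTA basis. -/
lemma SLF.coords_injective (hp : 2 ≤ p) : Function.Injective (SLF.coords p) := by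
  rw [injective_iff_map_eq_zero]
  intro φ h
  have h0 : ∀ j < p, φ.1.ofConv (Uq.C p ^ j * Uq.idem p 0) = 0 := fun j hj =>
    congrFun h (Sum.inl (Sum.inl ⟨j, hj⟩))
  have h1 : ∀ j < p, φ.1.ofConv (Uq.C p ^ j * Uq.idem p 1) = 0 := fun j hj =>
    congrFun h (Sum.inl (Sum.inr ⟨j, hj⟩))
  have h2 : ∀ n : ℕ, 0 < n → n < p → SLF.jump (n : ℤ) φ = 0 := fun n hn hn' => by
    have := congrFun h (Sum.inr ⟨n - 1, by omega⟩)
    rw [show n = n - 1 + 1 by omega]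
    exact this
  refine SLF.eq_zero_of_idem hp (a := 1) (b := 0) (fun m => ?_) ⟨0, by ring⟩
    (apply_C_pow_mul_idem_eq_zero hp h1) (apply_C_pow_mul_idem_eq_zero hp h0)
  have := jump_eq_zero hp h2 (m + 1)
  rw [SLF.jump_apply, sub_eq_zero] at this
  rw [show m + 2 = m + 1 + 1 by ring, this]
  congr 2; ring

lemma finiteDimensional_SLF (hp : 2 ≤ p) : Module.Finite ℂ (SLF p) :=
  Module.Finite.of_injective (SLF.coords p) (SLF.coords_injective hp)

lemma finrank_SLF (hp : 2 ≤ p) :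
    Fintype.card ((ℤˣ × Fin p) ⊕ Fin (p - 1)) = Module.finrank ℂ (SLF p) := by
  have := finiteDimensional_SLF hp
  refine le_antisymm (LinearIndependent.fintype_card_le_finrank (M := SLF p)
    (linearIndependent_gta hp)) ?_
  refine (LinearMap.finrank_le_finrank_of_injective (M := SLF p)
    (SLF.coords_injective hp)).trans ?_
  rw [Module.finrank_fintype_fun_eq_card]
  simp
  omega

/-- A linearly independent family with as many elements as the dimension is a basis. -/
lemma exists_basis_of_linearIndependent {ι V : Type*} [Fintype ι] [Nonempty ι] [AddCommGroup V]
    [Module ℂ V] {b : ι → V} (h : LinearIndependent ℂ b)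
    (hc : Fintype.card ι = Module.finrank ℂ V) : ∃ B : Module.Basis ι ℂ V, ∀ i, B i = b i :=
  ⟨basisOfLinearIndependentOfCardEqFinrank h hc, fun i =>
    congrFun (coe_basisOfLinearIndependentOfCardEqFinrank h hc) i⟩

/-- The GTA basis of the space of symmetric linear forms. -/
lemma exists_gta_basis (hp : 2 ≤ p) :
    ∃ B : Module.Basis ((ℤˣ × Fin p) ⊕ Fin (p - 1)) ℂ (SLF p), ∀ i, B i = gta p i := by
  have hne : Nonempty ((ℤˣ × Fin p) ⊕ Fin (p - 1)) := ⟨Sum.inl (1, 0)⟩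
  have h := exists_basis_of_linearIndependent (V := SLF p) (b := gta p)
  exact h (linearIndependent_gta hp) (finrank_SLF hp)

end

/-! ### Commutativity and the multiplication rules -/

section

variable {p : ℕ} [NeZero p] (hp : 2 ≤ p)
include hp

/-- Linear maps that agree on the GTA basis are equal. -/
lemma SLF.linearMap_ext {M : Type*} [AddCommMonoid M] [Module ℂ M] {f g : SLF p →ₗ[ℂ] M}
    (h1 : ∀ (α : ℤˣ) (s : ℕ), 1 ≤ s → s ≤ p → f (chi p α s) = g (chi p α s))
    (h2 : ∀ s : ℕ, 1 ≤ s → s ≤ p - 1 → f (G p s) = g (G p s)) : f = g := by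
  obtain ⟨B, hB⟩ := exists_gta_basis hp
  refine B.ext fun i => ?_
  rw [hB]
  rcases i with ⟨α, s⟩ | s
  · exact h1 α _ (by omega) s.2
  · exact h2 _ (by omega) (by omega)

lemma SLF.apply_flip (φ : SLF p) (x : Uq p) :
    φ.1.ofConv (Uq.flip p x) = φ.1.ofConv x := by
  have : SLF.eval (Uq.flip p x) = SLF.eval x :=
    SLF.linearMap_ext hp (fun α s _ h => chi_apply_flip hp α h x)
      (fun s h1 h2 => G_apply_flip hp (by omega) (by omega) x)
  exact LinearMap.congr_fun this φ

/-- Every symmetric form is invariant under `flip`, the product φψ included; as `flip` reverses the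
coproduct, (φψ) ∘ `flip` is ψφ. -/
lemma SLF.mul_comm' (φ ψ : SLF p) : φ * ψ = ψ * φ := by
  refine Subtype.ext (WithConv.ofConv_injective (LinearMap.ext fun x => ?_))
  exact (SLF.apply_flip hp (φ * ψ) x).symm.trans
    (mul_apply_flip φ ψ (SLF.apply_flip hp φ) (SLF.apply_flip hp ψ) x)

lemma chi_two_mul_G {s : ℕ} (h1 : 0 < s) (h2 : s < p) : chi p 1 2 * G p s
    = (qInt p (s - 1) / qInt p s) • G p (s - 1) + (qInt p (s + 1) / qInt p s) • G p (s + 1) := by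
  obtain ⟨s, rfl⟩ := Nat.exists_eq_succ_of_ne_zero h1.ne'
  have h := qInt_smul_G_mul_chi_two hp h2
  have h0 : qInt p (s + 1) ≠ 0 := by
    rw [Ne, qInt_eq_zero_iff hp]
    intro h
    have := Int.le_of_dvd (by omega) h
    omega
  rw [SLF.mul_comm' hp, ← inv_smul_smul₀ h0 (G p (s + 1) * chi p 1 2), h, smul_add, smul_smul,
    smul_smul, add_comm]
  simp only [Nat.succ_eq_add_one, Nat.add_sub_cancel]
  push_cast
  rw [add_sub_cancel_right, div_eq_inv_mul, div_eq_inv_mul]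
  congr 3

lemma gtaRules_mul : GTARules p (LinearMap.mul ℂ (SLF p)) where
  unit φ := by rw [LinearMap.mul_apply', chi_one_one hp, one_mul]
  chi_minus_chi α s _ h := by rw [LinearMap.mul_apply', chi_neg_one_one_mul_chi hp α h]
  chi_two_chi α s h1 h2 := by
    rw [LinearMap.mul_apply', SLF.mul_comm' hp, chi_mul_chi_two hp α (by omega) (by omega)]
  chi_two_chi_p α := by rw [LinearMap.mul_apply', SLF.mul_comm' hp, chi_p_mul_chi_two hp]
  chi_two_G_one := by
    rw [LinearMap.mul_apply', chi_two_mul_G hp one_pos (by omega), Nat.sub_self, G_zero, smul_zero,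
      zero_add, Nat.cast_one, qInt_one hp, div_one]
    rfl
  chi_two_G s h1 h2 := by rw [LinearMap.mul_apply', chi_two_mul_G hp (by omega) (by omega)]
  chi_two_G_last := by
    -- The rule at s = p - 1 is the general one with [p-1] = 1, [p-2] = [2] and G_p = 0.
    have e1 : qInt p ((p - 1 : ℕ) : ℤ) = 1 := by
      rw [Nat.cast_sub (by omega), Nat.cast_one, qInt_sub_left (NeZero.ne p), qInt_one hp]
    have e2 : qInt p (((p - 1 : ℕ) : ℤ) - 1) = qInt p 2 := by
      rw [← qInt_sub_left (NeZero.ne p) 2]; congr 1; omega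
    rw [LinearMap.mul_apply', chi_two_mul_G hp (by omega) (by omega), e1, e2,
      show p - 1 + 1 = p by omega, G_p, smul_zero, add_zero, div_one, show p - 1 - 1 = p - 2 by omega]
  chi_minus_G s h1 h2 := by
    rw [LinearMap.mul_apply', chi_neg_one_one_mul_G hp (by omega) (by omega)]
  G_mul_G s t h1 h2 h3 h4 := by
    rw [LinearMap.mul_apply', G_mul_G_eq_zero hp (by omega) (by omega) (by omega) (by omega)]

/-! ### The multiplication rules determine the product -/

/-- The multiplication rules determine a commutative and associative product. -/
lemma eq_mul_of_gtaRules {m : SLF p →ₗ[ℂ] SLF p →ₗ[ℂ] SLF p} (hc : ∀ φ ψ, m φ ψ = m ψ φ)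
    (ha : ∀ φ ψ θ, m (m φ ψ) θ = m φ (m ψ θ)) (hm : GTARules p m) :
    m = LinearMap.mul ℂ (SLF p) := by
  have hr := gtaRules_mul hp
  set μ := LinearMap.mul ℂ (SLF p) with hμ
  have hcμ : ∀ φ ψ, μ φ ψ = μ ψ φ := SLF.mul_comm' hp
  have haμ : ∀ φ ψ θ, μ (μ φ ψ) θ = μ φ (μ ψ θ) := mul_assoc
  have hone : m (chi p 1 1) = μ (chi p 1 1) :=
    LinearMap.ext fun φ => by rw [hm.unit, hr.unit]
  have hneg : m (chi p (-1) 1) = μ (chi p (-1) 1) := by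
    refine SLF.linearMap_ext hp (fun α s h1 h2 => ?_) fun s h1 h2 => ?_
    · rw [hm.chi_minus_chi α s h1 h2, hr.chi_minus_chi α s h1 h2]
    · rw [hm.chi_minus_G s h1 h2, hr.chi_minus_G s h1 h2]
  have htwo : m (chi p 1 2) = μ (chi p 1 2) := by
    refine SLF.linearMap_ext hp (fun α s h1 h2 => ?_) fun s h1 h2 => ?_
    -- The fusion rule starts at s = 2; for s = 1 commutativity turns the product into
    -- multiplication by χ^+_1 or χ^-_1.
    · by_cases hs1 : s = 1
      · subst hs1
        rw [hc, hcμ]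
        rcases Int.units_eq_one_or α with rfl | rfl
        · rw [hone]
        · rw [hneg]
      by_cases hsp : s = p
      · subst hsp
        rw [hm.chi_two_chi_p, hr.chi_two_chi_p]
      · rw [hm.chi_two_chi α s (by omega) (by omega), hr.chi_two_chi α s (by omega) (by omega)]
    · by_cases hs1 : s = 1
      · subst hs1
        rw [hm.chi_two_G_one, hr.chi_two_G_one]
      by_cases hsp : s = p - 1
      · subst hsp
        rw [hm.chi_two_G_last, hr.chi_two_G_last]
      · rw [hm.chi_two_G s (by omega) (by omega), hr.chi_two_G s (by omega) (by omega)]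
  -- By associativity of both products, the elements that multiply everything in the same way under
  -- m and μ are closed under multiplication.
  have hmul : ∀ a b, m a = μ a → m b = μ b → m (μ a b) = μ (μ a b) := fun a b h1 h2 =>
    LinearMap.ext fun φ => by rw [haμ, ← h2, ← h1, ha]
  have hpos : ∀ s, 1 ≤ s → s ≤ p → m (chi p 1 s) = μ (chi p 1 s) := by
    intro s
    induction s using Nat.strong_induction_on with
    | _ s ih =>
      intro h1 h2
      by_cases hs1 : s = 1
      · rw [hs1, hone]
      by_cases hs2 : s = 2
      · rw [hs2, htwo]
      -- The fusion rule expresses χ^+_s as χ^+_2 χ^+_{s-1} - χ^+_{s-2}, so all characters are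
      -- reached from χ^+_1 and χ^+_2.
      have h3 := hr.chi_two_chi 1 (s - 1) (by omega) (by omega)
      rw [show s - 1 + 1 = s by omega, show s - 1 - 1 = s - 2 by omega] at h3
      have h4 := hmul _ _ htwo (ih (s - 1) (by omega) (by omega) (by omega))
      rw [h3, map_add, map_add, ih (s - 2) (by omega) (by omega) (by omega)] at h4
      exact LinearMap.ext fun φ => add_left_cancel (LinearMap.congr_fun h4 φ)
  have hchi : ∀ α s, 1 ≤ s → s ≤ p → m (chi p α s) = μ (chi p α s) := by
    intro α s h1 h2
    rcases Int.units_eq_one_or α with rfl | rfl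
    · exact hpos s h1 h2
    · rw [← hr.chi_minus_chi 1 s h1 h2]
      exact hmul _ _ hneg (hpos s h1 h2)
  refine SLF.linearMap_ext hp hchi fun s h1 h2 => ?_
  -- G_s times a character is settled by commutativity, and G_s G_t vanishes under both products.
  refine SLF.linearMap_ext hp (fun α t h3 h4 => ?_) fun t h3 h4 => ?_
  · rw [hc, hcμ, hchi α t h3 h4]
  · rw [hm.G_mul_G s t h1 h2 h3 h4, hr.G_mul_G s t h1 h2 h3 h4]

end

end RestrictedQuantumGroup

end

theorem mainTheorem12 (p : ℕ) [NeZero p] (hp : 2 ≤ p) :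
    -- the `χ^±_s` (`1 ≤ s ≤ p`) and the `G_s` (`1 ≤ s ≤ p - 1`) form a basis of `SLF(Ū_q)`
    (∃ B : Module.Basis ((ℤˣ × Fin p) ⊕ Fin (p - 1)) ℂ (SLF p),
      (∀ (α : ℤˣ) (i : Fin p), B (Sum.inl (α, i)) = chi p α (i + 1)) ∧
      (∀ i : Fin (p - 1), B (Sum.inr i) = G p (i + 1))) ∧
    -- the algebra `SLF(Ū_q)` is commutative
    (∀ φ ψ : SLF p, φ * ψ = ψ * φ) ∧
    -- its product satisfies the multiplication rules
    GTARules p (LinearMap.mul ℂ (SLF p)) ∧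
    -- and it is the only commutative and associative bilinear product that does
    (∀ m : SLF p →ₗ[ℂ] SLF p →ₗ[ℂ] SLF p,
      (∀ φ ψ : SLF p, m φ ψ = m ψ φ) →
      (∀ φ ψ θ : SLF p, m (m φ ψ) θ = m φ (m ψ θ)) →
      GTARules p m → m = LinearMap.mul ℂ (SLF p)) := by
  refine ⟨?_, SLF.mul_comm' hp, gtaRules_mul hp, fun m hc ha hm => eq_mul_of_gtaRules hp hc ha hm⟩
  obtain ⟨B, hB⟩ := exists_gta_basis hp
  exact ⟨B, fun α i => hB (Sum.inl (α, i)), fun i => hB (Sum.inr i)⟩
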